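/- Let $\mathcal H=L^2((0,1),\mathbb R)\oplus L^2((0,1),\mathbb R)$ with $\|v\|^2=\int_0^1(v_1^2+v_2^2)\,dx$, let $\mathcal H_{\mathbb C}$ be its complexification, and put $$J=\begin{pmatrix}0&1\\-1&0\end{pmatrix},\qquad J_1=\begin{pmatrix}1&0\\0&-1\end{pmatrix},\qquad V=\begin{pmatrix}v_1&v_2\\v_2&-v_1\end{pmatrix}.$$ For $v\in\mathcal H_{\mathbb C}$ and $\lambda\in\mathbb C$ let $\vartheta=(\vartheta_1,\vartheta_2)^\top$ and $\varphi=(\varphi_1,\varphi_2)^\top$ be the solutions of $Jf'+Vf=\lambda f$ on $[0,1]$ with $\vartheta(0,\lambda)=(1,0)^\top$, $\varphi(0,\lambda)=(0,1)^\top$. For $v\in\mathcal H$ let $\nu_n,\tau_n,\varrho_n$ ($n\in\mathbb Z$) be the eigenvalues of $Jf'+Vf=\lambda f$ on $[0,1]$ under the boundary conditions $f_2(0)=f_2(1)=0$, $f_1(0)=f_2(1)=0$, $f_2(0)=f_1(1)=0$ respectively. In each case the eigenvalues are real and form a strictly increasing sequence, labelled so that $\nu_n-\pi n\to0$, $\tau_n-\tau_n^o\to0$,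 $\varrho_n-\varrho_n^o\to0$ as $n\to\pm\infty$, where $\tau_n^o=\varrho_n^o=\pi(n-\tfrac12)$. The norming constants are $$\mathfrak s_n=-\log|\vartheta_1(1,\nu_n)|,\qquad \mathfrak t_n=-\log|\varphi_1(1,\tau_n)|,\qquad \mathfrak u_n=-\log|\vartheta_2(1,\varrho_n)|.$$ Let $(\Phi f)_n=\int_0^1e^{2\pi nxJ}f(x)\,dx$ and $(\mathfrak Ff)(x)=e^{\pi xJ}f(x)$, so that $(\mathfrak F^*f)(x)=e^{-\pi xJ}f(x)$, for $f\in\mathcal H_{\mathbb C}$. Then for every $d\in(1,2)$ $$\begin{pmatrix}\nu_n(v)-\pi n\\ \mathfrak s_n(v)\end{pmatrix}=J_1(\Phi v)_n+\ell^d(n),\quad \begin{pmatrix}\tau_n(v)-\tau_n^o\\ \mathfrak t_n(v)\end{pmatrix}=-J_1(\Phi\mathfrak F^*v)_n+\ell^d(n),\quad \begin{pmatrix}\varrho_n(v)-\varrho_n^o\\ \mathfrak u_n(v)\end{pmatrix}=J_1(\Phi\mathfrak F^*v)_n+\ell^d(n)$$ as $n\to\pm\infty$, uniformly on the ball $\mathcal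 B_{\mathbb C}(u,\varepsilon_u)=\{v\in\mathcal H_{\mathbb C}:\|v-u\|<\varepsilon_u\}$, $\varepsilon_u=4^{-4}e^{-3\|u\|}$, for every $u\in\mathcal H$. This means the following, for each of the three problems. For every $u\in\mathcal H$ there is $N$ such that for each $|n|>N$ the eigenvalue and the norming constant with index $n$, as functions of the real potential, extend analytically from the real points of $\mathcal B_{\mathbb C}(u,\varepsilon_u)$ to the whole ball, and for each $v$ in the ball the extended eigenvalue is the only eigenvalue of the problem for $v$ at distance less than $1$ from its unperturbed value ($\pi n$, $\tau_n^o$, $\varrho_n^o$ respectively). Moreover, for every $d\in(1,2)$ there is a constant $C$ (depending on $u$ and $d$) such that the two components of the remainder, namely the left side minus the term $\pm J_1(\Phi\,\cdot\,)_n$, have sums of $d$-th powers of their moduli bounded by $C$: for each real $v$ in the ball with the sum over all $n\in\mathbb Z$, and for each complex $v$ in the ball with the sum over $|n|>N$. -/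

import Mathlib

open MeasureTheory Set Filter Topology

namespace ZS

noncomputable section

/-- The real space `L²((0,1), ℝ) ⊕ L²((0,1), ℝ)` of potentials `v = (v₁, v₂)`, with
`‖v‖² = ∫₀¹ (v₁² + v₂²)`. -/
abbrev Potential : Type :=
  Lp (EuclideanSpace ℝ (Fin 2)) 2 (volume.restrict (Ioo (0 : ℝ) 1))

/-- The complexification of `Potential`, with `‖v‖² = ∫₀¹ (|v₁|² + |v₂|²)`. -/
abbrev PotentialC : Type :=
  Lp (EuclideanSpace ℂ (Fin 2)) 2 (volume.restrict (Ioo (0 : ℝ) 1))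

/-- The inclusion `ℝ² ⊂ ℂ²`. -/
def ofRealVec : EuclideanSpace ℝ (Fin 2) →L[ℝ] EuclideanSpace ℂ (Fin 2) :=
  LinearMap.toContinuousLinearMap
    { toFun := fun a => WithLp.toLp 2 (fun k => (a k : ℂ))
      map_add' := by intro a b; ext k; simp
      map_smul' := by intro c a; ext k; simp }

/-- A real potential, seen as a complex one. -/
def complexify (v : Potential) : PotentialC := ofRealVec.compLp v

/-- `J`. -/
def J : Matrix (Fin 2) (Fin 2) ℂ := !![0, 1; -1, 0]

/-- `J₁`. -/
def J₁ : Matrix (Fin 2) (Fin 2) ℂ := !![1, 0; 0, -1]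

/-- The matrix exponential `e^{θJ} = cos θ + J sin θ`, for real `θ`. -/
def expJ (θ : ℝ) : Matrix (Fin 2) (Fin 2) ℂ :=
  !![(Real.cos θ : ℂ), (Real.sin θ : ℂ); -(Real.sin θ : ℂ), (Real.cos θ : ℂ)]

/-- The matrix `V(x)` of the potential `v = (v₁, v₂)`. -/
def potMatrix (v : PotentialC) (x : ℝ) : Matrix (Fin 2) (Fin 2) ℂ :=
  !![v x 0, v x 1; v x 1, -v x 0]

/-- `f = (f₁, f₂)` (with components `f x 0`, `f x 1`) is an absolutely continuous solution of
`J f' + V f = z f` on `[0,1]`. -/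
def IsSolution (v : PotentialC) (z : ℂ) (f : ℝ → Fin 2 → ℂ) : Prop :=
  AbsolutelyContinuousOnInterval f 0 1 ∧
    ∀ᵐ x ∂volume.restrict (Ioo (0 : ℝ) 1), ∃ f' : Fin 2 → ℂ, HasDerivAt f f' x ∧
      J.mulVec f' + (potMatrix v x).mulVec (f x) = z • f x

/-- The solution on `[0,1]` with initial value `a` at `0` (it exists and is unique on `[0,1]`). -/
def solution (v : PotentialC) (z : ℂ) (a : Fin 2 → ℂ) : ℝ → Fin 2 → ℂ :=
  Classical.epsilon fun f => IsSolution v z f ∧ f 0 = a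

/-- The fundamental solution `ϑ`, with `ϑ(0) = (1, 0)`. -/
def theta (v : PotentialC) (z : ℂ) : ℝ → Fin 2 → ℂ := solution v z ![1, 0]

/-- The fundamental solution `φ`, with `φ(0) = (0, 1)`. -/
def phi (v : PotentialC) (z : ℂ) : ℝ → Fin 2 → ℂ := solution v z ![0, 1]

/-- The eigenvalues of `J f' + V f = z f` under the boundary conditions that component `i` of `f`
vanishes at `0` and component `j` of `f` vanishes at `1` (components numbered `0`, `1`). -/
def eigenvalues (i j : Fin 2) (v : PotentialC) : Set ℂ :=
  {z | ∃ f, IsSolution v z f ∧ (∃ x ∈ Icc (0 : ℝ) 1, f x ≠ 0) ∧ f 0 i = 0 ∧ f 1 j = 0}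

/-- `s` lists the eigenvalues of a real potential in increasing order, each once, labelled so that
`s n - s₀ n → 0` as `n → ±∞`. There is at most one such `s` when `s₀ (n + 1) - s₀ n = π`. -/
def IsEigenvalueSeq (i j : Fin 2) (s₀ : ℤ → ℝ) (v : Potential) (s : ℤ → ℝ) : Prop :=
  StrictMono s ∧ range (fun n => (s n : ℂ)) = eigenvalues i j (complexify v) ∧
    Tendsto (fun n => s n - s₀ n) cofinite (𝓝 0)

/-- The labelled eigenvalues of a real potential. -/
def eigenvalueSeq (i j : Fin 2) (s₀ : ℤ → ℝ) (v : Potential) : ℤ → ℝ :=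
  Classical.epsilon (IsEigenvalueSeq i j s₀ v)

/-- Unperturbed Neumann eigenvalues `πn`. -/
def nu₀ (n : ℤ) : ℝ := Real.pi * n

/-- Unperturbed mixed eigenvalues `π(n - 1/2)`, the same for both types. -/
def tau₀ (n : ℤ) : ℝ := Real.pi * (n - 1 / 2)

/-- Neumann eigenvalues `ν_n`: `f₂(0) = f₂(1) = 0`. -/
def nu (v : Potential) : ℤ → ℝ := eigenvalueSeq 1 1 nu₀ v

/-- Mixed eigenvalues of the first type `τ_n`: `f₁(0) = f₂(1) = 0`. -/
def tau (v : Potential) : ℤ → ℝ := eigenvalueSeq 0 1 tau₀ v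

/-- Mixed eigenvalues of the second type `ϱ_n`: `f₂(0) = f₁(1) = 0`. -/
def rho (v : Potential) : ℤ → ℝ := eigenvalueSeq 1 0 tau₀ v

/-- `𝔰_n = -log |ϑ₁(1, ν_n)|`. -/
def normS (v : Potential) (n : ℤ) : ℝ := -Real.log ‖theta (complexify v) (nu v n) 1 0‖

/-- `𝔱_n = -log |φ₁(1, τ_n)|`. -/
def normT (v : Potential) (n : ℤ) : ℝ := -Real.log ‖phi (complexify v) (tau v n) 1 0‖

/-- `𝔲_n = -log |ϑ₂(1, ϱ_n)|`. -/
def normU (v : Potential) (n : ℤ) : ℝ := -Real.log ‖theta (complexify v) (rho v n) 1 1‖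

/-- The Fourier transform `(Φf)_n = ∫₀¹ e^{2πnxJ} f(x) dx ∈ ℂ²`. -/
def fourier (f : ℝ → Fin 2 → ℂ) (n : ℤ) : Fin 2 → ℂ := fun k =>
  ∫ x in Ioo (0 : ℝ) 1, (expJ (2 * Real.pi * n * x)).mulVec (f x) k

/-- `𝔉* f`, the adjoint of the multiplication operator `(𝔉f)(x) = e^{πxJ} f(x)`. -/
def gaugeAdjoint (f : ℝ → Fin 2 → ℂ) : ℝ → Fin 2 → ℂ := fun x =>
  (expJ (Real.pi * x)).conjTranspose.mulVec (f x)

/-- The complex ball around the real potential `u` of radius `4⁻⁴ e^{-3‖u‖}`. -/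
def complexBall (u : Potential) : Set PotentialC :=
  Metric.ball (complexify u) ((1 / 4 ^ 4) * Real.exp (-3 * ‖u‖))

/-- The asymptotics `(s_n(v) - s₀_n, c_n(v)) = M_n(v) + ℓ^d(n)` for every `d ∈ (1,2)`, uniformly
on every ball `complexBall u`. Here `s`, `c` are the eigenvalues and the norming constants of real
potentials for the boundary conditions `i`, `j`, and `M` is the main term.

For complex potentials and large `|n|` the data `s_n`, `c_n` are understood through their
(necessarily unique) analytic continuations `sC n`, `cC n` to the ball, and `sC n v` is the only
eigenvalue of `v` at distance less than `1` from `s₀ n`. A sequence is `ℓ^d(n)` uniformly if the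
`d`-th powers of its moduli have sums with a common bound; for real potentials the sums run over
all `n ∈ ℤ`, for complex ones over all `n` with `|n| > N`. -/
def UniformAsymptotics (i j : Fin 2) (s₀ : ℤ → ℝ) (s c : Potential → ℤ → ℝ)
    (M : PotentialC → ℤ → Fin 2 → ℂ) : Prop :=
  (∀ v, IsEigenvalueSeq i j s₀ v (s v)) ∧
  ∀ u : Potential, ∃ (N : ℕ) (sC cC : ℤ → PotentialC → ℂ),
    (∀ n : ℤ, (N : ℤ) < |n| →
      AnalyticOnNhd ℂ (sC n) (complexBall u) ∧ AnalyticOnNhd ℂ (cC n) (complexBall u) ∧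
      (∀ w : Potential, complexify w ∈ complexBall u →
        sC n (complexify w) = s w n ∧ cC n (complexify w) = c w n) ∧
      ∀ v ∈ complexBall u,
        eigenvalues i j v ∩ Metric.ball (s₀ n : ℂ) 1 = {sC n v}) ∧
    ∀ d : ℝ, 1 < d → d < 2 → ∃ C : ℝ,
      (∀ w : Potential, complexify w ∈ complexBall u → ∀ F : Finset ℤ,
        ∑ n ∈ F, (‖((s w n - s₀ n : ℝ) : ℂ) - M (complexify w) n 0‖ ^ d +
          ‖(c w n : ℂ) - M (complexify w) n 1‖ ^ d) ≤ C) ∧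
      ∀ v ∈ complexBall u, ∀ F : Finset ℤ, (∀ n ∈ F, (N : ℤ) < |n|) →
        ∑ n ∈ F, (‖sC n v - s₀ n - M v n 0‖ ^ d + ‖cC n v - M v n 1‖ ^ d) ≤ C

end

end ZS

namespace ZS

/-! ### Primitives of integrable functions on `[0,1]` -/

section Primitives

variable {E : Type*} [NormedAddCommGroup E] [NormedSpace ℝ E]

/-! In the eigenbasis of J, with a = f₁ - i f₂ and b = f₁ + i f₂, the equation becomes a' = -iλa +
qb, b' = iλb + pa, where q = v₂ + i v₁ and p = v₂ - i v₁ (`isSystem_of_isSolution`,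
`isSolution_of_isSystem`). The solution ϑ has a(0) = b(0) = 1. The Neumann eigenvalues are the zeros
of a(1) - b(1), and at such a zero ϑ₁(1) is the common value of a(1) and b(1). The pair (a, b) is
obtained by inverting 1 minus a Volterra operator that is linear in (v, λ), hence it is analytic in
both (`analyticAt_sysSol`).

Put λ = πn + δ and remove the diagonal: A = e^{iλx}a and B = e^{-iλx}b satisfy A' = QB, B' = PA with
Q = q e^{2πinx} e^{2iδx}. Integrating the oscillating coefficient by parts gives A(1) = 1 + (Fourier
coefficient of q) + (iterated Fourier integral `D0`) + error, where the error is quadratic in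
partial Fourier integrals or is δ times such an integral (`system_expansion`). At an eigenvalue δ is
itself of first order, and Bessel's inequality, applied to truncations of q and p, makes the
quadratic errors summable in n, uniformly on bounded sets.

The iterated integral is what restricts d. By Parseval it is, up to products of Fourier
coefficients, the convolution of an ℓ¹ sequence of products of Fourier coefficients of p and q with
the kernel 1/(k - n), which lies in ℓᵈ for every d > 1 (`norm_D0_le`,
`sum_rpow_tsum_hilbertKernel_le`). Solving a(1) = b(1) to second order (`zero_expansion`) leaves
linear terms that are exactly the two components of J₁Φv (`fourier_eq`).

For real v the number b is a conjugate of a, and its argument is a Prüfer angle: it is strictly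
increasing in λ, stays within ‖v‖ of λ at x = 1, and takes the values πn exactly at the eigenvalues
(`strictMono_angle`, `range_nuSeq`). For complex v in the ball, the radius is small enough to keep
ϑ(1, ·) near that of the center, so that for large |n| the second component, up to sign, is within
1/20 of sin δ on a disc (`norm_sol_sub_le`, `exists_norm_theta_sub_le`). A contraction then gives a
single zero (`exists_zero_of_near_sin`), and the implicit function theorem makes it analytic in v
(`analyticAt_of_implicit`).

The mixed problems need no new analysis. Multiplication by e^{-πxJ} is an isometry that shifts λ by
π/2 and turns the problem for ϱ into the one for ν; the map f ↦ Jf replaces v by -v and exchanges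
the two mixed problems (`UniformAsymptotics.transfer`). -/

theorem absolutelyContinuousOnInterval_of_dist_le {X Y : Type*} [PseudoMetricSpace X]
    [PseudoMetricSpace Y] {f : ℝ → X} {g : ℝ → Y} {a b C : ℝ}
    (hg : AbsolutelyContinuousOnInterval g a b)
    (h : ∀ x ∈ uIcc a b, ∀ y ∈ uIcc a b, dist (f x) (f y) ≤ C * dist (g x) (g y)) :
    AbsolutelyContinuousOnInterval f a b := by
  have h0 := Tendsto.const_mul C hg
  rw [mul_zero] at h0
  refine squeeze_zero' (Eventually.of_forall fun E => Finset.sum_nonneg fun i _ => dist_nonneg)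
    ?_ h0
  have hE : ∀ᶠ E : ℕ × (ℕ → ℝ × ℝ) in AbsolutelyContinuousOnInterval.totalLengthFilter ⊓
      𝓟 (AbsolutelyContinuousOnInterval.disjWithin a b),
      E ∈ AbsolutelyContinuousOnInterval.disjWithin a b :=
    eventually_inf_principal.mpr (by simp)
  filter_upwards [hE] with E hE
  rw [Finset.mul_sum]
  exact Finset.sum_le_sum fun i hi => h _ (hE.1 i hi).1 _ (hE.1 i hi).2

/-- `F` is a primitive on `[0,1]` of the integrable function `f`. -/
def Prim (F f : ℝ → E) : Prop :=
  IntervalIntegrable f volume 0 1 ∧ ∀ x ∈ Icc (0 : ℝ) 1, F x = F 0 + ∫ t in (0 : ℝ)..x, f t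

theorem intervalIntegrable_sub {E₀ : Type*} [NormedAddCommGroup E₀] {f : ℝ → E₀} (hf : IntervalIntegrable f volume 0 1) {x y : ℝ}
    (hx : x ∈ Icc (0 : ℝ) 1) (hy : y ∈ Icc (0 : ℝ) 1) : IntervalIntegrable f volume x y := by
  refine hf.mono_set ?_
  rw [uIcc_of_le zero_le_one]
  exact uIcc_subset_Icc hx hy

theorem Prim.sub_eq {F f : ℝ → E} (h : Prim F f) {x y : ℝ}
    (hx : x ∈ Icc (0 : ℝ) 1) (hy : y ∈ Icc (0 : ℝ) 1) : F y - F x = ∫ t in x..y, f t := by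
  rw [h.2 x hx, h.2 y hy, ← intervalIntegral.integral_interval_sub_left (a := 0)
    (intervalIntegrable_sub h.1 (by simp) hy) (intervalIntegrable_sub h.1 (by simp) hx)]
  abel

/-- Increments of F are dominated by increments of the scalar primitive of ‖f‖, for which absolute
continuity is known. -/
theorem Prim.absolutelyContinuous {F f : ℝ → E} (h : Prim F f) :
    AbsolutelyContinuousOnInterval F 0 1 := by
  have hn : IntervalIntegrable (fun x => ‖f x‖) volume 0 1 := h.1.norm
  refine absolutelyContinuousOnInterval_of_dist_le (C := 1)
    (hn.absolutelyContinuousOnInterval_intervalIntegral (c := 0) (by simp)) ?_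
  rw [uIcc_of_le zero_le_one]
  intro x hx y hy
  rw [dist_comm, dist_eq_norm, h.sub_eq hx hy, one_mul, dist_comm, Real.dist_eq,
    intervalIntegral.integral_interval_sub_left
      (intervalIntegrable_sub hn (by simp) hy) (intervalIntegrable_sub hn (by simp) hx)]
  exact intervalIntegral.norm_integral_le_abs_integral_norm

theorem Prim.continuousOn {F f : ℝ → E} (h : Prim F f) : ContinuousOn F (Icc 0 1) := by
  have := h.absolutelyContinuous.continuousOn
  rwa [uIcc_of_le zero_le_one] at this

theorem Prim.ae_hasDerivAt [CompleteSpace E] {F f : ℝ → E} (h : Prim F f) :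
    ∀ᵐ x, x ∈ Ioo (0 : ℝ) 1 → HasDerivAt F (f x) x := by
  filter_upwards [h.1.ae_hasDerivAt_integral] with x hx hx01
  have h1 := (hx (by rw [uIcc_of_le zero_le_one]; exact Ioo_subset_Icc_self hx01) 0
    (by simp)).const_add (F 0)
  refine h1.congr_of_eventuallyEq ?_
  filter_upwards [Ioo_mem_nhds hx01.1 hx01.2] with y hy
  exact h.2 y (Ioo_subset_Icc_self hy)

theorem prim_integral {f : ℝ → E} (hf : IntervalIntegrable f volume 0 1) :
    Prim (fun x => ∫ t in (0 : ℝ)..x, f t) f :=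
  ⟨hf, fun x _ => by simp⟩

theorem prim_const_add_integral {f : ℝ → E} (hf : IntervalIntegrable f volume 0 1) (c : E) :
    Prim (fun x => c + ∫ t in (0 : ℝ)..x, f t) f :=
  ⟨hf, fun x _ => by simp⟩

/-- The difference of F and the integral of f is absolutely continuous with derivative zero almost
everywhere, hence constant. -/
theorem prim_of_absolutelyContinuous [CompleteSpace E] {F f : ℝ → E}
    (hF : AbsolutelyContinuousOnInterval F 0 1)
    (hf : IntervalIntegrable f volume 0 1)
    (hd : ∀ᵐ x, x ∈ Ioo (0 : ℝ) 1 → HasDerivAt F (f x) x) : Prim F f := by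
  refine ⟨hf, fun x hx => ?_⟩
  have hI := prim_integral hf
  have hac := hF.sub hI.absolutelyContinuous
  -- The derivative is known on the open interval only, so the two endpoints are discarded as null
  -- sets.
  have h1 : ∀ᵐ x : ℝ, x ≠ 0 := by simp [ae_iff, measure_singleton]
  have h2 : ∀ᵐ x : ℝ, x ≠ 1 := by simp [ae_iff, measure_singleton]
  have hz : ∀ᵐ x, x ∈ uIcc (0 : ℝ) 1 →
      HasDerivAt (F - fun x => ∫ t in (0 : ℝ)..x, f t) 0 x := by
    filter_upwards [hd, hI.ae_hasDerivAt, h1, h2] with x hx1 hx2 hx3 hx4 hx5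
    rw [uIcc_of_le zero_le_one] at hx5
    have hm : x ∈ Ioo (0 : ℝ) 1 := ⟨lt_of_le_of_ne hx5.1 (Ne.symm hx3), lt_of_le_of_ne hx5.2 hx4⟩
    simpa using (hx1 hm).sub (hx2 hm)
  obtain ⟨C, hC⟩ := hac.const_of_ae_hasDerivAt_zero hz
  have e0 := hC 0 (by simp)
  have ex := hC x (by rwa [uIcc_of_le zero_le_one])
  simp only [Pi.sub_apply, intervalIntegral.integral_same, sub_zero] at e0 ex
  rw [e0, ← ex]
  abel

theorem Prim.congr {F f G g : ℝ → E} (h : Prim F f) (hF : ∀ x ∈ Icc (0 : ℝ) 1, F x = G x)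
    (hf : ∀ᵐ x, x ∈ Ioo (0 : ℝ) 1 → f x = g x) : Prim G g := by
  have hae : f =ᵐ[volume.restrict (Ioo (0 : ℝ) 1)] g :=
    (ae_restrict_iff' measurableSet_Ioo).2 hf
  have hae' : f =ᵐ[volume.restrict (uIoc (0 : ℝ) 1)] g := by
    rwa [uIoc_of_le zero_le_one, ← restrict_Ioo_eq_restrict_Ioc]
  refine ⟨h.1.congr_ae hae', fun x hx => ?_⟩
  rw [← hF x hx, ← hF 0 (by simp), h.2 x hx]
  congr 1
  refine intervalIntegral.integral_congr_ae ?_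
  have h2 : ∀ᵐ x : ℝ, x ≠ 1 := by simp [ae_iff, measure_singleton]
  filter_upwards [hf, h2] with t ht ht1 htx
  rw [uIoc_of_le hx.1] at htx
  exact ht ⟨htx.1, lt_of_le_of_ne (htx.2.trans hx.2) ht1⟩

theorem Prim.add {F f G g : ℝ → E} (h : Prim F f) (h' : Prim G g) :
    Prim (fun x => F x + G x) (fun x => f x + g x) := by
  refine ⟨h.1.add h'.1, fun x hx => ?_⟩
  beta_reduce
  rw [intervalIntegral.integral_add (intervalIntegrable_sub h.1 (by simp) hx)
    (intervalIntegrable_sub h'.1 (by simp) hx), h.2 x hx, h'.2 x hx]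
  abel

theorem Prim.clm {E' : Type*} [NormedAddCommGroup E'] [NormedSpace ℝ E']
    [CompleteSpace E] [CompleteSpace E'] {F f : ℝ → E}
    (h : Prim F f) (L : E →L[ℝ] E') : Prim (fun x => L (F x)) (fun x => L (f x)) := by
  refine ⟨⟨L.integrable_comp h.1.1, L.integrable_comp h.1.2⟩, fun x hx => ?_⟩
  beta_reduce
  rw [h.2 x hx, map_add,
    ← L.intervalIntegral_comp_comm (intervalIntegrable_sub h.1 (by simp) hx)]

theorem Prim.sub {F f G g : ℝ → E} (h : Prim F f) (h' : Prim G g) :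
    Prim (fun x => F x - G x) (fun x => f x - g x) := by
  refine ⟨h.1.sub h'.1, fun x hx => ?_⟩
  beta_reduce
  rw [intervalIntegral.integral_sub (intervalIntegrable_sub h.1 (by simp) hx)
    (intervalIntegrable_sub h'.1 (by simp) hx), h.2 x hx, h'.2 x hx]
  abel

theorem prim_id : Prim (fun x : ℝ => x) (fun _ => (1 : ℝ)) :=
  ⟨intervalIntegrable_const, fun x _ => by simp⟩

theorem intervalIntegrable_mul_continuousOn {𝕜 : Type*} [RCLike 𝕜] {f g : ℝ → 𝕜}
    (hf : IntervalIntegrable f volume 0 1)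
    (hg : ContinuousOn g (Icc 0 1)) : IntervalIntegrable (fun x => f x * g x) volume 0 1 :=
  hf.mul_continuousOn (by rwa [uIcc_of_le zero_le_one])

/-- This is the source of every integration by parts below: the integral identity contained in
`Prim` is read off for a product. -/
theorem Prim.mul {𝕜 : Type*} [RCLike 𝕜] {F f G g : ℝ → 𝕜} (h : Prim F f) (h' : Prim G g) :
    Prim (fun x => F x * G x) (fun x => f x * G x + F x * g x) := by
  refine prim_of_absolutelyContinuous (h.absolutelyContinuous.smul h'.absolutelyContinuous) ?_ ?_
  · refine (intervalIntegrable_mul_continuousOn h.1 h'.continuousOn).add ?_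
    simpa [mul_comm] using intervalIntegrable_mul_continuousOn h'.1 h.continuousOn
  · filter_upwards [h.ae_hasDerivAt, h'.ae_hasDerivAt] with x hx hx' hm
    exact (hx hm).mul (hx' hm)

/-- Chain rule for a primitive composed with a continuously differentiable function. -/
theorem Prim.comp {𝕜 : Type*} [RCLike 𝕜] {F f : ℝ → 𝕜} (h : Prim F f) {φ φ' : 𝕜 → 𝕜}
    (hφ : ∀ z, HasDerivAt φ (φ' z) z) (hφ' : Continuous φ') :
    Prim (fun x => φ (F x)) (fun x => f x * φ' (F x)) := by
  obtain ⟨R, hR⟩ := isCompact_Icc.exists_bound_of_continuousOn h.continuousOn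
  obtain ⟨C, hC⟩ := (isCompact_closedBall (0 : 𝕜) R).exists_bound_of_continuousOn
    hφ'.continuousOn
  have hcont : ContinuousOn (fun x => φ' (F x)) (Icc 0 1) :=
    hφ'.comp_continuousOn h.continuousOn
  refine prim_of_absolutelyContinuous ?_ (intervalIntegrable_mul_continuousOn h.1 hcont) ?_
  -- On the closed ball of radius R, which contains the range of F, the bound C for φ' makes φ
  -- Lipschitz.
  · refine absolutelyContinuousOnInterval_of_dist_le (C := C) h.absolutelyContinuous ?_
    rw [uIcc_of_le zero_le_one]
    intro x hx y hy
    rw [dist_eq_norm, dist_eq_norm]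
    exact (convex_closedBall (0 : 𝕜) R).norm_image_sub_le_of_norm_hasDerivWithin_le
      (fun z _ => (hφ z).hasDerivWithinAt) (fun z hz => hC z hz)
      (by simpa using hR y hy) (by simpa using hR x hx)
  · filter_upwards [h.ae_hasDerivAt] with x hx hm
    have := (hφ (F x)).scomp x (hx hm)
    simpa using! this

theorem Prim.cexp {F f : ℝ → ℂ} (h : Prim F f) :
    Prim (fun x => Complex.exp (F x)) (fun x => f x * Complex.exp (F x)) :=
  h.comp Complex.hasDerivAt_exp Complex.continuous_exp

theorem Prim.rexp {F f : ℝ → ℝ} (h : Prim F f) :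
    Prim (fun x => Real.exp (F x)) (fun x => f x * Real.exp (F x)) :=
  h.comp Real.hasDerivAt_exp Real.continuous_exp

theorem Prim.mono {F f : ℝ → ℝ} (h : Prim F f) (hf : ∀ᵐ x, x ∈ Ioo (0 : ℝ) 1 → 0 ≤ f x)
    {x : ℝ} (hx : x ∈ Icc (0 : ℝ) 1) : F 0 ≤ F x := by
  rw [h.2 x hx]
  have : 0 ≤ ∫ t in (0 : ℝ)..x, f t := by
    refine intervalIntegral.integral_nonneg_of_ae_restrict hx.1 ?_
    rw [← restrict_Ioo_eq_restrict_Icc]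
    refine (ae_restrict_iff' measurableSet_Ioo).2 ?_
    filter_upwards [hf] with t ht htx using ht ⟨htx.1, htx.2.trans_le hx.2⟩
  linarith

/-- **Grönwall's inequality** in integral form with an integrable weight. -/
theorem gronwall {y k : ℝ → ℝ} {C : ℝ} (hy : ContinuousOn y (Icc 0 1))
    (hk : IntervalIntegrable k volume 0 1) (hk0 : ∀ x, 0 ≤ k x)
    (h : ∀ x ∈ Icc (0 : ℝ) 1, y x ≤ C + ∫ t in (0 : ℝ)..x, k t * y t)
    {x : ℝ} (hx : x ∈ Icc (0 : ℝ) 1) : y x ≤ C * Real.exp (∫ t in (0 : ℝ)..x, k t) := by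
  -- With G = C + ∫ k y, the product G exp(-∫ k) has derivative k (y - G) exp(-∫ k) ≤ 0. Since
  -- `Prim.mono` is about nonnegative derivatives, it is applied to the negative of this product.
  have hG := prim_const_add_integral (intervalIntegrable_mul_continuousOn hk hy) C
  have hE := (prim_integral hk.neg).rexp
  have hGE := hG.mul hE
  have hN := hGE.clm (-ContinuousLinearMap.id ℝ ℝ)
  have hm := hN.mono (Eventually.of_forall fun t ht => by
    have h1 := h t (Ioo_subset_Icc_self ht)
    simp only [neg_apply, ContinuousLinearMap.id_apply, Pi.neg_apply]
    have h2 := mul_nonneg (hk0 t) (sub_nonneg.2 h1)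
    have h3 := mul_nonneg h2 (Real.exp_pos (∫ t in (0 : ℝ)..t, -k t)).le
    nlinarith) hx
  simp only [neg_apply, ContinuousLinearMap.id_apply, Pi.neg_apply,
    intervalIntegral.integral_same, intervalIntegral.integral_neg, add_zero, Real.exp_zero,
    mul_one, neg_le_neg_iff, Real.exp_neg] at hm
  have hp := Real.exp_pos (∫ t in (0 : ℝ)..x, k t)
  rw [← div_eq_mul_inv, div_le_iff₀ hp] at hm
  exact (h x hx).trans hm

end Primitives

/-! ### Square integrable functions on `(0,1)` -/

section SquareIntegrable

/-- Lebesgue measure on the unit interval. -/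
noncomputable abbrev μ₀ : Measure ℝ := volume.restrict (Ioo (0 : ℝ) 1)

theorem setIntegral_eq_intervalIntegral {E : Type*} [NormedAddCommGroup E] [NormedSpace ℝ E]
    (f : ℝ → E) : ∫ x, f x ∂μ₀ = ∫ x in (0 : ℝ)..1, f x := by
  rw [intervalIntegral.integral_of_le zero_le_one, ← restrict_Ioo_eq_restrict_Ioc]

theorem integrable_iff_intervalIntegrable {E : Type*} [NormedAddCommGroup E] {f : ℝ → E} :
    Integrable f μ₀ ↔ IntervalIntegrable f volume 0 1 := by
  rw [intervalIntegrable_iff_integrableOn_Ioo_of_le zero_le_one, IntegrableOn]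

theorem memLp_intervalIntegrable {E : Type*} [NormedAddCommGroup E] {f : ℝ → E}
    (hf : MemLp f 2 μ₀) : IntervalIntegrable f volume 0 1 :=
  integrable_iff_intervalIntegrable.1 (hf.integrable (by norm_num))

theorem memLp_sq_intervalIntegrable {E : Type*} [NormedAddCommGroup E] {f : ℝ → E}
    (hf : MemLp f 2 μ₀) : IntervalIntegrable (fun x => ‖f x‖ ^ 2) volume 0 1 :=
  integrable_iff_intervalIntegrable.1 (by simpa using hf.integrable_norm_pow (p := 2) (by norm_num))

theorem cauchySchwarz {E F : Type*} [NormedAddCommGroup E] [NormedAddCommGroup F]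
    {f : ℝ → E} {g : ℝ → F} (hf : MemLp f 2 μ₀) (hg : MemLp g 2 μ₀) :
    ∫ x in (0 : ℝ)..1, ‖f x‖ * ‖g x‖ ≤
      √(∫ x in (0 : ℝ)..1, ‖f x‖ ^ 2) * √(∫ x in (0 : ℝ)..1, ‖g x‖ ^ 2) := by
  have h := integral_mul_norm_le_Lp_mul_Lq (μ := μ₀) (f := fun x => ‖f x‖) (g := fun x => ‖g x‖)
    (p := 2) (q := 2) Real.HolderConjugate.two_two (by simpa using hf.norm) (by simpa using hg.norm)
  simp only [norm_norm, setIntegral_eq_intervalIntegral, Real.rpow_ofNat] at h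
  simpa only [Real.sqrt_eq_rpow] using h

theorem integral_norm_le_sqrt {E : Type*} [NormedAddCommGroup E] {f : ℝ → E}
    (hf : MemLp f 2 μ₀) :
    ∫ x in (0 : ℝ)..1, ‖f x‖ ≤ √(∫ x in (0 : ℝ)..1, ‖f x‖ ^ 2) := by
  have := cauchySchwarz hf (memLp_const (1 : ℝ))
  simpa using this

theorem sqrt_integral_norm_sq {E : Type*} [NormedAddCommGroup E] (f : Lp E 2 μ₀) :
    √(∫ x in (0 : ℝ)..1, ‖f x‖ ^ 2) = ‖f‖ := by
  rw [Lp.norm_def, (Lp.memLp f).eLpNorm_eq_integral_rpow_norm (by norm_num) (by norm_num),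
    ENNReal.toReal_ofReal (by positivity), Real.sqrt_eq_rpow, ← setIntegral_eq_intervalIntegral]
  simp

theorem integral_norm_le_norm {E : Type*} [NormedAddCommGroup E] (f : Lp E 2 μ₀) :
    ∫ x in (0 : ℝ)..1, ‖f x‖ ≤ ‖f‖ :=
  (integral_norm_le_sqrt (Lp.memLp f)).trans_eq (sqrt_integral_norm_sq f)

theorem ae_unitInterval {P : ℝ → Prop} (h : ∀ᵐ x ∂μ₀, P x) :
    ∀ᵐ x, x ∈ Ioo (0 : ℝ) 1 → P x := (ae_restrict_iff' measurableSet_Ioo).1 h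

theorem integral_congr_unitInterval {E : Type*} [NormedAddCommGroup E] [NormedSpace ℝ E]
    {f g : ℝ → E} (h : ∀ᵐ x ∂μ₀, f x = g x) {x : ℝ} (hx : x ∈ Icc (0 : ℝ) 1) :
    ∫ t in (0 : ℝ)..x, f t = ∫ t in (0 : ℝ)..x, g t := by
  refine intervalIntegral.integral_congr_ae ?_
  have h2 : ∀ᵐ x : ℝ, x ≠ 1 := by simp [ae_iff, measure_singleton]
  filter_upwards [ae_unitInterval h, h2] with t ht ht1 htx
  rw [uIoc_of_le hx.1] at htx
  exact ht ⟨htx.1, lt_of_le_of_ne (htx.2.trans hx.2) ht1⟩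

theorem integral_norm_mono {f : ℝ → ℝ} (hf : IntervalIntegrable f volume 0 1) (h0 : ∀ x, 0 ≤ f x)
    {x : ℝ} (hx : x ∈ Icc (0 : ℝ) 1) : ∫ t in (0 : ℝ)..x, f t ≤ ∫ t in (0 : ℝ)..1, f t :=
  intervalIntegral.integral_mono_interval le_rfl hx.1 hx.2 (Eventually.of_forall h0) hf

end SquareIntegrable

/-! ### The Volterra operator -/

section Volterra

/-- Continuous functions on the unit interval. -/
abbrev CI : Type := C(Icc (0 : ℝ) 1, ℂ)

/-- The extension of a continuous function on `[0,1]` to the line by constants. -/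
noncomputable def ext (f : CI) : ℝ → ℂ := IccExtend (zero_le_one : (0 : ℝ) ≤ 1) f

theorem continuous_ext (f : CI) : Continuous (ext f) := f.continuous.Icc_extend'

theorem ext_apply (f : CI) {x : ℝ} (hx : x ∈ Icc (0 : ℝ) 1) : ext f x = f ⟨x, hx⟩ :=
  IccExtend_of_mem _ _ hx

theorem norm_ext_le (f : CI) (x : ℝ) : ‖ext f x‖ ≤ ‖f‖ := f.norm_coe_le_norm _

theorem intervalIntegrable_mul_ext (k : Lp ℂ 2 μ₀) (f : CI) :
    IntervalIntegrable (fun t => k t * ext f t) volume 0 1 :=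
  intervalIntegrable_mul_continuousOn (memLp_intervalIntegrable (Lp.memLp k))
    (continuous_ext f).continuousOn

/-- The function `x ↦ ∫₀ˣ k f`. -/
noncomputable def volterraFun (k : Lp ℂ 2 μ₀) (f : CI) : CI where
  toFun x := ∫ t in (0 : ℝ)..x, k t * ext f t
  continuous_toFun :=
    continuousOn_iff_continuous_domRestrict.1 (prim_integral (intervalIntegrable_mul_ext k f)).continuousOn

theorem volterraFun_apply (k : Lp ℂ 2 μ₀) (f : CI) (x : Icc (0 : ℝ) 1) :
    volterraFun k f x = ∫ t in (0 : ℝ)..x, k t * ext f t := rfl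

/-- The Volterra operator `f ↦ (x ↦ ∫₀ˣ k f)`, depending linearly on the kernel `k`. -/
noncomputable def volterra : Lp ℂ 2 μ₀ →L[ℂ] CI →L[ℂ] CI :=
  LinearMap.mkContinuous₂
    (LinearMap.mk₂ ℂ volterraFun
      (fun k k' f => by
        ext x
        simp only [volterraFun_apply, ContinuousMap.add_apply]
        rw [← intervalIntegral.integral_add
          (intervalIntegrable_sub (intervalIntegrable_mul_ext k f) (by simp) x.2)
          (intervalIntegrable_sub (intervalIntegrable_mul_ext k' f) (by simp) x.2)]
        refine integral_congr_unitInterval ?_ x.2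
        filter_upwards [Lp.coeFn_add k k'] with t ht
        rw [ht, Pi.add_apply, add_mul])
      (fun c k f => by
        ext x
        simp only [volterraFun_apply, ContinuousMap.smul_apply, smul_eq_mul]
        rw [← intervalIntegral.integral_const_mul]
        refine integral_congr_unitInterval ?_ x.2
        filter_upwards [Lp.coeFn_smul c k] with t ht
        rw [ht, Pi.smul_apply, smul_eq_mul, mul_assoc])
      (fun k f f' => by
        ext x
        simp only [volterraFun_apply, ContinuousMap.add_apply]
        rw [← intervalIntegral.integral_add
          (intervalIntegrable_sub (intervalIntegrable_mul_ext k f) (by simp) x.2)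
          (intervalIntegrable_sub (intervalIntegrable_mul_ext k f') (by simp) x.2)]
        refine intervalIntegral.integral_congr fun t _ => ?_
        simp only [ext, IccExtend_apply, ContinuousMap.add_apply, mul_add])
      (fun c k f => by
        ext x
        simp only [volterraFun_apply, ContinuousMap.smul_apply, smul_eq_mul]
        rw [← intervalIntegral.integral_const_mul]
        refine intervalIntegral.integral_congr fun t _ => ?_
        simp only [ext, IccExtend_apply, ContinuousMap.smul_apply, smul_eq_mul]
        ring))
    -- The norm bound 1 holds because on an interval of length one the L¹ norm of k is at most its
    -- L² norm.
    1 (fun k f => by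
      rw [one_mul, ContinuousMap.norm_le _ (by positivity)]
      intro x
      simp only [LinearMap.mk₂_apply, volterraFun_apply]
      have hk := (memLp_intervalIntegrable (Lp.memLp k)).norm
      calc ‖∫ t in (0 : ℝ)..x, k t * ext f t‖ ≤ ∫ t in (0 : ℝ)..x, ‖k t‖ * ‖f‖ := by
            refine intervalIntegral.norm_integral_le_of_norm_le x.2.1
              (Eventually.of_forall fun t _ => ?_)
              ((intervalIntegrable_sub hk (by simp) x.2).mul_const _)
            rw [norm_mul]
            exact mul_le_mul_of_nonneg_left (norm_ext_le f t) (norm_nonneg _)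
        _ = (∫ t in (0 : ℝ)..x, ‖k t‖) * ‖f‖ := by rw [intervalIntegral.integral_mul_const]
        _ ≤ ‖k‖ * ‖f‖ := by
            refine mul_le_mul_of_nonneg_right ?_ (norm_nonneg _)
            exact (integral_norm_mono hk (fun _ => norm_nonneg _) x.2).trans
              (integral_norm_le_norm k))

theorem volterra_apply (k : Lp ℂ 2 μ₀) (f : CI) (x : Icc (0 : ℝ) 1) :
    volterra k f x = ∫ t in (0 : ℝ)..x, k t * ext f t := rfl

end Volterra

/-! ### The system in the eigenbasis of `J` -/

section System

open Complex (I)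

/-- The linear form `w ↦ w₂ + i w₁`. -/
noncomputable def qForm : EuclideanSpace ℂ (Fin 2) →L[ℂ] ℂ :=
  (EuclideanSpace.proj 1 : EuclideanSpace ℂ (Fin 2) →L[ℂ] ℂ) +
    I • (EuclideanSpace.proj 0 : EuclideanSpace ℂ (Fin 2) →L[ℂ] ℂ)

/-- The linear form `w ↦ w₂ - i w₁`. -/
noncomputable def pForm : EuclideanSpace ℂ (Fin 2) →L[ℂ] ℂ :=
  (EuclideanSpace.proj 1 : EuclideanSpace ℂ (Fin 2) →L[ℂ] ℂ) -
    I • (EuclideanSpace.proj 0 : EuclideanSpace ℂ (Fin 2) →L[ℂ] ℂ)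

/-- `q = v₂ + i v₁`. -/
noncomputable def qFun (v : PotentialC) (x : ℝ) : ℂ := v x 1 + I * v x 0

/-- `p = v₂ - i v₁`. -/
noncomputable def pFun (v : PotentialC) (x : ℝ) : ℂ := v x 1 - I * v x 0

/-- `q` as a function of the potential in `L²`. -/
noncomputable def qLp : PotentialC →L[ℂ] Lp ℂ 2 μ₀ := qForm.compLpL 2 μ₀

/-- `p` as a function of the potential in `L²`. -/
noncomputable def pLp : PotentialC →L[ℂ] Lp ℂ 2 μ₀ := pForm.compLpL 2 μ₀

theorem coeFn_qLp (v : PotentialC) : ∀ᵐ x ∂μ₀, qLp v x = qFun v x := by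
  filter_upwards [qForm.coeFn_compLpL (p := 2) (μ := μ₀) v] with x hx
  rw [qLp, hx]
  simp [qForm, qFun]

theorem coeFn_pLp (v : PotentialC) : ∀ᵐ x ∂μ₀, pLp v x = pFun v x := by
  filter_upwards [pForm.coeFn_compLpL (p := 2) (μ := μ₀) v] with x hx
  rw [pLp, hx]
  simp [pForm, pFun]

theorem memLp_qFun (v : PotentialC) : MemLp (qFun v) 2 μ₀ :=
  (memLp_congr_ae (coeFn_qLp v)).1 (Lp.memLp _)

theorem memLp_pFun (v : PotentialC) : MemLp (pFun v) 2 μ₀ :=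
  (memLp_congr_ae (coeFn_pLp v)).1 (Lp.memLp _)

/-- `(a, b)` solves `a' = -i z a + q b`, `b' = i z b + p a` on `[0,1]`. -/
def IsSystem (q p : ℝ → ℂ) (z : ℂ) (a b : ℝ → ℂ) : Prop :=
  Prim a (fun x => -(I * z) * a x + q x * b x) ∧ Prim b (fun x => I * z * b x + p x * a x)

/-- The pairs of continuous functions on `[0,1]`. -/
abbrev CI2 : Type := CI × CI

/-- The integral operator of the system, depending linearly on `(v, z)`. -/
noncomputable def sysOp : PotentialC × ℂ →L[ℂ] (CI2 →L[ℂ] CI2) :=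
  -- The first block carries the off-diagonal coefficients q and p; the second carries the diagonal
  -- coefficients -iz and iz, as multiples of the Volterra operator with kernel 1. Linearity in (v,
  -- z) is what later yields analyticity.
  (((ContinuousLinearMap.compL ℂ CI2 CI CI2 (ContinuousLinearMap.inl ℂ CI CI)) ∘L
      ((ContinuousLinearMap.compL ℂ CI2 CI CI).flip (ContinuousLinearMap.snd ℂ CI CI)) ∘L
      volterra ∘L qLp) +
    ((ContinuousLinearMap.compL ℂ CI2 CI CI2 (ContinuousLinearMap.inr ℂ CI CI)) ∘L
      ((ContinuousLinearMap.compL ℂ CI2 CI CI).flip (ContinuousLinearMap.fst ℂ CI CI)) ∘L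
      volterra ∘L pLp)) ∘L ContinuousLinearMap.fst ℂ PotentialC ℂ +
  (ContinuousLinearMap.snd ℂ PotentialC ℂ).smulRight
    ((ContinuousLinearMap.inl ℂ CI CI) ∘L ((-I) • volterra (Lp.const 2 μ₀ (1 : ℂ))) ∘L
        (ContinuousLinearMap.fst ℂ CI CI) +
      (ContinuousLinearMap.inr ℂ CI CI) ∘L (I • volterra (Lp.const 2 μ₀ (1 : ℂ))) ∘L
        (ContinuousLinearMap.snd ℂ CI CI))

theorem sysOp_apply_aux (z c : ℂ) (k : Lp ℂ 2 μ₀) (q : ℝ → ℂ)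
    (hk : ∀ᵐ x ∂μ₀, k x = q x) (f g : CI) (x : Icc (0 : ℝ) 1) :
    volterra k g x + z * (c * volterra (Lp.const 2 μ₀ (1 : ℂ)) f x) =
      ∫ t in (0 : ℝ)..x, (c * z * ext f t + q t * ext g t) := by
  rw [volterra_apply, volterra_apply, ← intervalIntegral.integral_const_mul,
    ← intervalIntegral.integral_const_mul, ← intervalIntegral.integral_add
      (intervalIntegrable_sub (intervalIntegrable_mul_ext k g) (by simp) x.2)
      ((intervalIntegrable_sub (intervalIntegrable_mul_ext _ f) (by simp) x.2).const_mul _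
        |>.const_mul _)]
  refine integral_congr_unitInterval ?_ x.2
  filter_upwards [hk, Lp.coeFn_const 2 μ₀ (1 : ℂ)] with t ht ht'
  rw [ht, ht', Function.const_apply]
  ring

theorem sysOp_apply_fst (v : PotentialC) (z : ℂ) (f : CI2) (x : Icc (0 : ℝ) 1) :
    (sysOp (v, z) f).1 x =
      ∫ t in (0 : ℝ)..x, (-(I * z) * ext f.1 t + qFun v t * ext f.2 t) := by
  have := sysOp_apply_aux z (-I) _ _ (coeFn_qLp v) f.1 f.2 x
  rw [← neg_mul, ← this]
  simp [sysOp]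

theorem sysOp_apply_snd (v : PotentialC) (z : ℂ) (f : CI2) (x : Icc (0 : ℝ) 1) :
    (sysOp (v, z) f).2 x =
      ∫ t in (0 : ℝ)..x, (I * z * ext f.2 t + pFun v t * ext f.1 t) := by
  rw [← sysOp_apply_aux z I _ _ (coeFn_pLp v) f.2 f.1 x]
  simp [sysOp]

end System

/-! ### Existence and analyticity of solutions by iterating the Volterra operator. -/

section Solve

open Complex (I)

/-- A pointwise bound for the coefficients of the system. -/
noncomputable def sysWeight (v : PotentialC) (z : ℂ) (t : ℝ) : ℝ := ‖z‖ + ‖qFun v t‖ + ‖pFun v t‖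

theorem intervalIntegrable_sysWeight (v : PotentialC) (z : ℂ) :
    IntervalIntegrable (sysWeight v z) volume 0 1 :=
  (intervalIntegrable_const.add (memLp_intervalIntegrable (memLp_qFun v)).norm).add
    (memLp_intervalIntegrable (memLp_pFun v)).norm

theorem sysWeight_nonneg (v : PotentialC) (z : ℂ) (t : ℝ) : 0 ≤ sysWeight v z t := by
  unfold sysWeight; positivity

theorem integral_mul_pow_div_factorial {k : ℝ → ℝ} (hk : IntervalIntegrable k volume 0 1) (n : ℕ)
    {x : ℝ} (hx : x ∈ Icc (0 : ℝ) 1) :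
    ∫ t in (0 : ℝ)..x, k t * ((∫ s in (0 : ℝ)..t, k s) ^ n / n.factorial) =
      (∫ s in (0 : ℝ)..x, k s) ^ (n + 1) / (n + 1).factorial := by
  have h := (prim_integral hk).comp (φ := fun y => y ^ (n + 1) / (n + 1).factorial)
    (φ' := fun y => y ^ n / n.factorial) (fun y => by
      have := (hasDerivAt_pow (n + 1) y).div_const ((n + 1).factorial : ℝ)
      convert! this using 1
      rw [Nat.factorial_succ]
      push_cast
      have : (n.factorial : ℝ) ≠ 0 := by positivity
      field_simp) (by fun_prop)
  have := h.2 x hx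
  simpa using this.symm

/-- Iterated integration gains a factorial: one more application integrates the weight against the
previous bound, and the weight is the derivative of its own primitive, so
`integral_mul_pow_div_factorial` raises the power by one. -/
theorem norm_sysOp_pow_apply_le (v : PotentialC) (z : ℂ) (f : CI2) (n : ℕ) (x : Icc (0 : ℝ) 1) :
    ‖((sysOp (v, z) ^ n) f).1 x‖ ≤ ‖f‖ * ((∫ t in (0 : ℝ)..x, sysWeight v z t) ^ n / n.factorial) ∧
    ‖((sysOp (v, z) ^ n) f).2 x‖ ≤
      ‖f‖ * ((∫ t in (0 : ℝ)..x, sysWeight v z t) ^ n / n.factorial) := by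
  induction n generalizing x with
  | zero =>
    simp only [pow_zero, one_apply_eq_self, Nat.factorial_zero, Nat.cast_one, div_one,
      mul_one]
    exact ⟨(f.1.norm_coe_le_norm x).trans (norm_fst_le f),
      (f.2.norm_coe_le_norm x).trans (norm_snd_le f)⟩
  | succ n ih =>
    have hw := intervalIntegrable_sysWeight v z
    set W : ℝ → ℝ := fun t => ∫ s in (0 : ℝ)..t, sysWeight v z s with hW
    have hWc : ContinuousOn (fun t => ‖f‖ * (W t ^ n / n.factorial)) (Icc 0 1) :=
      ((prim_integral hw).continuousOn.pow n).div_const _ |>.const_smul ‖f‖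
    have hInt := intervalIntegrable_mul_continuousOn hw hWc
    have hI : ∫ t in (0 : ℝ)..x, sysWeight v z t * (‖f‖ * (W t ^ n / n.factorial)) =
        ‖f‖ * (W x ^ (n + 1) / (n + 1).factorial) := by
      rw [hW, ← integral_mul_pow_div_factorial hw n x.2, ← intervalIntegral.integral_const_mul]
      refine intervalIntegral.integral_congr fun t _ => ?_
      ring
    have key : ∀ c d : ℂ, ∀ t ∈ Icc (0 : ℝ) 1, ‖c‖ + ‖d‖ ≤ sysWeight v z t → ∀ g h : ℂ,
        ‖g‖ ≤ ‖f‖ * (W t ^ n / n.factorial) → ‖h‖ ≤ ‖f‖ * (W t ^ n / n.factorial) →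
        ‖c * g + d * h‖ ≤ sysWeight v z t * (‖f‖ * (W t ^ n / n.factorial)) := by
      intro c d t _ hcd g h hg hh
      refine (norm_add_le _ _).trans ?_
      rw [norm_mul, norm_mul]
      calc ‖c‖ * ‖g‖ + ‖d‖ * ‖h‖
          ≤ ‖c‖ * (‖f‖ * (W t ^ n / n.factorial)) + ‖d‖ * (‖f‖ * (W t ^ n / n.factorial)) := by
            gcongr
        _ = (‖c‖ + ‖d‖) * (‖f‖ * (W t ^ n / n.factorial)) := by ring
        _ ≤ _ := mul_le_mul_of_nonneg_right hcd ((norm_nonneg _).trans hg)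
    have hmem : ∀ t ∈ Ioc (0 : ℝ) x, t ∈ Icc (0 : ℝ) 1 := fun t ht => ⟨ht.1.le, ht.2.trans x.2.2⟩
    rw [pow_succ', ← hI]
    constructor
    · change ‖(sysOp (v, z) ((sysOp (v, z) ^ n) f)).1 x‖ ≤ _
      rw [sysOp_apply_fst]
      refine intervalIntegral.norm_integral_le_of_norm_le x.2.1
        (Eventually.of_forall fun t ht => ?_) (intervalIntegrable_sub hInt (by simp) x.2)
      have ht' := hmem t ht
      refine key _ _ t ht' ?_ _ _ ?_ ?_
      · simp only [norm_neg, norm_mul, Complex.norm_I, one_mul, sysWeight]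
        linarith [norm_nonneg (pFun v t)]
      · rw [ext_apply _ ht']; exact (ih ⟨t, ht'⟩).1
      · rw [ext_apply _ ht']; exact (ih ⟨t, ht'⟩).2
    · change ‖(sysOp (v, z) ((sysOp (v, z) ^ n) f)).2 x‖ ≤ _
      rw [sysOp_apply_snd]
      refine intervalIntegral.norm_integral_le_of_norm_le x.2.1
        (Eventually.of_forall fun t ht => ?_) (intervalIntegrable_sub hInt (by simp) x.2)
      have ht' := hmem t ht
      refine key _ _ t ht' ?_ _ _ ?_ ?_
      · simp only [norm_mul, Complex.norm_I, one_mul, sysWeight]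
        linarith [norm_nonneg (qFun v t)]
      · rw [ext_apply _ ht']; exact (ih ⟨t, ht'⟩).2
      · rw [ext_apply _ ht']; exact (ih ⟨t, ht'⟩).1

theorem norm_sysOp_pow_le (v : PotentialC) (z : ℂ) (n : ℕ) :
    ‖sysOp (v, z) ^ n‖ ≤ (∫ t in (0 : ℝ)..1, sysWeight v z t) ^ n / n.factorial := by
  have hw := intervalIntegrable_sysWeight v z
  have hp : 0 ≤ ∫ t in (0 : ℝ)..1, sysWeight v z t :=
    intervalIntegral.integral_nonneg zero_le_one fun t _ => sysWeight_nonneg v z t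
  refine ContinuousLinearMap.opNorm_le_bound _ (by positivity) fun f => ?_
  rw [Prod.norm_def, max_le_iff, ContinuousMap.norm_le _ (by positivity),
    ContinuousMap.norm_le _ (by positivity)]
  have hmono : ∀ x : Icc (0 : ℝ) 1,
      ‖f‖ * ((∫ t in (0 : ℝ)..x, sysWeight v z t) ^ n / n.factorial) ≤
      (∫ t in (0 : ℝ)..1, sysWeight v z t) ^ n / n.factorial * ‖f‖ := by
    intro x
    rw [mul_comm]
    have h0 : 0 ≤ ∫ t in (0 : ℝ)..x, sysWeight v z t :=
      intervalIntegral.integral_nonneg x.2.1 fun t _ => sysWeight_nonneg v z t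
    gcongr
    exact integral_norm_mono hw (sysWeight_nonneg v z) x.2
  exact ⟨fun x => ((norm_sysOp_pow_apply_le v z f n x).1).trans (hmono x),
    fun x => ((norm_sysOp_pow_apply_le v z f n x).2).trans (hmono x)⟩

/-- The element 1 - T divides 1 - T ^ n with a commuting cofactor, and the latter is invertible by
the Neumann series. Volterra operators need this form, since only a high power of T is small. -/
theorem isUnit_one_sub_of_norm_pow_lt_one {X : Type*} [NormedAddCommGroup X] [NormedSpace ℂ X]
    [CompleteSpace X] {T : X →L[ℂ] X} {n : ℕ} (hn : ‖T ^ n‖ < 1) : IsUnit (1 - T) := by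
  have h1 : IsUnit (1 - T ^ n) := isUnit_one_sub_of_norm_lt_one hn
  rw [← mul_neg_geom_sum] at h1
  have hc : Commute (1 - T) (∑ i ∈ Finset.range n, T ^ i) :=
    Commute.sub_left (Commute.one_left _) (Commute.sum_right _ _ _ fun i _ => Commute.self_pow _ _)
  exact (hc.isUnit_mul_iff.1 h1).1

theorem analyticAt_inverse_one_sub_apply {W X : Type*} [NormedAddCommGroup W] [NormedSpace ℂ W]
    [NormedAddCommGroup X] [NormedSpace ℂ X] [CompleteSpace X] (S : W →L[ℂ] (X →L[ℂ] X))
    {w : W} (hw : IsUnit (1 - S w)) (x : X) :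
    AnalyticAt ℂ (fun w => Ring.inverse (1 - S w) x) w := by
  obtain ⟨u, hu⟩ := hw
  have h1 : AnalyticAt ℂ (fun w => 1 - S w) w := analyticAt_const.sub (S.analyticAt w)
  have h2 : AnalyticAt ℂ (fun w => Ring.inverse (1 - S w)) w := by
    have := analyticAt_inverse (𝕜 := ℂ) u
    rw [hu] at this
    exact AnalyticAt.comp (g := Ring.inverse) this h1
  exact ((ContinuousLinearMap.apply ℂ X x).analyticAt _).comp h2

theorem isUnit_one_sub_sysOp (v : PotentialC) (z : ℂ) : IsUnit (1 - sysOp (v, z)) := by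
  have ht := FloorSemiring.tendsto_pow_div_factorial_atTop (∫ t in (0 : ℝ)..1, sysWeight v z t)
  obtain ⟨n, hn⟩ := (ht.eventually (gt_mem_nhds zero_lt_one)).exists
  exact isUnit_one_sub_of_norm_pow_lt_one (X := CI2) (T := sysOp (v, z)) (n := n)
    ((norm_sysOp_pow_le v z n).trans_lt hn)

/-- The solution of the system with both initial values `1`. -/
noncomputable def sysSol (v : PotentialC) (z : ℂ) : CI2 :=
  Ring.inverse (1 - sysOp (v, z)) (1, 1)

theorem sysSol_eq (v : PotentialC) (z : ℂ) :
    sysSol v z = (1, 1) + sysOp (v, z) (sysSol v z) := by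
  have h := congrArg (fun T : CI2 →L[ℂ] CI2 => T (1, 1))
    (Ring.mul_inverse_cancel _ (isUnit_one_sub_sysOp v z))
  simp only [one_apply_eq_self] at h
  rw [← sub_eq_iff_eq_add]
  exact h

theorem analyticAt_sysSol (w : PotentialC × ℂ) :
    AnalyticAt ℂ (fun w : PotentialC × ℂ => sysSol w.1 w.2) w :=
  analyticAt_inverse_one_sub_apply sysOp (isUnit_one_sub_sysOp w.1 w.2) (1, 1)

/-- The first component of the solution of the system with initial values `1`. -/
noncomputable def aSol (v : PotentialC) (z : ℂ) : ℝ → ℂ := ext (sysSol v z).1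

/-- The second component of the solution of the system with initial values `1`. -/
noncomputable def bSol (v : PotentialC) (z : ℂ) : ℝ → ℂ := ext (sysSol v z).2

theorem aSol_zero (v : PotentialC) (z : ℂ) : aSol v z 0 = 1 := by
  rw [aSol, ext_apply _ (by simp), sysSol_eq, Prod.fst_add, ContinuousMap.add_apply,
    sysOp_apply_fst]
  simp

theorem bSol_zero (v : PotentialC) (z : ℂ) : bSol v z 0 = 1 := by
  rw [bSol, ext_apply _ (by simp), sysSol_eq, Prod.snd_add, ContinuousMap.add_apply,
    sysOp_apply_snd]
  simp

theorem isSystem_sol (v : PotentialC) (z : ℂ) :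
    IsSystem (qFun v) (pFun v) z (aSol v z) (bSol v z) := by
  have ha : ContinuousOn (aSol v z) (Icc 0 1) := (continuous_ext _).continuousOn
  have hb : ContinuousOn (bSol v z) (Icc 0 1) := (continuous_ext _).continuousOn
  have hq := memLp_intervalIntegrable (memLp_qFun v)
  have hp := memLp_intervalIntegrable (memLp_pFun v)
  refine ⟨⟨?_, fun x hx => ?_⟩, ⟨?_, fun x hx => ?_⟩⟩
  · exact (intervalIntegrable_mul_continuousOn intervalIntegrable_const ha).add
      (intervalIntegrable_mul_continuousOn hq hb)
  · rw [aSol_zero, aSol, ext_apply _ hx]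
    nth_rw 1 [sysSol_eq]
    rw [Prod.fst_add, ContinuousMap.add_apply, sysOp_apply_fst]
    rfl
  · exact (intervalIntegrable_mul_continuousOn intervalIntegrable_const hb).add
      (intervalIntegrable_mul_continuousOn hp ha)
  · rw [bSol_zero, bSol, ext_apply _ hx]
    nth_rw 1 [sysSol_eq]
    rw [Prod.snd_add, ContinuousMap.add_apply, sysOp_apply_snd]
    rfl

theorem analyticAt_aSol (x : ℝ) (w : PotentialC × ℂ) :
    AnalyticAt ℂ (fun w : PotentialC × ℂ => aSol w.1 w.2 x) w :=
  ((ContinuousMap.evalCLM ℂ (projIcc 0 1 zero_le_one x) ∘L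
    ContinuousLinearMap.fst ℂ CI CI).analyticAt _).comp (analyticAt_sysSol w)

theorem analyticAt_bSol (x : ℝ) (w : PotentialC × ℂ) :
    AnalyticAt ℂ (fun w : PotentialC × ℂ => bSol w.1 w.2 x) w :=
  ((ContinuousMap.evalCLM ℂ (projIcc 0 1 zero_le_one x) ∘L
    ContinuousLinearMap.snd ℂ CI CI).analyticAt _).comp (analyticAt_sysSol w)

end Solve

/-! ### A priori bounds and uniqueness for the system. -/

section Bounds

open Complex (I)

theorem prim_cexp (c : ℂ) :
    Prim (fun x : ℝ => Complex.exp (c * x)) (fun x => c * Complex.exp (c * x)) := by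
  have h := (prim_id.clm Complex.ofRealCLM).clm
    ((ContinuousLinearMap.mul ℝ ℂ c))
  simpa using h.cexp

/-- Removal of a constant coefficient by an exponential factor. -/
theorem Prim.exp_mul {a g : ℝ → ℂ} {c : ℂ} (h : Prim a (fun x => c * a x + g x)) :
    Prim (fun x : ℝ => Complex.exp (-c * x) * a x) (fun x => Complex.exp (-c * x) * g x) := by
  refine ((prim_cexp (-c)).mul h).congr (fun x _ => rfl) (Eventually.of_forall fun x _ => ?_)
  ring

theorem norm_cexp_mul_ofReal (c : ℂ) (x : ℝ) : ‖Complex.exp (c * x)‖ = Real.exp (c.re * x) := by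
  rw [Complex.norm_exp]; simp

/-- Variation of constants: a(x) is e^{cx}a(0) plus the integral of e^{c(x-t)}g(t). After the weight
e^{-Yx} is attached, what remains of the exponential kernel is e^{(Re c - Y)x} times e^{-(Re c -
Y)t}, at most 1 for t ≤ x. -/
theorem exp_mul_norm_le {a g : ℝ → ℂ} {c : ℂ} {Y : ℝ} (hY : c.re ≤ Y)
    (h : Prim a (fun x => c * a x + g x)) (hg : IntervalIntegrable g volume 0 1) {x : ℝ}
    (hx : x ∈ Icc (0 : ℝ) 1) :
    Real.exp (-Y * x) * ‖a x‖ ≤ ‖a 0‖ + ∫ t in (0 : ℝ)..x, Real.exp (-Y * t) * ‖g t‖ := by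
  have hA := h.exp_mul.2 x hx
  simp only [Complex.ofReal_zero, mul_zero, Complex.exp_zero, one_mul] at hA
  have hcont : ContinuousOn (fun t : ℝ => Real.exp (-Y * t)) (Icc 0 1) := by fun_prop
  have hInt := intervalIntegrable_mul_continuousOn hg.norm hcont
  have hInt' : IntervalIntegrable (fun t => Real.exp (-Y * t) * ‖g t‖) volume 0 1 := by
    simpa only [mul_comm] using hInt
  have e1 : Real.exp (-Y * x) * ‖a x‖ =
      Real.exp ((c.re - Y) * x) * ‖Complex.exp (-c * x) * a x‖ := by
    rw [norm_mul, norm_cexp_mul_ofReal, ← mul_assoc, ← Real.exp_add]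
    congr 2
    simp only [Complex.neg_re]
    ring
  have h1 : Real.exp ((c.re - Y) * x) ≤ 1 := by
    rw [Real.exp_le_one_iff]
    exact mul_nonpos_of_nonpos_of_nonneg (by linarith) hx.1
  rw [e1, hA]
  refine (mul_le_mul_of_nonneg_left (norm_add_le _ _) (Real.exp_pos _).le).trans ?_
  rw [mul_add]
  refine add_le_add (mul_le_of_le_one_left (norm_nonneg _) h1) ?_
  rw [← Real.norm_of_nonneg (Real.exp_pos ((c.re - Y) * x)).le, ← norm_smul,
    ← intervalIntegral.integral_smul]
  refine intervalIntegral.norm_integral_le_of_norm_le hx.1 (Eventually.of_forall fun t ht => ?_)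
    (intervalIntegrable_sub hInt' (by simp) hx)
  rw [norm_smul, norm_mul, norm_cexp_mul_ofReal, Real.norm_of_nonneg (Real.exp_pos _).le,
    ← mul_assoc, ← Real.exp_add]
  refine mul_le_mul_of_nonneg_right (Real.exp_le_exp.2 ?_) (norm_nonneg _)
  simp only [Complex.neg_re]
  nlinarith [ht.2]

/-- A priori bound for the inhomogeneous system. -/
theorem system_bound {a b g h : ℝ → ℂ} {z : ℂ} {k r : ℝ → ℝ} {M Y : ℝ}
    (hY : |z.im| ≤ Y)
    (ha : Prim a (fun x => -(I * z) * a x + g x)) (hb : Prim b (fun x => I * z * b x + h x))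
    (hg : IntervalIntegrable g volume 0 1) (hh : IntervalIntegrable h volume 0 1)
    (hk : IntervalIntegrable k volume 0 1) (hk0 : ∀ x, 0 ≤ k x)
    (hr : IntervalIntegrable r volume 0 1) (hr0 : ∀ x, 0 ≤ r x)
    (hgk : ∀ᵐ x ∂μ₀, ‖g x‖ ≤ k x * max ‖a x‖ ‖b x‖ + r x * Real.exp (Y * x))
    (hhk : ∀ᵐ x ∂μ₀, ‖h x‖ ≤ k x * max ‖a x‖ ‖b x‖ + r x * Real.exp (Y * x))
    (ha0 : ‖a 0‖ ≤ M) (hb0 : ‖b 0‖ ≤ M) {x : ℝ} (hx : x ∈ Icc (0 : ℝ) 1) :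
    max ‖a x‖ ‖b x‖ ≤
      Real.exp (Y * x) * ((M + ∫ t in (0 : ℝ)..1, r t) * Real.exp (∫ t in (0 : ℝ)..x, k t)) := by
  -- In the weighted maximum the diagonal terms ±iz no longer contribute, so the Grönwall exponent
  -- contains only k and no power of z.
  set y : ℝ → ℝ := fun t => Real.exp (-Y * t) * max ‖a t‖ ‖b t‖ with hy
  have hyc : ContinuousOn y (Icc 0 1) :=
    ContinuousOn.mul (by fun_prop) (ha.continuousOn.norm.sup hb.continuousOn.norm)
  have hInt := (intervalIntegrable_mul_continuousOn hk hyc).add hr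
  have half : ∀ (f : ℝ → ℂ), IntervalIntegrable f volume 0 1 →
      (∀ᵐ x ∂μ₀, ‖f x‖ ≤ k x * max ‖a x‖ ‖b x‖ + r x * Real.exp (Y * x)) →
      ∀ x ∈ Icc (0 : ℝ) 1, ∫ t in (0 : ℝ)..x, Real.exp (-Y * t) * ‖f t‖ ≤
        (∫ t in (0 : ℝ)..1, r t) + ∫ t in (0 : ℝ)..x, k t * y t := by
    intro f hf hfk x hx
    have hcont : ContinuousOn (fun t : ℝ => Real.exp (-Y * t)) (Icc 0 1) := by fun_prop
    have hInt' : IntervalIntegrable (fun t => Real.exp (-Y * t) * ‖f t‖) volume 0 1 := by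
      simpa only [mul_comm] using intervalIntegrable_mul_continuousOn hf.norm hcont
    calc ∫ t in (0 : ℝ)..x, Real.exp (-Y * t) * ‖f t‖
        ≤ ∫ t in (0 : ℝ)..x, (k t * y t + r t) := by
          refine intervalIntegral.integral_mono_ae_restrict hx.1
            (intervalIntegrable_sub hInt' (by simp) hx) (intervalIntegrable_sub hInt (by simp) hx) ?_
          rw [← restrict_Ioo_eq_restrict_Icc]
          refine (ae_restrict_iff' measurableSet_Ioo).2 ?_
          filter_upwards [ae_unitInterval hfk] with t ht htx
          have := mul_le_mul_of_nonneg_left (ht ⟨htx.1, htx.2.trans_le hx.2⟩)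
            (Real.exp_pos (-Y * t)).le
          refine this.trans_eq ?_
          have he : Real.exp (-Y * t) * Real.exp (Y * t) = 1 := by
            rw [← Real.exp_add]; simp
          simp only [hy]
          linear_combination r t * he
      _ = (∫ t in (0 : ℝ)..x, k t * y t) + ∫ t in (0 : ℝ)..x, r t :=
          intervalIntegral.integral_add
            (intervalIntegrable_sub (intervalIntegrable_mul_continuousOn hk hyc) (by simp) hx)
            (intervalIntegrable_sub hr (by simp) hx)
      _ ≤ _ := by linarith [integral_norm_mono hr hr0 hx]
  have hgr : ∀ x ∈ Icc (0 : ℝ) 1,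
      y x ≤ (M + ∫ t in (0 : ℝ)..1, r t) + ∫ t in (0 : ℝ)..x, k t * y t := by
    intro x hx
    have h1 := exp_mul_norm_le (Y := Y) (by simpa using (le_abs_self _).trans hY) ha hg hx
    have h2 := exp_mul_norm_le (Y := Y) (by simpa using (neg_le_abs _).trans hY) hb hh hx
    have h3 := half g hg hgk x hx
    have h4 := half h hh hhk x hx
    simp only [hy]
    rw [mul_max_of_nonneg _ _ (Real.exp_pos _).le, max_le_iff]
    constructor <;> linarith
  have := gronwall hyc hk hk0 hgr hx
  have he : Real.exp (Y * x) * Real.exp (-Y * x) = 1 := by rw [← Real.exp_add]; simp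
  calc max ‖a x‖ ‖b x‖ = Real.exp (Y * x) * y x := by
        simp only [hy]; rw [← mul_assoc, he, one_mul]
    _ ≤ _ := mul_le_mul_of_nonneg_left this (Real.exp_pos _).le

theorem IsSystem.bound {q p a b : ℝ → ℂ} {z : ℂ} (h : IsSystem q p z a b)
    (hq : IntervalIntegrable q volume 0 1) (hp : IntervalIntegrable p volume 0 1)
    {k : ℝ → ℝ} (hk : IntervalIntegrable k volume 0 1) (hk0 : ∀ x, 0 ≤ k x)
    (hqk : ∀ᵐ x ∂μ₀, ‖q x‖ ≤ k x) (hpk : ∀ᵐ x ∂μ₀, ‖p x‖ ≤ k x) {M : ℝ}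
    (ha0 : ‖a 0‖ ≤ M) (hb0 : ‖b 0‖ ≤ M) {x : ℝ} (hx : x ∈ Icc (0 : ℝ) 1) :
    max ‖a x‖ ‖b x‖ ≤ Real.exp (|z.im| * x) * (M * Real.exp (∫ t in (0 : ℝ)..x, k t)) := by
  have := system_bound (Y := |z.im|) (r := fun _ => 0) (M := M) le_rfl h.1 h.2
    (intervalIntegrable_mul_continuousOn hq h.2.continuousOn)
    (intervalIntegrable_mul_continuousOn hp h.1.continuousOn) hk hk0
    intervalIntegrable_const (fun _ => le_rfl)
    (by
      filter_upwards [hqk] with t ht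
      rw [norm_mul, zero_mul, add_zero]
      exact mul_le_mul ht (le_max_right _ _) (norm_nonneg _) (hk0 t))
    (by
      filter_upwards [hpk] with t ht
      rw [norm_mul, zero_mul, add_zero]
      exact mul_le_mul ht (le_max_left _ _) (norm_nonneg _) (hk0 t)) ha0 hb0 hx
  simpa using this

theorem IsSystem.sub {q p a b a' b' : ℝ → ℂ} {z : ℂ} (h : IsSystem q p z a b)
    (h' : IsSystem q p z a' b') :
    IsSystem q p z (fun x => a x - a' x) (fun x => b x - b' x) :=
  ⟨(h.1.sub h'.1).congr (fun _ _ => rfl) (Eventually.of_forall fun x _ => by ring),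
    (h.2.sub h'.2).congr (fun _ _ => rfl) (Eventually.of_forall fun x _ => by ring)⟩

theorem IsSystem.const_mul {q p a b : ℝ → ℂ} {z : ℂ} (h : IsSystem q p z a b) (c : ℂ) :
    IsSystem q p z (fun x => c * a x) (fun x => c * b x) :=
  ⟨(h.1.clm (ContinuousLinearMap.mul ℝ ℂ c)).congr (fun _ _ => rfl)
      (Eventually.of_forall fun x _ => by simp only [ContinuousLinearMap.mul_apply']; ring),
    (h.2.clm (ContinuousLinearMap.mul ℝ ℂ c)).congr (fun _ _ => rfl)
      (Eventually.of_forall fun x _ => by simp only [ContinuousLinearMap.mul_apply']; ring)⟩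

theorem IsSystem.unique {q p a b a' b' : ℝ → ℂ} {z : ℂ} (h : IsSystem q p z a b)
    (h' : IsSystem q p z a' b') (hq : IntervalIntegrable q volume 0 1)
    (hp : IntervalIntegrable p volume 0 1) (ha : a 0 = a' 0) (hb : b 0 = b' 0) {x : ℝ}
    (hx : x ∈ Icc (0 : ℝ) 1) : a x = a' x ∧ b x = b' x := by
  have := (h.sub h').bound hq hp (k := fun x => ‖q x‖ + ‖p x‖) (hq.norm.add hp.norm)
    (fun x => by positivity) (Eventually.of_forall fun x => by simp)
    (Eventually.of_forall fun x => by simp) (M := 0) (by simp [ha]) (by simp [hb]) hx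
  simp only [zero_mul, mul_zero, max_le_iff, norm_le_zero_iff, sub_eq_zero] at this
  exact this

end Bounds

/-! ### Passage between the original equation and the system. -/

section Conversion

open Complex (I)

/-- In the coordinates f₁ ∓ i f₂ of the eigenbasis of J, the matrix J is diagonal and V is
off-diagonal, with entries built from q and p. -/
theorem isSystem_of_isSolution {v : PotentialC} {z : ℂ} {f : ℝ → Fin 2 → ℂ}
    (h : IsSolution v z f) :
    IsSystem (qFun v) (pFun v) z (fun x => f x 0 - I * f x 1) (fun x => f x 0 + I * f x 1) := by
  have hc : ContinuousOn f (Icc 0 1) := by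
    have := h.1.continuousOn
    rwa [uIcc_of_le zero_le_one] at this
  have hc0 : ContinuousOn (fun x => f x 0) (Icc 0 1) := continuousOn_pi.1 hc 0
  have hc1 : ContinuousOn (fun x => f x 1) (Icc 0 1) := continuousOn_pi.1 hc 1
  have hq := memLp_intervalIntegrable (memLp_qFun v)
  have hp := memLp_intervalIntegrable (memLp_pFun v)
  have hac : ∀ c : ℂ, ‖c‖ = 1 → AbsolutelyContinuousOnInterval (fun x => f x 0 + c * f x 1) 0 1 := by
    intro c hc
    refine absolutelyContinuousOnInterval_of_dist_le (C := 2) h.1 fun x _ y _ => ?_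
    rw [dist_eq_norm, dist_eq_norm]
    have h0 := norm_le_pi_norm (f x - f y) 0
    have h1 := norm_le_pi_norm (f x - f y) 1
    calc ‖f x 0 + c * f x 1 - (f y 0 + c * f y 1)‖
        = ‖(f x - f y) 0 + c * (f x - f y) 1‖ := by
          congr 1; simp only [Pi.sub_apply]; ring
      _ ≤ ‖(f x - f y) 0‖ + ‖(f x - f y) 1‖ := by
          refine (norm_add_le _ _).trans ?_
          rw [norm_mul, hc, one_mul]
      _ ≤ _ := by linarith
  constructor
  · refine prim_of_absolutelyContinuous (by simpa [sub_eq_add_neg] using hac (-I) (by simp)) ?_ ?_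
    · exact (intervalIntegrable_mul_continuousOn intervalIntegrable_const
        (hc0.sub (hc1.const_smul I))).add
        (intervalIntegrable_mul_continuousOn hq (hc0.add (hc1.const_smul I)))
    · filter_upwards [ae_unitInterval h.2] with x hx hm
      obtain ⟨f', hf', he⟩ := hx hm
      have e0 := congrFun he 0
      have e1 := congrFun he 1
      simp only [J, potMatrix, Pi.add_apply, Pi.smul_apply, smul_eq_mul, Matrix.mulVec,
        dotProduct, Fin.sum_univ_two, Matrix.of_apply, Matrix.cons_val_zero, Matrix.cons_val_one,
        Matrix.cons_val', Matrix.cons_val_fin_one] at e0 e1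
      have hd := (hasDerivAt_pi.1 hf' 0).sub ((hasDerivAt_pi.1 hf' 1).const_mul I)
      convert! hd using 1
      simp only [qFun]
      linear_combination e1 + I * e0 + (z * f x 1 + v x 0 * f x 1) * Complex.I_sq
  · refine prim_of_absolutelyContinuous (hac I (by simp)) ?_ ?_
    · exact (intervalIntegrable_mul_continuousOn intervalIntegrable_const
        (hc0.add (hc1.const_smul I))).add
        (intervalIntegrable_mul_continuousOn hp (hc0.sub (hc1.const_smul I)))
    · filter_upwards [ae_unitInterval h.2] with x hx hm
      obtain ⟨f', hf', he⟩ := hx hm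
      have e0 := congrFun he 0
      have e1 := congrFun he 1
      simp only [J, potMatrix, Pi.add_apply, Pi.smul_apply, smul_eq_mul, Matrix.mulVec,
        dotProduct, Fin.sum_univ_two, Matrix.of_apply, Matrix.cons_val_zero, Matrix.cons_val_one,
        Matrix.cons_val', Matrix.cons_val_fin_one] at e0 e1
      have hd := (hasDerivAt_pi.1 hf' 0).add ((hasDerivAt_pi.1 hf' 1).const_mul I)
      convert! hd using 1
      simp only [pFun]
      linear_combination e1 - I * e0 + (z * f x 1 + v x 0 * f x 1) * Complex.I_sq

theorem isSolution_of_isSystem {v : PotentialC} {z : ℂ} {a b : ℝ → ℂ}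
    (h : IsSystem (qFun v) (pFun v) z a b) :
    IsSolution v z (fun x => ![(a x + b x) / 2, I * (a x - b x) / 2]) := by
  constructor
  · have h1 : AbsolutelyContinuousOnInterval
        (fun x => a x • (![1 / 2, I / 2] : Fin 2 → ℂ)) 0 1 := by
      refine absolutelyContinuousOnInterval_of_dist_le (C := ‖(![1 / 2, I / 2] : Fin 2 → ℂ)‖)
        h.1.absolutelyContinuous fun x _ y _ => ?_
      rw [dist_eq_norm, dist_eq_norm, ← sub_smul, norm_smul, mul_comm]
    have h2 : AbsolutelyContinuousOnInterval
        (fun x => b x • (![1 / 2, -I / 2] : Fin 2 → ℂ)) 0 1 := by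
      refine absolutelyContinuousOnInterval_of_dist_le (C := ‖(![1 / 2, -I / 2] : Fin 2 → ℂ)‖)
        h.2.absolutelyContinuous fun x _ y _ => ?_
      rw [dist_eq_norm, dist_eq_norm, ← sub_smul, norm_smul, mul_comm]
    convert! h1.add h2 using 1
    funext x k
    fin_cases k
    · simp; ring
    · simp; ring
  · refine (ae_restrict_iff' measurableSet_Ioo).2 ?_
    filter_upwards [h.1.ae_hasDerivAt, h.2.ae_hasDerivAt] with x ha hb hm
    have hd : ∀ k : Fin 2, HasDerivAt (fun x => (![(a x + b x) / 2, I * (a x - b x) / 2] :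
        Fin 2 → ℂ) k) ((![((-(I * z) * a x + qFun v x * b x) + (I * z * b x + pFun v x * a x)) / 2,
          I * ((-(I * z) * a x + qFun v x * b x) - (I * z * b x + pFun v x * a x)) / 2] :
            Fin 2 → ℂ) k) x := by
      intro k
      fin_cases k
      · exact ((ha hm).add (hb hm)).div_const 2
      · exact (((ha hm).sub (hb hm)).const_mul I).div_const 2
    refine ⟨_, hasDerivAt_pi.2 hd, ?_⟩
    funext k
    fin_cases k
    · simp [J, potMatrix, qFun, pFun]
      linear_combination (z * (-a x - b x) / 2 + v x 0 * (a x + b x) / 2) * Complex.I_sq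
    · simp [J, potMatrix, qFun, pFun]
      ring

/-- Since ϑ is defined by choice, a solution must be exhibited before anything can be said about it;
the initial vector (1, 0) corresponds to a(0) = b(0) = 1. -/
theorem theta_spec (v : PotentialC) (z : ℂ) :
    IsSolution v z (theta v z) ∧ theta v z 0 = ![1, 0] := by
  have : ∃ f, IsSolution v z f ∧ f 0 = ![1, 0] :=
    ⟨_, isSolution_of_isSystem (isSystem_sol v z), by simp [aSol_zero, bSol_zero]⟩
  exact Classical.epsilon_spec this

theorem IsSolution.unique {v : PotentialC} {z : ℂ} {f g : ℝ → Fin 2 → ℂ} (hf : IsSolution v z f)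
    (hg : IsSolution v z g) (h0 : f 0 = g 0) {x : ℝ} (hx : x ∈ Icc (0 : ℝ) 1) : f x = g x := by
  obtain ⟨e1, e2⟩ := (isSystem_of_isSolution hf).unique (isSystem_of_isSolution hg)
    (memLp_intervalIntegrable (memLp_qFun v)) (memLp_intervalIntegrable (memLp_pFun v))
    (by simp [h0]) (by simp [h0]) hx
  have h1 : f x 0 = g x 0 := by linear_combination (e1 + e2) / 2
  have h2 : f x 1 = g x 1 := by
    linear_combination I * (e1 - e2) / 2 + (f x 1 - g x 1) * Complex.I_sq
  funext k
  fin_cases k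
  · exact h1
  · exact h2

theorem theta_eq (v : PotentialC) (z : ℂ) {x : ℝ} (hx : x ∈ Icc (0 : ℝ) 1) :
    theta v z x = ![(aSol v z x + bSol v z x) / 2, I * (aSol v z x - bSol v z x) / 2] :=
  (theta_spec v z).1.unique (isSolution_of_isSystem (isSystem_sol v z))
    (by rw [(theta_spec v z).2]; simp [aSol_zero, bSol_zero]) hx

theorem theta_one_zero (v : PotentialC) (z : ℂ) :
    theta v z 1 0 = (aSol v z 1 + bSol v z 1) / 2 := by
  rw [theta_eq v z (by simp)]; rfl

theorem theta_one_one (v : PotentialC) (z : ℂ) :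
    theta v z 1 1 = I * (aSol v z 1 - bSol v z 1) / 2 := by
  rw [theta_eq v z (by simp)]; rfl

theorem IsSolution.const_smul {v : PotentialC} {z : ℂ} {f : ℝ → Fin 2 → ℂ} (hf : IsSolution v z f)
    (c : ℂ) : IsSolution v z (fun x => c • f x) := by
  refine ⟨hf.1.const_smul c, ?_⟩
  filter_upwards [hf.2] with x ⟨f', hf', he⟩
  refine ⟨c • f', hf'.const_smul c, ?_⟩
  rw [Matrix.mulVec_smul, Matrix.mulVec_smul, ← smul_add, he, smul_comm]

/-- The eigenvalues for a boundary condition `f₂(0) = 0` are the zeros of a component of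
`ϑ(1, ·)`. -/
theorem mem_eigenvalues_iff (v : PotentialC) (z : ℂ) {j : Fin 2} :
    z ∈ eigenvalues 1 j v ↔ theta v z 1 j = 0 := by
  constructor
  · rintro ⟨f, hf, ⟨x, hx, hne⟩, h0, h1⟩
    have key : ∀ x ∈ Icc (0 : ℝ) 1, f x = f 0 0 • theta v z x := by
      intro x hx
      refine hf.unique ((theta_spec v z).1.const_smul (f 0 0)) ?_ hx
      rw [(theta_spec v z).2]
      funext k
      fin_cases k
      · simp
      · simpa using h0
    have hc : f 0 0 ≠ 0 := by
      intro hc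
      exact hne (by rw [key x hx, hc, zero_smul])
    have := congrFun (key 1 (by simp)) j
    rw [h1, Pi.smul_apply, smul_eq_mul] at this
    exact (mul_eq_zero.1 this.symm).resolve_left hc
  · intro h
    refine ⟨theta v z, (theta_spec v z).1, ⟨0, by simp, ?_⟩, ?_, h⟩
    · rw [(theta_spec v z).2]
      intro hc
      simpa using congrFun hc 0
    · rw [(theta_spec v z).2]; simp

end Conversion

/-! ### Expansion of the solutions for large frequencies -/

section Expansion

open Complex (I)

theorem norm_integral_le_unit {f : ℝ → ℂ} {g : ℝ → ℝ} (hg : IntervalIntegrable g volume 0 1)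
    (hg0 : ∀ t, 0 ≤ g t) (h : ∀ t ∈ Icc (0 : ℝ) 1, ‖f t‖ ≤ g t) {x : ℝ}
    (hx : x ∈ Icc (0 : ℝ) 1) : ‖∫ t in (0 : ℝ)..x, f t‖ ≤ ∫ t in (0 : ℝ)..1, g t :=
  (intervalIntegral.norm_integral_le_of_norm_le hx.1
    (Eventually.of_forall fun t ht => h t ⟨ht.1.le, ht.2.trans hx.2⟩)
    (intervalIntegrable_sub hg (by simp) hx)).trans (integral_norm_mono hg hg0 hx)

theorem integral_mono_unit {f g : ℝ → ℝ} (hf : IntervalIntegrable f volume 0 1)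
    (hg : IntervalIntegrable g volume 0 1) (h : ∀ t ∈ Icc (0 : ℝ) 1, f t ≤ g t) :
    ∫ t in (0 : ℝ)..1, f t ≤ ∫ t in (0 : ℝ)..1, g t :=
  intervalIntegral.integral_mono_on zero_le_one hf hg h

/-- `A' = Q B`, `B' = P A` with `A(0) = B(0) = 1`, and `T` is the primitive of `Q`. -/
theorem coupled_expansion {Q P A B : ℝ → ℂ} (hQ : IntervalIntegrable Q volume 0 1)
    (hA : Prim A (fun x => Q x * B x)) (hB : Prim B (fun x => P x * A x)) (hA0 : A 0 = 1)
    (hB0 : B 0 = 1) {x : ℝ} (hx : x ∈ Icc (0 : ℝ) 1) :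
    A x - 1 = (∫ t in (0 : ℝ)..x, Q t) + (∫ t in (0 : ℝ)..x, Q t) * (∫ t in (0 : ℝ)..x, P t * A t)
      - ∫ t in (0 : ℝ)..x, (∫ s in (0 : ℝ)..t, Q s) * (P t * A t) := by
  have hT := prim_integral hQ
  -- Integrating QB by parts through T trades the oscillating factor Q, which is not small, for its
  -- primitive T, which is.
  have h := (hT.mul hB).2 x hx
  have hcT : ContinuousOn (fun t => ∫ s in (0 : ℝ)..t, Q s) (Icc 0 1) := hT.continuousOn
  have hi2 : IntervalIntegrable (fun t => (∫ s in (0 : ℝ)..t, Q s) * (P t * A t)) volume 0 1 := by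
    simpa only [mul_comm] using intervalIntegrable_mul_continuousOn hB.1 hcT
  rw [intervalIntegral.integral_add (intervalIntegrable_sub hA.1 (by simp) hx)
    (intervalIntegrable_sub hi2 (by simp) hx)] at h
  have h1 := hA.2 x hx
  have h2 := hB.2 x hx
  rw [hA0] at h1
  rw [hB0] at h2
  simp only [intervalIntegral.integral_same, zero_mul, zero_add] at h
  linear_combination h1 - h + (∫ t in (0 : ℝ)..x, Q t) * h2

variable {Q P A B : ℝ → ℂ} {w : ℝ → ℝ} {M W : ℝ}

/-- Each term of `coupled_expansion` contains the primitive of Q, while its other factors are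
bounded; so A - 1 is controlled by that primitive alone. -/
theorem coupled_first_order (hQ : IntervalIntegrable Q volume 0 1)
    (hA : Prim A (fun x => Q x * B x)) (hB : Prim B (fun x => P x * A x)) (hA0 : A 0 = 1)
    (hB0 : B 0 = 1) (hw : IntervalIntegrable w volume 0 1) (hw0 : ∀ x, 0 ≤ w x)
    (hP : ∀ x ∈ Icc (0 : ℝ) 1, ‖P x‖ ≤ w x) (hW : ∫ t in (0 : ℝ)..1, w t ≤ W)
    (hM0 : 0 ≤ M) (hM : ∀ x ∈ Icc (0 : ℝ) 1, ‖A x‖ ≤ M) {x : ℝ} (hx : x ∈ Icc (0 : ℝ) 1) :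
    ‖A x - 1‖ ≤ (1 + M * W) * ‖∫ t in (0 : ℝ)..x, Q t‖ +
      M * ∫ t in (0 : ℝ)..1, w t * ‖∫ s in (0 : ℝ)..t, Q s‖ := by
  have hT := prim_integral hQ
  have hwT := intervalIntegrable_mul_continuousOn hw hT.continuousOn.norm
  have h1 : ‖∫ t in (0 : ℝ)..x, P t * A t‖ ≤ M * W := by
    refine (norm_integral_le_unit (g := fun t => w t * M) (hw.mul_const M)
      (fun t => mul_nonneg (hw0 t) hM0) (fun t ht => ?_) hx).trans ?_
    · rw [norm_mul]
      exact mul_le_mul (hP t ht) (hM t ht) (norm_nonneg _) (hw0 t)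
    · rw [intervalIntegral.integral_mul_const, mul_comm]
      exact mul_le_mul_of_nonneg_left hW hM0
  have h2 : ‖∫ t in (0 : ℝ)..x, (∫ s in (0 : ℝ)..t, Q s) * (P t * A t)‖ ≤
      M * ∫ t in (0 : ℝ)..1, w t * ‖∫ s in (0 : ℝ)..t, Q s‖ := by
    rw [← intervalIntegral.integral_const_mul]
    refine norm_integral_le_unit (hwT.const_mul M)
      (fun t => mul_nonneg hM0 (mul_nonneg (hw0 t) (norm_nonneg _))) (fun t ht => ?_) hx
    rw [norm_mul, norm_mul]
    calc ‖∫ s in (0 : ℝ)..t, Q s‖ * (‖P t‖ * ‖A t‖) ≤ ‖∫ s in (0 : ℝ)..t, Q s‖ * (w t * M) :=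
          mul_le_mul_of_nonneg_left (mul_le_mul (hP t ht) (hM t ht) (norm_nonneg _) (hw0 t))
            (norm_nonneg _)
      _ = _ := by ring
  rw [coupled_expansion hQ hA hB hA0 hB0 hx]
  refine (norm_sub_le _ _).trans (add_le_add ?_ h2)
  refine (norm_add_le _ _).trans ?_
  rw [norm_mul, add_mul, one_mul, mul_comm (M * W)]
  exact add_le_add le_rfl (mul_le_mul_of_nonneg_left h1 (norm_nonneg _))

/-- Replacing A by 1 inside `coupled_expansion` and integrating by parts once more produces the
iterated integral of Q and P. What is left over pairs the primitive of Q with A - 1, a product of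
two small quantities. -/
theorem coupled_second_order (hQ : IntervalIntegrable Q volume 0 1)
    (hPi : IntervalIntegrable P volume 0 1)
    (hA : Prim A (fun x => Q x * B x)) (hB : Prim B (fun x => P x * A x)) (hA0 : A 0 = 1)
    (hB0 : B 0 = 1) (hw : IntervalIntegrable w volume 0 1) (hw0 : ∀ x, 0 ≤ w x)
    (hP : ∀ x ∈ Icc (0 : ℝ) 1, ‖P x‖ ≤ w x) :
    ‖A 1 - 1 - (∫ t in (0 : ℝ)..1, Q t) - ∫ t in (0 : ℝ)..1, Q t * ∫ s in (0 : ℝ)..t, P s‖ ≤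
      ‖∫ t in (0 : ℝ)..1, Q t‖ * (∫ t in (0 : ℝ)..1, w t * ‖A t - 1‖) +
      ∫ t in (0 : ℝ)..1, w t * (‖∫ s in (0 : ℝ)..t, Q s‖ * ‖A t - 1‖) := by
  have hT := prim_integral hQ
  have hS := prim_integral hPi
  have h1 : (1 : ℝ) ∈ Icc (0 : ℝ) 1 := by simp
  have hTc := hT.continuousOn
  have hAc : ContinuousOn (fun t => A t - 1) (Icc 0 1) := hA.continuousOn.sub continuousOn_const
  have iTP : IntervalIntegrable (fun t => (∫ s in (0 : ℝ)..t, Q s) * P t) volume 0 1 := by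
    simpa only [mul_comm] using intervalIntegrable_mul_continuousOn hPi hTc
  have iPA := intervalIntegrable_mul_continuousOn hPi hAc
  have iTPA : IntervalIntegrable (fun t => (∫ s in (0 : ℝ)..t, Q s) * (P t * (A t - 1)))
      volume 0 1 := by
    simpa only [mul_comm] using intervalIntegrable_mul_continuousOn iPA hTc
  have iQS := intervalIntegrable_mul_continuousOn hQ hS.continuousOn
  have e0 := coupled_expansion hQ hA hB hA0 hB0 h1
  have e1 := (hT.mul hS).2 1 h1
  rw [intervalIntegral.integral_add iQS iTP] at e1
  simp only [intervalIntegral.integral_same, zero_mul, zero_add] at e1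
  have e2 : ∫ t in (0 : ℝ)..1, P t * A t =
      (∫ t in (0 : ℝ)..1, P t) + ∫ t in (0 : ℝ)..1, P t * (A t - 1) := by
    rw [← intervalIntegral.integral_add hPi iPA]
    refine intervalIntegral.integral_congr fun t _ => ?_
    ring
  have e3 : ∫ t in (0 : ℝ)..1, (∫ s in (0 : ℝ)..t, Q s) * (P t * A t) =
      (∫ t in (0 : ℝ)..1, (∫ s in (0 : ℝ)..t, Q s) * P t) +
        ∫ t in (0 : ℝ)..1, (∫ s in (0 : ℝ)..t, Q s) * (P t * (A t - 1)) := by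
    rw [← intervalIntegral.integral_add iTP iTPA]
    refine intervalIntegral.integral_congr fun t _ => ?_
    ring
  have e4 : A 1 - 1 - (∫ t in (0 : ℝ)..1, Q t) - ∫ t in (0 : ℝ)..1, Q t * ∫ s in (0 : ℝ)..t, P s =
      (∫ t in (0 : ℝ)..1, Q t) * (∫ t in (0 : ℝ)..1, P t * (A t - 1)) -
        ∫ t in (0 : ℝ)..1, (∫ s in (0 : ℝ)..t, Q s) * (P t * (A t - 1)) := by
    rw [e0, e2, e3]
    linear_combination e1
  rw [e4]
  refine (norm_sub_le _ _).trans (add_le_add ?_ ?_)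
  · rw [norm_mul]
    refine mul_le_mul_of_nonneg_left ?_ (norm_nonneg _)
    refine norm_integral_le_unit (intervalIntegrable_mul_continuousOn hw hAc.norm)
      (fun t => mul_nonneg (hw0 t) (norm_nonneg _)) (fun t ht => ?_) h1
    rw [norm_mul]
    exact mul_le_mul_of_nonneg_right (hP t ht) (norm_nonneg _)
  · refine norm_integral_le_unit (intervalIntegrable_mul_continuousOn hw (hTc.norm.mul hAc.norm))
      (fun t => mul_nonneg (hw0 t) (mul_nonneg (norm_nonneg _) (norm_nonneg _))) (fun t ht => ?_) h1
    rw [norm_mul, norm_mul, mul_left_comm]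
    exact mul_le_mul_of_nonneg_right (hP t ht) (by positivity)

end Expansion

/-! ### Partial Fourier integrals and small shifts of the frequency. -/

section Frequencies

open Complex (I)

/-- The partial Fourier integral `∫₀ˣ f(t) e^{2πint} dt`. -/
noncomputable def T0 (f : ℝ → ℂ) (n : ℤ) (x : ℝ) : ℂ :=
  ∫ t in (0 : ℝ)..x, f t * Complex.exp (2 * Real.pi * I * n * t)

/-- The iterated Fourier integral `∫₀¹ q(x) e^{2πinx} ∫₀ˣ p(t) e^{-2πint} dt dx`. -/
noncomputable def D0 (q p : ℝ → ℂ) (n : ℤ) : ℂ :=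
  ∫ t in (0 : ℝ)..1, q t * Complex.exp (2 * Real.pi * I * n * t) * T0 p (-n) t

/-- The `L²` norm on the unit interval. -/
noncomputable def L2n (f : ℝ → ℂ) : ℝ := √(∫ x in (0 : ℝ)..1, ‖f x‖ ^ 2)

/-- The size of the partial Fourier integrals at frequency `n`. -/
noncomputable def fSize (f : ℝ → ℂ) (n : ℤ) : ℝ := ‖T0 f n 1‖ + L2n (T0 f n)

theorem L2n_nonneg (f : ℝ → ℂ) : 0 ≤ L2n f := Real.sqrt_nonneg _

theorem fSize_nonneg (f : ℝ → ℂ) (n : ℤ) : 0 ≤ fSize f n :=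
  add_nonneg (norm_nonneg _) (L2n_nonneg _)

theorem norm_cexp_freq (n : ℤ) (t : ℝ) : ‖Complex.exp (2 * Real.pi * I * n * t)‖ = 1 := by
  rw [Complex.norm_exp]; simp

theorem intervalIntegrable_freq {f : ℝ → ℂ} (hf : IntervalIntegrable f volume 0 1) (n : ℤ) :
    IntervalIntegrable (fun t : ℝ => f t * Complex.exp (2 * Real.pi * I * n * t)) volume 0 1 :=
  intervalIntegrable_mul_continuousOn hf (by fun_prop)

theorem prim_T0 {f : ℝ → ℂ} (hf : IntervalIntegrable f volume 0 1) (n : ℤ) :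
    Prim (T0 f n) (fun t : ℝ => f t * Complex.exp (2 * Real.pi * I * n * t)) :=
  prim_integral (intervalIntegrable_freq hf n)

theorem memLp_of_continuousOn {f : ℝ → ℂ} (hf : ContinuousOn f (Icc 0 1)) : MemLp f 2 μ₀ := by
  obtain ⟨C, hC⟩ := isCompact_Icc.exists_bound_of_continuousOn hf
  have hm : AEStronglyMeasurable f μ₀ :=
    (hf.mono Ioo_subset_Icc_self).aestronglyMeasurable measurableSet_Ioo
  refine MemLp.of_bound hm C ?_
  exact (ae_restrict_iff' measurableSet_Ioo).2
    (Eventually.of_forall fun x hx => hC x (Ioo_subset_Icc_self hx))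

theorem integral_norm_T0_le {f : ℝ → ℂ} (hf : IntervalIntegrable f volume 0 1) (n : ℤ) :
    ∫ t in (0 : ℝ)..1, ‖T0 f n t‖ ≤ fSize f n :=
  (integral_norm_le_sqrt (memLp_of_continuousOn (prim_T0 hf n).continuousOn)).trans
    (le_add_of_nonneg_left (norm_nonneg _))

theorem integral_mul_norm_T0_le {f p : ℝ → ℂ} (hf : IntervalIntegrable f volume 0 1)
    (hp : MemLp p 2 μ₀) (n : ℤ) :
    ∫ t in (0 : ℝ)..1, ‖p t‖ * ‖T0 f n t‖ ≤ L2n p * fSize f n :=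
  (cauchySchwarz hp (memLp_of_continuousOn (prim_T0 hf n).continuousOn)).trans
    (mul_le_mul_of_nonneg_left (le_add_of_nonneg_left (norm_nonneg _)) (L2n_nonneg _))

theorem norm_cexp_mul_le {c : ℂ} {D : ℝ} (hc : ‖c‖ ≤ D) {x : ℝ} (hx : x ∈ Icc (0 : ℝ) 1) :
    ‖Complex.exp (c * x)‖ ≤ Real.exp D := by
  rw [Complex.norm_exp, Real.exp_le_exp]
  refine (Complex.re_le_norm _).trans ?_
  rw [norm_mul, Complex.norm_real, Real.norm_of_nonneg hx.1]
  exact (mul_le_of_le_one_right (norm_nonneg _) hx.2).trans hc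

/-- The factor e^{ct} measures the deviation from an integer frequency. Integration by parts reduces
the shifted integral to integrals at the integer frequency, where Bessel's inequality is available.
-/
theorem integral_shift_eq {f : ℝ → ℂ} (hf : IntervalIntegrable f volume 0 1) (n : ℤ) (c : ℂ)
    {x : ℝ} (hx : x ∈ Icc (0 : ℝ) 1) :
    ∫ t in (0 : ℝ)..x, f t * Complex.exp (2 * Real.pi * I * n * t) * Complex.exp (c * t) =
      T0 f n x * Complex.exp (c * x) - c * ∫ t in (0 : ℝ)..x, T0 f n t * Complex.exp (c * t) := by
  have hT := prim_T0 hf n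
  have h := (hT.mul (prim_cexp c)).2 x hx
  have hc : ContinuousOn (fun t : ℝ => Complex.exp (c * t)) (Icc 0 1) := by fun_prop
  have i1 := intervalIntegrable_mul_continuousOn hT.1 hc
  have i2 : IntervalIntegrable (fun t : ℝ => T0 f n t * (c * Complex.exp (c * t))) volume 0 1 :=
    (hT.continuousOn.mul (continuousOn_const.mul hc)).intervalIntegrable_of_Icc zero_le_one
  rw [intervalIntegral.integral_add (intervalIntegrable_sub i1 (by simp) hx)
    (intervalIntegrable_sub i2 (by simp) hx)] at h
  rw [← intervalIntegral.integral_const_mul]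
  have h0 : T0 f n 0 = 0 := by simp [T0]
  beta_reduce at h
  rw [h0, zero_mul, zero_add] at h
  rw [h, eq_sub_iff_add_eq]
  congr 1
  refine intervalIntegral.integral_congr fun t _ => ?_
  ring

theorem norm_integral_T0_mul_le {f : ℝ → ℂ} (hf : IntervalIntegrable f volume 0 1) (n : ℤ) {c : ℂ}
    {D : ℝ} (hc : ‖c‖ ≤ D) {x : ℝ} (hx : x ∈ Icc (0 : ℝ) 1) :
    ‖∫ t in (0 : ℝ)..x, T0 f n t * Complex.exp (c * t)‖ ≤ Real.exp D * fSize f n := by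
  have hT := (prim_T0 hf n).continuousOn
  calc _ ≤ ∫ t in (0 : ℝ)..1, Real.exp D * ‖T0 f n t‖ := by
        refine norm_integral_le_unit
          ((continuousOn_const.mul hT.norm).intervalIntegrable_of_Icc zero_le_one)
          (fun t => mul_nonneg (Real.exp_pos _).le (norm_nonneg _)) (fun t ht => ?_) hx
        rw [norm_mul, mul_comm]
        exact mul_le_mul_of_nonneg_right (norm_cexp_mul_le hc ht) (norm_nonneg _)
    _ = Real.exp D * ∫ t in (0 : ℝ)..1, ‖T0 f n t‖ := intervalIntegral.integral_const_mul _ _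
    _ ≤ _ := mul_le_mul_of_nonneg_left (integral_norm_T0_le hf n) (Real.exp_pos _).le

theorem norm_integral_shift_le {f : ℝ → ℂ} (hf : IntervalIntegrable f volume 0 1) (n : ℤ) {c : ℂ}
    {D : ℝ} (hc : ‖c‖ ≤ D) {x : ℝ} (hx : x ∈ Icc (0 : ℝ) 1) :
    ‖∫ t in (0 : ℝ)..x, f t * Complex.exp (2 * Real.pi * I * n * t) * Complex.exp (c * t)‖ ≤
      Real.exp D * (‖T0 f n x‖ + D * fSize f n) := by
  rw [integral_shift_eq hf n c hx]
  refine (norm_sub_le _ _).trans ?_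
  rw [norm_mul, norm_mul]
  have h1 := mul_le_mul_of_nonneg_left (norm_cexp_mul_le hc hx) (norm_nonneg (T0 f n x))
  have h2 := mul_le_mul hc (norm_integral_T0_mul_le hf n hc hx) (norm_nonneg _)
    ((norm_nonneg _).trans hc)
  linarith

theorem norm_cexp_sub_one_le (c : ℂ) {D : ℝ} (hc : ‖c‖ ≤ D) :
    ‖Complex.exp c - 1‖ ≤ ‖c‖ * Real.exp D := by
  have := Complex.norm_exp_sub_sum_le_norm_mul_exp c 1
  simp only [Finset.range_one, Finset.sum_singleton, pow_zero, Nat.factorial_zero, Nat.cast_one,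
    div_one, pow_one] at this
  exact this.trans (mul_le_mul_of_nonneg_left (Real.exp_le_exp.2 hc) (norm_nonneg _))

/-- The factor ‖c‖ is kept explicit: at an eigenvalue c is itself of first order, which makes this
error quadratic. -/
theorem norm_integral_shift_sub_le {f : ℝ → ℂ} (hf : IntervalIntegrable f volume 0 1) (n : ℤ)
    {c : ℂ} {D : ℝ} (hc : ‖c‖ ≤ D) :
    ‖(∫ t in (0 : ℝ)..1, f t * Complex.exp (2 * Real.pi * I * n * t) * Complex.exp (c * t)) -
      T0 f n 1‖ ≤ ‖c‖ * (2 * Real.exp D * fSize f n) := by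
  rw [integral_shift_eq hf n c (by simp)]
  have h1 := norm_cexp_sub_one_le c hc
  have h2 := norm_integral_T0_mul_le hf n hc (x := 1) (by simp)
  have h3 : ‖T0 f n 1‖ ≤ fSize f n := le_add_of_nonneg_right (L2n_nonneg _)
  have e : T0 f n 1 * Complex.exp (c * (1 : ℝ)) - c * (∫ t in (0 : ℝ)..1, T0 f n t *
      Complex.exp (c * t)) - T0 f n 1 = T0 f n 1 * (Complex.exp c - 1) -
        c * ∫ t in (0 : ℝ)..1, T0 f n t * Complex.exp (c * t) := by
    simp only [Complex.ofReal_one, mul_one]; ring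
  rw [e]
  refine (norm_sub_le _ _).trans ?_
  rw [norm_mul, norm_mul]
  have h4 := mul_le_mul h3 h1 (norm_nonneg _) (fSize_nonneg f n)
  have h5 := mul_le_mul_of_nonneg_left h2 (norm_nonneg c)
  linarith

/-- In the inner integral, the boundary term of `integral_shift_eq` carries e^{-ct}, which cancels
the outer e^{ct}. Only the correction with the factor c survives. -/
theorem norm_integral_shift_mul_sub_D0_le {q p : ℝ → ℂ} (hq : IntervalIntegrable q volume 0 1)
    (hp : IntervalIntegrable p volume 0 1) (n : ℤ) {c : ℂ} {D : ℝ} (hc : ‖c‖ ≤ D) :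
    ‖(∫ t in (0 : ℝ)..1, q t * Complex.exp (2 * Real.pi * I * n * t) * Complex.exp (c * t) *
      ∫ s in (0 : ℝ)..t, p s * Complex.exp (2 * Real.pi * I * (-n : ℤ) * s) * Complex.exp (-c * s))
      - D0 q p n‖ ≤
      ‖c‖ * (Real.exp D * Real.exp D * (∫ t in (0 : ℝ)..1, ‖q t‖) * fSize p (-n)) := by
  have hS := prim_T0 hp (-n)
  have hcc : ContinuousOn (fun t : ℝ => Complex.exp (c * t)) (Icc 0 1) := by fun_prop
  have hcc' : ContinuousOn (fun t : ℝ => Complex.exp (-c * t)) (Icc 0 1) := by fun_prop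
  have iq := intervalIntegrable_freq hq n
  have hR : ContinuousOn (fun x : ℝ => ∫ t in (0 : ℝ)..x, T0 p (-n) t * Complex.exp (-c * t))
      (Icc 0 1) :=
    (prim_integral ((hS.continuousOn.mul hcc').intervalIntegrable_of_Icc zero_le_one)).continuousOn
  have iS := intervalIntegrable_mul_continuousOn
    (intervalIntegrable_mul_continuousOn (intervalIntegrable_freq hp (-n)) hcc')
    (continuousOn_const (c := (1 : ℂ)))
  simp only [mul_one] at iS
  rw [D0, ← intervalIntegral.integral_sub
    (intervalIntegrable_mul_continuousOn (intervalIntegrable_mul_continuousOn iq hcc)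
      (prim_integral iS).continuousOn)
    (intervalIntegrable_mul_continuousOn iq hS.continuousOn)]
  calc _ ≤ ∫ t in (0 : ℝ)..1, ‖q t‖ * (‖c‖ * (Real.exp D * Real.exp D * fSize p (-n))) := by
        refine norm_integral_le_unit (hq.norm.mul_const _)
          (fun t => mul_nonneg (norm_nonneg _) (mul_nonneg (norm_nonneg _)
            (mul_nonneg (by positivity) (fSize_nonneg _ _)))) (fun t ht => ?_) (by simp)
        have he : Complex.exp (c * t) * Complex.exp (-c * t) = 1 := by
          rw [← Complex.exp_add]; simp
        rw [integral_shift_eq hp (-n) (-c) ht]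
        have e : q t * Complex.exp (2 * Real.pi * I * n * t) * Complex.exp (c * t) *
            (T0 p (-n) t * Complex.exp (-c * t) - -c * ∫ s in (0 : ℝ)..t, T0 p (-n) s *
              Complex.exp (-c * s)) - q t * Complex.exp (2 * Real.pi * I * n * t) * T0 p (-n) t =
            q t * Complex.exp (2 * Real.pi * I * n * t) * (c * (Complex.exp (c * t) *
              ∫ s in (0 : ℝ)..t, T0 p (-n) s * Complex.exp (-c * s))) := by
          linear_combination (q t * Complex.exp (2 * Real.pi * I * n * t) * T0 p (-n) t) * he
        rw [e, norm_mul, norm_mul, norm_cexp_freq, mul_one, norm_mul, norm_mul]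
        refine mul_le_mul_of_nonneg_left (mul_le_mul_of_nonneg_left ?_ (norm_nonneg _))
          (norm_nonneg _)
        rw [mul_assoc]
        exact mul_le_mul (norm_cexp_mul_le hc ht)
          (norm_integral_T0_mul_le hp (-n) (by simpa using hc) ht) (norm_nonneg _)
          (Real.exp_pos _).le
    _ = _ := by rw [intervalIntegral.integral_mul_const]; ring

end Frequencies

/-! ### Expansion of solutions for spectral parameters near πn. -/

section SystemExpansion

open Complex (I)

/-- By this symmetry every estimate for a at frequency n yields one for b at frequency -n. -/
theorem IsSystem.symm {q p a b : ℝ → ℂ} {z : ℂ} (h : IsSystem q p z a b) :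
    IsSystem p q (-z) b a :=
  ⟨h.2.congr (fun _ _ => rfl) (Eventually.of_forall fun x _ => by ring),
    h.1.congr (fun _ _ => rfl) (Eventually.of_forall fun x _ => by ring)⟩

/-- The exponential factors absorb the diagonal of the system; the coefficient becomes q e^{2iλx},
split into an integer frequency and the shift e^{2iδx}. -/
theorem IsSystem.gauge {q p a b : ℝ → ℂ} {n : ℤ} {δ : ℂ}
    (h : IsSystem q p (Real.pi * n + δ) a b) :
    Prim (fun x : ℝ => Complex.exp (I * (Real.pi * n + δ) * x) * a x)
      (fun x : ℝ => q x * Complex.exp (2 * Real.pi * I * n * x) * Complex.exp (2 * I * δ * x) *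
        (Complex.exp (-(I * (Real.pi * n + δ)) * x) * b x)) := by
  refine h.1.exp_mul.congr (fun x _ => by rw [neg_neg]) (Eventually.of_forall fun x _ => ?_)
  have e : Complex.exp (2 * Real.pi * I * n * x) * Complex.exp (2 * I * δ * x) *
      Complex.exp (-(I * (Real.pi * n + δ)) * x) = Complex.exp (-(-(I * (Real.pi * n + δ))) * x) := by
    rw [← Complex.exp_add, ← Complex.exp_add]
    congr 1
    ring
  rw [← e]
  ring

theorem IsSystem.gauge' {q p a b : ℝ → ℂ} {n : ℤ} {δ : ℂ}
    (h : IsSystem q p (Real.pi * n + δ) a b) :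
    Prim (fun x : ℝ => Complex.exp (-(I * (Real.pi * n + δ)) * x) * b x)
      (fun x : ℝ => p x * Complex.exp (2 * Real.pi * I * (-n : ℤ) * x) *
        Complex.exp (-(2 * I * δ) * x) * (Complex.exp (I * (Real.pi * n + δ) * x) * a x)) := by
  refine h.2.exp_mul.congr (fun x _ => rfl) (Eventually.of_forall fun x _ => ?_)
  have e : Complex.exp (2 * Real.pi * I * (-n : ℤ) * x) * Complex.exp (-(2 * I * δ) * x) *
      Complex.exp ((I * (Real.pi * n + δ)) * x) = Complex.exp (-(I * (Real.pi * n + δ)) * x) := by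
    rw [← Complex.exp_add, ← Complex.exp_add]
    congr 1
    push_cast
    ring
  rw [← e]
  ring

theorem norm_gauge_le {q p a b : ℝ → ℂ} {n : ℤ} {δ : ℂ} {D K : ℝ}
    (h : IsSystem q p (Real.pi * n + δ) a b) (hq : MemLp q 2 μ₀) (hp : MemLp p 2 μ₀)
    (hqK : L2n q ≤ K) (hpK : L2n p ≤ K) (hδ : ‖δ‖ ≤ D) (ha : a 0 = 1) (hb : b 0 = 1) {x : ℝ}
    (hx : x ∈ Icc (0 : ℝ) 1) :
    ‖Complex.exp (I * (Real.pi * n + δ) * x) * a x‖ ≤ Real.exp (2 * D + 2 * K) := by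
  have hqi := memLp_intervalIntegrable hq
  have hpi := memLp_intervalIntegrable hp
  have hb := h.bound hqi hpi (k := fun x => ‖q x‖ + ‖p x‖) (hqi.norm.add hpi.norm)
    (fun x => by positivity) (Eventually.of_forall fun x => by simp)
    (Eventually.of_forall fun x => by simp) (M := 1) (by simp [ha]) (by simp [hb]) hx
  have hy : |((Real.pi : ℂ) * n + δ).im| ≤ D := by
    have : ((Real.pi : ℂ) * n + δ).im = δ.im := by simp
    rw [this]
    exact (Complex.abs_im_le_norm δ).trans hδ
  have hD : 0 ≤ D := (norm_nonneg _).trans hδ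
  have hInt : ∫ t in (0 : ℝ)..x, (‖q t‖ + ‖p t‖) ≤ 2 * K := by
    refine (integral_norm_mono (hqi.norm.add hpi.norm) (fun _ => by positivity) hx).trans ?_
    rw [intervalIntegral.integral_add hqi.norm hpi.norm]
    have h1 := (integral_norm_le_sqrt hq).trans hqK
    have h2 := (integral_norm_le_sqrt hp).trans hpK
    linarith
  have h1 : ‖a x‖ ≤ Real.exp (D + 2 * K) := by
    refine ((le_max_left _ _).trans hb).trans ?_
    rw [one_mul, ← Real.exp_add, Real.exp_le_exp]
    have : |((Real.pi : ℂ) * n + δ).im| * x ≤ D :=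
      (mul_le_of_le_one_right (abs_nonneg _) hx.2).trans hy
    linarith
  have h2 : ‖Complex.exp (I * (Real.pi * n + δ) * x)‖ ≤ Real.exp D := by
    rw [norm_cexp_mul_ofReal, Real.exp_le_exp]
    have e : (I * (Real.pi * n + δ)).re = -((Real.pi : ℂ) * n + δ).im := by simp
    rw [e]
    have h3 : -((Real.pi : ℂ) * n + δ).im ≤ D := (neg_le_abs _).trans hy
    nlinarith [hx.1, hx.2]
  rw [norm_mul]
  calc _ ≤ Real.exp D * Real.exp (D + 2 * K) :=
        mul_le_mul h2 h1 (norm_nonneg _) (Real.exp_pos _).le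
    _ = _ := by rw [← Real.exp_add]; congr 1; ring

theorem integral_mul_sq_add_le {f p : ℝ → ℂ} (hf : IntervalIntegrable f volume 0 1)
    (hp : MemLp p 2 μ₀) (n : ℤ) :
    ∫ t in (0 : ℝ)..1, ‖p t‖ * (‖T0 f n t‖ + fSize f n) ^ 2 ≤
      2 * ((∫ t in (0 : ℝ)..1, ‖p t‖ * ‖T0 f n t‖ ^ 2) + L2n p * fSize f n ^ 2) := by
  have hT := (prim_T0 hf n).continuousOn.norm
  have hpi := (memLp_intervalIntegrable hp).norm
  have i1 : IntervalIntegrable (fun t => ‖p t‖ * ‖T0 f n t‖ ^ 2) volume 0 1 :=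
    intervalIntegrable_mul_continuousOn hpi (hT.pow 2)
  have i2 := intervalIntegrable_mul_continuousOn hpi ((hT.add (continuousOn_const
    (c := fSize f n))).pow 2)
  calc _ ≤ ∫ t in (0 : ℝ)..1, 2 * (‖p t‖ * ‖T0 f n t‖ ^ 2 + ‖p t‖ * fSize f n ^ 2) := by
        refine integral_mono_unit i2 ((i1.add (hpi.mul_const _)).const_mul 2) fun t _ => ?_
        have := mul_nonneg (norm_nonneg (p t)) (sq_nonneg (‖T0 f n t‖ - fSize f n))
        nlinarith
    _ = 2 * ((∫ t in (0 : ℝ)..1, ‖p t‖ * ‖T0 f n t‖ ^ 2) +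
          (∫ t in (0 : ℝ)..1, ‖p t‖) * fSize f n ^ 2) := by
        rw [intervalIntegral.integral_const_mul, intervalIntegral.integral_add i1
          (hpi.mul_const _), intervalIntegral.integral_mul_const]
    _ ≤ _ := by
        have := mul_le_mul_of_nonneg_right (integral_norm_le_sqrt hp) (sq_nonneg (fSize f n))
        unfold L2n
        linarith

/-- First and second order expansion of the first component at `x = 1`, with constants depending
only on the norms of the coefficients and on the distance of the spectral parameter to `πn`. -/
theorem system_expansion {D K : ℝ} (hD : 0 ≤ D) (hK : 0 ≤ K) :
    ∃ C : ℝ, 0 ≤ C ∧ ∀ (q p : ℝ → ℂ), MemLp q 2 μ₀ → MemLp p 2 μ₀ → L2n q ≤ K → L2n p ≤ K →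
      ∀ (n : ℤ) (δ : ℂ), ‖δ‖ ≤ D → ∀ a b : ℝ → ℂ, IsSystem q p (Real.pi * n + δ) a b →
      a 0 = 1 → b 0 = 1 →
      (∀ x ∈ Icc (0 : ℝ) 1, ‖Complex.exp (I * (Real.pi * n + δ) * x) * a x - 1‖ ≤
        C * (‖T0 q n x‖ + fSize q n)) ∧
      ‖Complex.exp (I * (Real.pi * n + δ)) * a 1 - 1 - T0 q n 1 - D0 q p n‖ ≤
        C * (‖δ‖ * (fSize q n + fSize p (-n)) + fSize q n ^ 2 +
          ∫ t in (0 : ℝ)..1, ‖p t‖ * ‖T0 q n t‖ ^ 2) := by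
  set E := Real.exp (2 * D) with hE
  set M := Real.exp (2 * D + 2 * K) with hM
  have hE0 : 0 < E := Real.exp_pos _
  have hM0 : 0 < M := Real.exp_pos _
  -- The constant C1 serves the first order estimate and C2 collects what the second order estimate
  -- costs, so their sum works for both.
  set C1 := (1 + M * (E * K)) * E * (1 + 2 * D) + M * E * E * K * (1 + 2 * D) with hC1
  set C2 := 4 * E + 2 * (E * E) * K + 2 * (E * E) * C1 * (1 + 2 * D) * K +
    2 * (E * E) * C1 * (1 + 2 * D) * (1 + K) with hC2
  have hC10 : 0 ≤ C1 := by positivity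
  have hC20 : 0 ≤ C2 := by positivity
  refine ⟨C1 + C2, by positivity, ?_⟩
  intro q p hq hp hqK hpK n δ hδ a b hab ha0 hb0
  have hqi := memLp_intervalIntegrable hq
  have hpi := memLp_intervalIntegrable hp
  set ω := fSize q n with hω
  have hω0 : 0 ≤ ω := fSize_nonneg q n
  set c : ℂ := 2 * I * δ with hc
  have hcn : ‖c‖ = 2 * ‖δ‖ := by simp [hc]
  have hcD : ‖c‖ ≤ 2 * D := by rw [hcn]; linarith
  set A : ℝ → ℂ := fun x => Complex.exp (I * (Real.pi * n + δ) * x) * a x with hA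
  set B : ℝ → ℂ := fun x => Complex.exp (-(I * (Real.pi * n + δ)) * x) * b x with hB
  set Q : ℝ → ℂ := fun x => q x * Complex.exp (2 * Real.pi * I * n * x) * Complex.exp (c * x)
    with hQ
  set P : ℝ → ℂ := fun x => p x * Complex.exp (2 * Real.pi * I * (-n : ℤ) * x) *
    Complex.exp (-c * x) with hP
  have hcc : ContinuousOn (fun t : ℝ => Complex.exp (c * t)) (Icc 0 1) := by fun_prop
  have hcc' : ContinuousOn (fun t : ℝ => Complex.exp (-c * t)) (Icc 0 1) := by fun_prop
  have iQ : IntervalIntegrable Q volume 0 1 :=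
    intervalIntegrable_mul_continuousOn (intervalIntegrable_freq hqi n) hcc
  have iP : IntervalIntegrable P volume 0 1 :=
    intervalIntegrable_mul_continuousOn (intervalIntegrable_freq hpi (-n)) hcc'
  have pA : Prim A (fun x => Q x * B x) := hab.gauge
  have pB : Prim B (fun x => P x * A x) := hab.gauge'
  have hA0 : A 0 = 1 := by simp [hA, ha0]
  have hB0 : B 0 = 1 := by simp [hB, hb0]
  set w : ℝ → ℝ := fun t => E * ‖p t‖ with hw
  have iw : IntervalIntegrable w volume 0 1 := hpi.norm.const_mul E
  have hw0 : ∀ x, 0 ≤ w x := fun x => by positivity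
  have hPw : ∀ x ∈ Icc (0 : ℝ) 1, ‖P x‖ ≤ w x := by
    intro x hx
    simp only [hP, hw]
    rw [norm_mul, norm_mul, norm_cexp_freq, mul_one, mul_comm]
    exact mul_le_mul_of_nonneg_right (norm_cexp_mul_le (by simpa using hcD) hx) (norm_nonneg _)
  have hp1 : ∫ t in (0 : ℝ)..1, ‖p t‖ ≤ K := (integral_norm_le_sqrt hp).trans hpK
  have hq1 : ∫ t in (0 : ℝ)..1, ‖q t‖ ≤ K := (integral_norm_le_sqrt hq).trans hqK
  have hW : ∫ t in (0 : ℝ)..1, w t ≤ E * K := by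
    simp only [hw]
    rw [intervalIntegral.integral_const_mul]
    exact mul_le_mul_of_nonneg_left hp1 hE0.le
  have hAM : ∀ x ∈ Icc (0 : ℝ) 1, ‖A x‖ ≤ M := fun x hx =>
    norm_gauge_le hab hq hp hqK hpK hδ ha0 hb0 hx
  have hT : ∀ x ∈ Icc (0 : ℝ) 1, ‖∫ t in (0 : ℝ)..x, Q t‖ ≤ E * (‖T0 q n x‖ + 2 * D * ω) :=
    fun x hx => norm_integral_shift_le hqi n hcD hx
  have hTc : ContinuousOn (fun t => ∫ s in (0 : ℝ)..t, Q s) (Icc 0 1) :=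
    (prim_integral iQ).continuousOn
  have hT0c := (prim_T0 hqi n).continuousOn
  have hT' : ∀ x ∈ Icc (0 : ℝ) 1,
      ‖∫ t in (0 : ℝ)..x, Q t‖ ≤ E * (1 + 2 * D) * (‖T0 q n x‖ + ω) := by
    intro x hx
    refine (hT x hx).trans ?_
    rw [mul_assoc E]
    refine mul_le_mul_of_nonneg_left ?_ hE0.le
    have := mul_nonneg hD (norm_nonneg (T0 q n x))
    linarith
  have hpT : ∫ t in (0 : ℝ)..1, ‖p t‖ * ‖T0 q n t‖ ≤ K * ω :=
    (integral_mul_norm_T0_le hqi hp n).trans (mul_le_mul_of_nonneg_right hpK hω0)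
  have ipT := intervalIntegrable_mul_continuousOn hpi.norm hT0c.norm
  -- Anything dominated by |T0| and ω has a weighted integral of size O(ω), because Cauchy–Schwarz
  -- pairs p with T0 in L².
  have hwgen : ∀ (g : ℝ → ℝ) (c₁ c₂ : ℝ), 0 ≤ c₁ → 0 ≤ c₂ → ContinuousOn g (Icc 0 1) →
      (∀ x ∈ Icc (0 : ℝ) 1, g x ≤ c₁ * ‖T0 q n x‖ + c₂ * ω) →
      ∫ t in (0 : ℝ)..1, w t * g t ≤ E * K * (c₁ + c₂) * ω := by
    intro g c₁ c₂ h1 h2 hg hgle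
    calc ∫ t in (0 : ℝ)..1, w t * g t
        ≤ ∫ t in (0 : ℝ)..1, E * (c₁ * (‖p t‖ * ‖T0 q n t‖) + c₂ * ω * ‖p t‖) := by
          refine integral_mono_unit (intervalIntegrable_mul_continuousOn iw hg)
            (((ipT.const_mul c₁).add (hpi.norm.const_mul _)).const_mul E) fun t ht => ?_
          have := mul_le_mul_of_nonneg_left (hgle t ht) (hw0 t)
          refine this.trans_eq ?_
          simp only [hw]; ring
      _ = E * (c₁ * (∫ t in (0 : ℝ)..1, ‖p t‖ * ‖T0 q n t‖) +
            c₂ * ω * ∫ t in (0 : ℝ)..1, ‖p t‖) := by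
          rw [intervalIntegral.integral_const_mul, intervalIntegral.integral_add
            (ipT.const_mul c₁) (hpi.norm.const_mul _), intervalIntegral.integral_const_mul,
            intervalIntegral.integral_const_mul]
      _ ≤ E * (c₁ * (K * ω) + c₂ * ω * K) := by gcongr
      _ = _ := by ring
  have hfirst : ∀ x ∈ Icc (0 : ℝ) 1, ‖A x - 1‖ ≤ C1 * (‖T0 q n x‖ + ω) := by
    intro x hx
    have h1 := coupled_first_order iQ pA pB hA0 hB0 iw hw0 hPw hW hM0.le hAM hx
    have h2 := hwgen (fun t => ‖∫ s in (0 : ℝ)..t, Q s‖) E (E * (2 * D)) hE0.le (by positivity)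
      hTc.norm (fun x hx => (hT x hx).trans_eq (by ring))
    have h3 := mul_le_mul_of_nonneg_left (hT' x hx) (by positivity : 0 ≤ 1 + M * (E * K))
    have h4 := mul_le_mul_of_nonneg_left h2 hM0.le
    have h5 : M * (E * K * (E + E * (2 * D)) * ω) ≤
        M * E * E * K * (1 + 2 * D) * (‖T0 q n x‖ + ω) := by
      have : 0 ≤ M * E * E * K * (1 + 2 * D) * ‖T0 q n x‖ := by positivity
      linarith
    calc ‖A x - 1‖ ≤ _ := h1
      _ ≤ (1 + M * (E * K)) * (E * (1 + 2 * D) * (‖T0 q n x‖ + ω)) +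
          M * E * E * K * (1 + 2 * D) * (‖T0 q n x‖ + ω) := add_le_add h3 (h4.trans h5)
      _ = _ := by rw [hC1]; ring
  refine ⟨fun x hx => (hfirst x hx).trans ?_, ?_⟩
  · have : 0 ≤ C2 * (‖T0 q n x‖ + ω) := by positivity
    linarith
  have hAc : ContinuousOn (fun t => A t - 1) (Icc 0 1) := pA.continuousOn.sub continuousOn_const
  set ω' := ∫ t in (0 : ℝ)..1, ‖p t‖ * ‖T0 q n t‖ ^ 2 with hω'
  have hω'0 : 0 ≤ ω' := intervalIntegral.integral_nonneg zero_le_one fun t _ => by positivity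
  set ωp := fSize p (-n) with hωp
  have hωp0 : 0 ≤ ωp := fSize_nonneg p (-n)
  have h1 := coupled_second_order iQ iP pA pB hA0 hB0 iw hw0 hPw
  have h2 := hwgen (fun t => ‖A t - 1‖) C1 C1 hC10 hC10 hAc.norm
    (fun x hx => (hfirst x hx).trans_eq (by ring))
  have h1m : (1 : ℝ) ∈ Icc (0 : ℝ) 1 := by simp
  have h3 : ‖∫ t in (0 : ℝ)..1, Q t‖ ≤ E * (1 + 2 * D) * ω := by
    refine (hT 1 h1m).trans ?_
    rw [mul_assoc E]
    refine mul_le_mul_of_nonneg_left ?_ hE0.le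
    have : ‖T0 q n 1‖ ≤ ω := le_add_of_nonneg_right (L2n_nonneg _)
    linarith
  have h4 : ∫ t in (0 : ℝ)..1, w t * (‖∫ s in (0 : ℝ)..t, Q s‖ * ‖A t - 1‖) ≤
      E * E * C1 * (1 + 2 * D) * (2 * (ω' + K * ω ^ 2)) := by
    have i2 := intervalIntegrable_mul_continuousOn hpi.norm ((hT0c.norm.add (continuousOn_const
      (c := ω))).pow 2)
    calc _ ≤ ∫ t in (0 : ℝ)..1, E * E * C1 * (1 + 2 * D) * (‖p t‖ * (‖T0 q n t‖ + ω) ^ 2) := by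
          refine integral_mono_unit (intervalIntegrable_mul_continuousOn iw
            (hTc.norm.mul hAc.norm)) (i2.const_mul _) fun t ht => ?_
          have := mul_le_mul_of_nonneg_left (mul_le_mul (hT' t ht) (hfirst t ht) (norm_nonneg _)
            (by positivity)) (hw0 t)
          refine this.trans_eq ?_
          simp only [hw]; ring
      _ = E * E * C1 * (1 + 2 * D) * ∫ t in (0 : ℝ)..1, ‖p t‖ * (‖T0 q n t‖ + ω) ^ 2 :=
          intervalIntegral.integral_const_mul _ _
      _ ≤ _ := by
          refine mul_le_mul_of_nonneg_left ((integral_mul_sq_add_le hqi hp n).trans ?_)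
            (by positivity)
          have := mul_le_mul_of_nonneg_right hpK (sq_nonneg ω)
          linarith
  have h5 : ‖A 1 - 1 - (∫ t in (0 : ℝ)..1, Q t) -
      ∫ t in (0 : ℝ)..1, Q t * ∫ s in (0 : ℝ)..t, P s‖ ≤
      E * (1 + 2 * D) * ω * (E * K * (C1 + C1) * ω) +
        E * E * C1 * (1 + 2 * D) * (2 * (ω' + K * ω ^ 2)) := by
    refine h1.trans (add_le_add (mul_le_mul h3 h2 ?_ (by positivity)) h4)
    exact intervalIntegral.integral_nonneg zero_le_one fun t _ => mul_nonneg (hw0 t) (norm_nonneg _)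
  have h6 := norm_integral_shift_sub_le hqi n hcD
  have h7 := norm_integral_shift_mul_sub_D0_le hqi hpi n hcD
  rw [hcn] at h6 h7
  have h8 : 2 * ‖δ‖ * (E * E * (∫ t in (0 : ℝ)..1, ‖q t‖) * ωp) ≤
      2 * ‖δ‖ * (E * E * K * ωp) := by gcongr
  -- The error has three sources: truncating the iteration, replacing the shifted single integral by
  -- `T0`, and replacing the shifted double integral by `D0`.
  have e : Complex.exp (I * (Real.pi * n + δ)) * a 1 - 1 - T0 q n 1 - D0 q p n =
      (A 1 - 1 - (∫ t in (0 : ℝ)..1, Q t) - ∫ t in (0 : ℝ)..1, Q t * ∫ s in (0 : ℝ)..t, P s) +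
      ((∫ t in (0 : ℝ)..1, Q t) - T0 q n 1) +
      ((∫ t in (0 : ℝ)..1, Q t * ∫ s in (0 : ℝ)..t, P s) - D0 q p n) := by
    simp only [hA, Complex.ofReal_one, mul_one]; ring
  rw [e]
  refine norm_add₃_le.trans ?_
  have hsum := add_le_add (add_le_add h5 h6) (h7.trans h8)
  refine hsum.trans ?_
  set d := ‖δ‖ with hd
  have hd0 : 0 ≤ d := norm_nonneg _
  -- What remains is a comparison of monomials; these facts provide the nonnegative surplus of the
  -- right-hand side.
  have k1 : 0 ≤ C1 * (d * (ω + ωp) + ω ^ 2 + ω') := by positivity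
  have k2 : 0 ≤ 2 * (E * E) * K * (d * ω + ω ^ 2 + ω') := by positivity
  have k3 : 0 ≤ 4 * E * (d * ωp + ω ^ 2 + ω') := by positivity
  have k4 : 0 ≤ 2 * (E * E) * C1 * (1 + 2 * D) * K * (d * (ω + ωp) + ω') := by positivity
  have k5 : 0 ≤ 2 * (E * E) * C1 * (1 + 2 * D) * (d * (ω + ωp) + ω ^ 2) := by positivity
  have k6 : 0 ≤ 2 * (E * E) * C1 * (1 + 2 * D) * K * (d * (ω + ωp) + ω') := by positivity
  rw [hC2, add_mul]
  linarith

end SystemExpansion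

/-! ### Fourier coefficients -/

section Fourier

open Complex (I)

theorem T0_one_eq_fourierCoeffOn (f : ℝ → ℂ) (n : ℤ) :
    T0 f n 1 = fourierCoeffOn (zero_lt_one : (0 : ℝ) < 1) f (-n) := by
  rw [fourierCoeffOn_eq_integral, T0]
  simp only [sub_zero, div_one, one_smul, neg_neg, fourier_coe_apply, smul_eq_mul]
  refine intervalIntegral.integral_congr fun t _ => ?_
  simp only [Complex.ofReal_one, div_one]
  ring

theorem hasSum_sq_T0 {f : ℝ → ℂ} (hf : MemLp f 2 μ₀) :
    HasSum (fun n : ℤ => ‖T0 f n 1‖ ^ 2) (∫ x in (0 : ℝ)..1, ‖f x‖ ^ 2) := by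
  have h := hasSum_sq_fourierCoeffOn (zero_lt_one : (0 : ℝ) < 1) (f := f)
    (by rwa [← restrict_Ioo_eq_restrict_Ioc])
  have h' := (Equiv.neg ℤ).hasSum_iff.2 h
  simp only [sub_zero, inv_one, one_smul] at h'
  refine h'.congr_fun fun n => ?_
  simp [T0_one_eq_fourierCoeffOn]

theorem sum_sq_T0_one_le {f : ℝ → ℂ} (hf : MemLp f 2 μ₀) (F : Finset ℤ) :
    ∑ n ∈ F, ‖T0 f n 1‖ ^ 2 ≤ ∫ x in (0 : ℝ)..1, ‖f x‖ ^ 2 :=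
  sum_le_hasSum F (fun _ _ => by positivity) (hasSum_sq_T0 hf)

theorem L2n_sq (f : ℝ → ℂ) : L2n f ^ 2 = ∫ x in (0 : ℝ)..1, ‖f x‖ ^ 2 :=
  Real.sq_sqrt (intervalIntegral.integral_nonneg zero_le_one fun _ _ => by positivity)

/-- A partial Fourier integral is a full Fourier coefficient of f cut off to (0, x], so Bessel's
inequality holds with a bound independent of x. -/
theorem sum_sq_T0_le {f : ℝ → ℂ} (hf : MemLp f 2 μ₀) (F : Finset ℤ) {x : ℝ}
    (hx : x ∈ Icc (0 : ℝ) 1) : ∑ n ∈ F, ‖T0 f n x‖ ^ 2 ≤ L2n f ^ 2 := by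
  have hg : MemLp ((Ioc 0 x).indicator f) 2 μ₀ := hf.indicator measurableSet_Ioc
  have h := sum_sq_T0_one_le hg F
  have e : ∀ n : ℤ, T0 ((Ioc 0 x).indicator f) n 1 = T0 f n x := by
    intro n
    rw [T0, T0, intervalIntegral.integral_of_le zero_le_one, intervalIntegral.integral_of_le hx.1]
    have : (fun t : ℝ => (Ioc 0 x).indicator f t * Complex.exp (2 * Real.pi * I * n * t)) =
        (Ioc 0 x).indicator (fun t : ℝ => f t * Complex.exp (2 * Real.pi * I * n * t)) := by
      funext t
      by_cases ht : t ∈ Ioc 0 x <;> simp [ht]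
    rw [this, setIntegral_indicator measurableSet_Ioc,
      inter_eq_self_of_subset_right (Ioc_subset_Ioc_right hx.2)]
  simp only [e] at h
  refine h.trans ?_
  rw [L2n_sq]
  refine integral_mono_unit (memLp_sq_intervalIntegrable hg) (memLp_sq_intervalIntegrable hf)
    fun t _ => ?_
  by_cases ht : t ∈ Ioc 0 x
  · simp [ht]
  · simp [ht]

theorem sum_sq_fSize_le {f : ℝ → ℂ} (hf : MemLp f 2 μ₀) (F : Finset ℤ) :
    ∑ n ∈ F, fSize f n ^ 2 ≤ 4 * L2n f ^ 2 := by
  have hi := memLp_intervalIntegrable hf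
  have h1 := sum_sq_T0_le hf F (x := 1) (by simp)
  have hInt : ∀ n : ℤ, IntervalIntegrable (fun t => ‖T0 f n t‖ ^ 2) volume 0 1 := fun n =>
    ((prim_T0 hi n).continuousOn.norm.pow 2).intervalIntegrable_of_Icc zero_le_one
  have h2 : ∑ n ∈ F, L2n (T0 f n) ^ 2 ≤ L2n f ^ 2 := by
    simp only [L2n_sq (T0 f _)]
    rw [← intervalIntegral.integral_finsetSum fun n _ => hInt n]
    calc _ ≤ ∫ _ in (0 : ℝ)..1, L2n f ^ 2 := by
          refine integral_mono_unit ?_ intervalIntegrable_const fun t ht => sum_sq_T0_le hf F ht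
          exact (IntervalIntegrable.sum F fun n _ => hInt n).congr fun t _ => by simp
      _ = _ := by simp
  calc ∑ n ∈ F, fSize f n ^ 2 ≤ ∑ n ∈ F, 2 * (‖T0 f n 1‖ ^ 2 + L2n (T0 f n) ^ 2) := by
        refine Finset.sum_le_sum fun n _ => ?_
        unfold fSize
        nlinarith [sq_nonneg (‖T0 f n 1‖ - L2n (T0 f n))]
    _ = 2 * (∑ n ∈ F, ‖T0 f n 1‖ ^ 2 + ∑ n ∈ F, L2n (T0 f n) ^ 2) := by
        rw [← Finset.mul_sum, Finset.sum_add_distrib]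
    _ ≤ _ := by linarith

/-- Bessel's inequality holds at each point t, so the sum may be taken under the integral and p
enters only through its L¹ norm. -/
theorem sum_integral_mul_sq_le {f p : ℝ → ℂ} (hf : MemLp f 2 μ₀) (hp : MemLp p 2 μ₀)
    (F : Finset ℤ) :
    ∑ n ∈ F, ∫ t in (0 : ℝ)..1, ‖p t‖ * ‖T0 f n t‖ ^ 2 ≤ L2n p * L2n f ^ 2 := by
  have hi := memLp_intervalIntegrable hf
  have hpi := (memLp_intervalIntegrable hp).norm
  have hInt : ∀ n : ℤ, IntervalIntegrable (fun t => ‖p t‖ * ‖T0 f n t‖ ^ 2) volume 0 1 := fun n =>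
    intervalIntegrable_mul_continuousOn hpi ((prim_T0 hi n).continuousOn.norm.pow 2)
  rw [← intervalIntegral.integral_finsetSum fun n _ => hInt n]
  calc _ ≤ ∫ t in (0 : ℝ)..1, ‖p t‖ * L2n f ^ 2 := by
        refine integral_mono_unit ?_ (hpi.mul_const _) fun t ht => ?_
        · exact (IntervalIntegrable.sum F fun n _ => hInt n).congr fun t _ => by simp
        · rw [← Finset.mul_sum]
          exact mul_le_mul_of_nonneg_left (sum_sq_T0_le hf F ht) (norm_nonneg _)
    _ = (∫ t in (0 : ℝ)..1, ‖p t‖) * L2n f ^ 2 := intervalIntegral.integral_mul_const _ _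
    _ ≤ _ := mul_le_mul_of_nonneg_right (integral_norm_le_sqrt hp) (sq_nonneg _)

theorem T0_add_const_mul {f g : ℝ → ℂ} (hf : MemLp f 2 μ₀) (hg : MemLp g 2 μ₀) (c : ℂ) (n : ℤ) :
    T0 (fun x => f x + c * g x) n 1 = T0 f n 1 + c * T0 g n 1 := by
  rw [T0, T0, T0, ← intervalIntegral.integral_const_mul, ← intervalIntegral.integral_add
    (intervalIntegrable_freq (memLp_intervalIntegrable hf) n)
    ((intervalIntegrable_freq (memLp_intervalIntegrable hg) n).const_mul c)]
  refine intervalIntegral.integral_congr fun t _ => ?_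
  ring

theorem polarization (a b : ℂ) : (starRingEnd ℂ) a * b =
    (((‖a + 1 * b‖ ^ 2 : ℝ) : ℂ) - ((‖a + (-1) * b‖ ^ 2 : ℝ) : ℂ)
      - I * ((‖a + I * b‖ ^ 2 : ℝ) : ℂ) + I * ((‖a + (-I) * b‖ ^ 2 : ℝ) : ℂ)) / 4 := by
  simp only [Complex.ofReal_pow, ← Complex.conj_mul', map_add, map_mul, map_neg, map_one,
    Complex.conj_I]
  linear_combination ((starRingEnd ℂ a) * b / 2 - (starRingEnd ℂ b) * a / 2) * Complex.I_sq

/-- Parseval's identity in bilinear form. -/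
theorem hasSum_T0_mul_T0 {f g : ℝ → ℂ} (hf : MemLp f 2 μ₀) (hg : MemLp g 2 μ₀) :
    HasSum (fun k : ℤ => T0 f (-k) 1 * T0 g k 1) (∫ x in (0 : ℝ)..1, f x * g x) := by
  set h : ℝ → ℂ := fun x => (starRingEnd ℂ) (f x) with hh
  have hhm : MemLp h 2 μ₀ := hf.star
  have hS : ∀ c : ℂ, HasSum (fun n : ℤ => ((‖T0 h n 1 + c * T0 g n 1‖ ^ 2 : ℝ) : ℂ))
      (∫ x in (0 : ℝ)..1, ((‖h x + c * g x‖ ^ 2 : ℝ) : ℂ)) := by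
    intro c
    have hm : MemLp (fun x => h x + c * g x) 2 μ₀ := hhm.add (hg.const_mul c)
    have := hasSum_sq_T0 hm
    simp only [T0_add_const_mul hhm hg] at this
    rw [intervalIntegral.integral_ofReal]
    exact_mod_cast this
  have hi : ∀ c : ℂ, IntervalIntegrable (fun x => ((‖h x + c * g x‖ ^ 2 : ℝ) : ℂ)) volume 0 1 := by
    intro c
    have hm : MemLp (fun x => h x + c * g x) 2 μ₀ := hhm.add (hg.const_mul c)
    have h2 := memLp_sq_intervalIntegrable hm
    exact ⟨h2.1.ofReal, h2.2.ofReal⟩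
  -- Parseval's identity is available for squares only; taking h + cg with h the conjugate of f and
  -- c = ±1, ±i recovers the product by polarization.
  have key := ((((hS 1).sub (hS (-1))).sub ((hS I).mul_left I)).add ((hS (-I)).mul_left I)).div_const 4
  have e1 : ∀ k : ℤ, T0 f (-k) 1 = (starRingEnd ℂ) (T0 h k 1) := by
    intro k
    rw [T0, T0, intervalIntegral.integral_of_le zero_le_one,
      intervalIntegral.integral_of_le zero_le_one, ← integral_conj]
    refine integral_congr_ae (Eventually.of_forall fun t => ?_)
    simp only [hh, map_mul, Complex.conj_conj, ← Complex.exp_conj, Complex.conj_ofReal,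
      Complex.conj_I, map_ofNat, map_intCast]
    congr 2
    push_cast
    ring
  convert! key using 1
  · funext k
    rw [e1, polarization]
  · rw [← intervalIntegral.integral_const_mul, ← intervalIntegral.integral_const_mul,
      ← intervalIntegral.integral_sub (hi 1) (hi (-1)),
      ← intervalIntegral.integral_sub ((hi 1).sub (hi (-1))) ((hi I).const_mul I),
      ← intervalIntegral.integral_add (((hi 1).sub (hi (-1))).sub ((hi I).const_mul I))
        ((hi (-I)).const_mul I), ← intervalIntegral.integral_div]
    refine intervalIntegral.integral_congr fun x _ => ?_
    rw [← polarization]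
    simp [hh]

end Fourier

/-! ### The iterated Fourier integral as a discrete Hilbert transform. -/

section SecondOrder

open Complex (I)

theorem T0_one_eq_integral (f : ℝ → ℂ) (n : ℤ) :
    T0 f n 1 = ∫ t in (0 : ℝ)..1, f t * Complex.exp (2 * Real.pi * I * n * t) := rfl

theorem cexp_freq_one (m : ℤ) : Complex.exp (2 * Real.pi * I * m * (1 : ℝ)) = 1 := by
  rw [Complex.exp_eq_one_iff]
  exact ⟨m, by push_cast; ring⟩

theorem integral_cexp_freq {m : ℤ} (hm : m ≠ 0) :
    ∫ t in (0 : ℝ)..1, Complex.exp (2 * Real.pi * I * m * t) = 0 := by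
  have h := (prim_cexp (2 * Real.pi * I * m)).2 1 (by simp)
  beta_reduce at h
  rw [cexp_freq_one, intervalIntegral.integral_const_mul] at h
  have hne : (2 * Real.pi * I * m : ℂ) ≠ 0 := by
    simp [Real.pi_ne_zero, hm]
  have h0 : (2 * Real.pi * I * m : ℂ) * ∫ t in (0 : ℝ)..1, Complex.exp (2 * Real.pi * I * m * t)
      = 0 := by simpa using h
  exact (mul_eq_zero.1 h0).resolve_left hne

/-- Subtracting the linear function makes the difference vanish at both endpoints, so integration by
parts leaves no boundary term. The constant it adds to the derivative is orthogonal to the nonzero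
frequency k - n. -/
theorem T0_sub_linear_freq {q : ℝ → ℂ} (hq : IntervalIntegrable q volume 0 1) {n k : ℤ}
    (hk : k ≠ n) :
    T0 (fun x : ℝ => (T0 q n x - T0 q n 1 * x) * Complex.exp (2 * Real.pi * I * (-n : ℤ) * x)) k 1
      = -(T0 q k 1 * (2 * Real.pi * I * (k - n : ℤ))⁻¹) := by
  have hm : k - n ≠ 0 := sub_ne_zero.2 hk
  have hne : (2 * Real.pi * I * (k - n : ℤ) : ℂ) ≠ 0 := by
    simp only [ne_eq, mul_eq_zero, OfNat.ofNat_ne_zero, Complex.ofReal_eq_zero, Real.pi_ne_zero,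
      Complex.I_ne_zero, or_self, Int.cast_eq_zero, false_or]
    exact hm
  have pr := (prim_T0 hq n).sub ((prim_id.clm Complex.ofRealCLM).clm
    (ContinuousLinearMap.mul ℝ ℂ (T0 q n 1)))
  simp only [Complex.ofRealCLM_apply, ContinuousLinearMap.mul_apply', Complex.ofReal_one,
    mul_one] at pr
  have hrc : ContinuousOn (fun x : ℝ => T0 q n x - T0 q n 1 * x) (Icc 0 1) := pr.continuousOn
  have hH : ContinuousOn (fun x : ℝ => Complex.exp (2 * Real.pi * I * (k - n : ℤ) * x))
      (Icc 0 1) := by fun_prop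
  have h := (pr.mul (prim_cexp (2 * Real.pi * I * (k - n : ℤ)))).2 1 (by simp)
  have i1 := intervalIntegrable_mul_continuousOn pr.1 hH
  have i2 : IntervalIntegrable (fun x : ℝ => (T0 q n x - T0 q n 1 * x) *
      (2 * Real.pi * I * (k - n : ℤ) * Complex.exp (2 * Real.pi * I * (k - n : ℤ) * x)))
      volume 0 1 :=
    (hrc.mul (continuousOn_const.mul hH)).intervalIntegrable_of_Icc zero_le_one
  rw [intervalIntegral.integral_add i1 i2] at h
  have e0 : T0 q n 0 = 0 := by simp [T0]
  have e1 : ∫ x in (0 : ℝ)..1, (q x * Complex.exp (2 * Real.pi * I * n * x) - T0 q n 1) *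
      Complex.exp (2 * Real.pi * I * (k - n : ℤ) * x) = T0 q k 1 := by
    have e2 : ∀ x : ℝ, (q x * Complex.exp (2 * Real.pi * I * n * x) - T0 q n 1) *
        Complex.exp (2 * Real.pi * I * (k - n : ℤ) * x) =
        q x * Complex.exp (2 * Real.pi * I * k * x) -
          T0 q n 1 * Complex.exp (2 * Real.pi * I * (k - n : ℤ) * x) := by
      intro x
      have : Complex.exp (2 * Real.pi * I * k * x) = Complex.exp (2 * Real.pi * I * n * x) *
          Complex.exp (2 * Real.pi * I * (k - n : ℤ) * x) := by
        rw [← Complex.exp_add]; congr 1; push_cast; ring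
      rw [this]; ring
    simp only [e2]
    rw [intervalIntegral.integral_sub (intervalIntegrable_freq hq k)
      ((hH.intervalIntegrable_of_Icc zero_le_one).const_mul _),
      intervalIntegral.integral_const_mul, integral_cexp_freq hm, mul_zero, sub_zero, T0]
  have e3 : ∫ x in (0 : ℝ)..1, (T0 q n x - T0 q n 1 * x) *
      (2 * Real.pi * I * (k - n : ℤ) * Complex.exp (2 * Real.pi * I * (k - n : ℤ) * x)) =
      (2 * Real.pi * I * (k - n : ℤ)) * T0 (fun x : ℝ => (T0 q n x - T0 q n 1 * x) *
        Complex.exp (2 * Real.pi * I * (-n : ℤ) * x)) k 1 := by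
    rw [T0_one_eq_integral _ k, ← intervalIntegral.integral_const_mul]
    refine intervalIntegral.integral_congr fun x _ => ?_
    have : Complex.exp (2 * Real.pi * I * (k - n : ℤ) * x) =
        Complex.exp (2 * Real.pi * I * (-n : ℤ) * x) * Complex.exp (2 * Real.pi * I * k * x) := by
      rw [← Complex.exp_add]; congr 1; push_cast; ring
    rw [this]; ring
  rw [e1, e3] at h
  beta_reduce at h
  rw [e0] at h
  simp only [Complex.ofReal_zero, Complex.ofReal_one, mul_zero, zero_mul, mul_one,
    sub_self, zero_add] at h
  rw [← div_eq_mul_inv, ← neg_div, eq_div_iff hne]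
  linear_combination -h

/-- At the resonance k = n the exponentials cancel and no denominator is available. The coefficient
is a mean value, which integration by parts against x expresses through a Fourier coefficient of x
q. -/
theorem T0_sub_linear_freq_self {q : ℝ → ℂ} (hq : IntervalIntegrable q volume 0 1) (n : ℤ) :
    T0 (fun x : ℝ => (T0 q n x - T0 q n 1 * x) * Complex.exp (2 * Real.pi * I * (-n : ℤ) * x)) n 1
      = T0 q n 1 / 2 - T0 (fun x : ℝ => x * q x) n 1 := by
  have pr := (prim_T0 hq n).sub ((prim_id.clm Complex.ofRealCLM).clm
    (ContinuousLinearMap.mul ℝ ℂ (T0 q n 1)))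
  have px := prim_id.clm Complex.ofRealCLM
  simp only [Complex.ofRealCLM_apply, ContinuousLinearMap.mul_apply', Complex.ofReal_one,
    mul_one] at pr px
  have hrc : ContinuousOn (fun x : ℝ => T0 q n x - T0 q n 1 * x) (Icc 0 1) := pr.continuousOn
  have h := (pr.mul px).2 1 (by simp)
  have i1 := intervalIntegrable_mul_continuousOn pr.1 px.continuousOn
  have i2 := hrc.intervalIntegrable_of_Icc (μ := volume) zero_le_one
  simp only [mul_one] at h
  rw [intervalIntegral.integral_add i1 i2] at h
  have e0 : T0 q n 0 = 0 := by simp [T0]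
  have ix : IntervalIntegrable (fun x : ℝ => T0 q n 1 * (x : ℂ)) volume 0 1 :=
    (px.continuousOn.intervalIntegrable_of_Icc zero_le_one).const_mul _
  have iq := intervalIntegrable_freq (intervalIntegrable_mul_continuousOn hq px.continuousOn) n
  have e1 : ∫ x in (0 : ℝ)..1, (q x * Complex.exp (2 * Real.pi * I * n * x) - T0 q n 1) * x =
      T0 (fun x : ℝ => x * q x) n 1 - T0 q n 1 / 2 := by
    have e2 : ∀ x : ℝ, (q x * Complex.exp (2 * Real.pi * I * n * x) - T0 q n 1) * x =
        q x * x * Complex.exp (2 * Real.pi * I * n * x) - T0 q n 1 * x := fun x => by ring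
    simp only [e2]
    rw [intervalIntegral.integral_sub iq ix, intervalIntegral.integral_const_mul,
      intervalIntegral.integral_ofReal, integral_id, T0_one_eq_integral (fun x : ℝ => x * q x)]
    congr 1
    · refine intervalIntegral.integral_congr fun x _ => ?_
      ring
    · norm_num
      ring
  have e3 : T0 (fun x : ℝ => (T0 q n x - T0 q n 1 * x) *
      Complex.exp (2 * Real.pi * I * (-n : ℤ) * x)) n 1 =
      ∫ x in (0 : ℝ)..1, (T0 q n x - T0 q n 1 * x) := by
    rw [T0_one_eq_integral (fun x : ℝ => (T0 q n x - T0 q n 1 * x) * _)]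
    refine intervalIntegral.integral_congr fun x _ => ?_
    have : Complex.exp (2 * Real.pi * I * (-n : ℤ) * x) * Complex.exp (2 * Real.pi * I * n * x) =
        1 := by
      rw [← Complex.exp_add, Complex.exp_eq_one_iff]; exact ⟨0, by push_cast; ring⟩
    rw [mul_assoc, this, mul_one]
  rw [e1] at h
  rw [e0] at h
  simp only [Complex.ofReal_zero, Complex.ofReal_one, mul_zero, mul_one,
    sub_self, zero_add] at h
  rw [e3]
  linear_combination -h

theorem memLp_ofReal_mul {f : ℝ → ℂ} (hf : MemLp f 2 μ₀) : MemLp (fun x : ℝ => x * f x) 2 μ₀ := by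
  refine hf.of_le (AEStronglyMeasurable.mul (by fun_prop) hf.1) ?_
  refine (ae_restrict_iff' measurableSet_Ioo).2 (Eventually.of_forall fun x hx => ?_)
  rw [norm_mul, Complex.norm_real, Real.norm_of_nonneg hx.1.le]
  exact mul_le_of_le_one_left (norm_nonneg _) hx.2.le

theorem L2n_ofReal_mul_le {f : ℝ → ℂ} (hf : MemLp f 2 μ₀) :
    L2n (fun x : ℝ => x * f x) ≤ L2n f := by
  refine Real.sqrt_le_sqrt (integral_mono_unit (memLp_sq_intervalIntegrable (memLp_ofReal_mul hf))
    (memLp_sq_intervalIntegrable hf) fun x hx => ?_)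
  rw [norm_mul, Complex.norm_real, Real.norm_of_nonneg hx.1]
  exact pow_le_pow_left₀ (mul_nonneg hx.1 (norm_nonneg _))
    (mul_le_of_le_one_left (norm_nonneg _) hx.2) 2

/-- The discrete Hilbert kernel `1 / (2π|m|)`. -/
noncomputable def hilbertKernel (m : ℤ) : ℝ := ‖(2 * Real.pi * I * m : ℂ)⁻¹‖

theorem hilbertKernel_nonneg (m : ℤ) : 0 ≤ hilbertKernel m := norm_nonneg _

theorem hilbertKernel_eq (m : ℤ) : hilbertKernel m = (2 * Real.pi)⁻¹ * |(m : ℝ)|⁻¹ := by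
  simp [hilbertKernel, abs_of_pos Real.pi_pos, mul_comm]

theorem hilbertKernel_le (m : ℤ) : hilbertKernel m ≤ |(m : ℝ)|⁻¹ := by
  rw [hilbertKernel_eq]
  refine mul_le_of_le_one_left (by positivity) (inv_le_one_of_one_le₀ ?_)
  linarith [Real.pi_gt_three]

theorem hilbertKernel_le_one (m : ℤ) : hilbertKernel m ≤ 1 := by
  refine (hilbertKernel_le m).trans ?_
  -- At m = 0 the convention 0⁻¹ = 0 makes the kernel vanish, so the diagonal never enters the
  -- convolution.
  rcases eq_or_ne m 0 with rfl | hm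
  · simp
  · refine inv_le_one_of_one_le₀ ?_
    exact_mod_cast Int.one_le_abs hm

theorem summable_norm_T0_mul {q p : ℝ → ℂ} (hq : MemLp q 2 μ₀) (hp : MemLp p 2 μ₀) :
    Summable (fun k : ℤ => ‖T0 p (-k) 1‖ * ‖T0 q k 1‖) := by
  have h1 : Summable fun k : ℤ => ‖T0 p (-k) 1‖ ^ 2 :=
    (Equiv.neg ℤ).summable_iff.2 (hasSum_sq_T0 hp).summable
  refine Summable.of_nonneg_of_le (fun k => by positivity) (fun k => ?_)
    (h1.add (hasSum_sq_T0 hq).summable)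
  nlinarith [sq_nonneg (‖T0 p (-k) 1‖ - ‖T0 q k 1‖), sq_nonneg (‖T0 p (-k) 1‖),
    sq_nonneg (‖T0 q k 1‖)]

/-- Integration by parts puts the primitive of the q-factor against p. Its linear part gives
products of Fourier coefficients; the rest is expanded by Parseval, where division by k - n produces
the Hilbert kernel. -/
theorem norm_D0_le {q p : ℝ → ℂ} (hq : MemLp q 2 μ₀) (hp : MemLp p 2 μ₀) (n : ℤ) :
    ‖D0 q p n‖ ≤ (‖T0 q n 1‖ * ‖T0 p (-n) 1‖ + ‖T0 q n 1‖ * ‖T0 (fun x : ℝ => x * p x) (-n) 1‖ +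
      ‖T0 p (-n) 1‖ * (‖T0 q n 1‖ + ‖T0 (fun x : ℝ => x * q x) n 1‖)) +
      ∑' k : ℤ, ‖T0 p (-k) 1‖ * ‖T0 q k 1‖ * hilbertKernel (k - n) := by
  have hqi := memLp_intervalIntegrable hq
  have hpi := memLp_intervalIntegrable hp
  have hc := (prim_T0 hqi n).continuousOn
  have hx : ContinuousOn (fun x : ℝ => (x : ℂ)) (Icc 0 1) := by fun_prop
  have hrc : ContinuousOn (fun x : ℝ => T0 q n x - T0 q n 1 * x) (Icc 0 1) :=
    hc.sub (continuousOn_const.mul hx)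
  set g : ℝ → ℂ := fun x : ℝ => (T0 q n x - T0 q n 1 * x) *
    Complex.exp (2 * Real.pi * I * (-n : ℤ) * x) with hg
  have hgm : MemLp g 2 μ₀ := memLp_of_continuousOn (hrc.mul (by fun_prop))
  have hS := hasSum_T0_mul_T0 hp hgm
  have ip := intervalIntegrable_freq hpi (-n)
  have hbp := ((prim_T0 hqi n).mul (prim_T0 hpi (-n))).2 1 (by simp)
  have i1 : IntervalIntegrable (fun t => q t * Complex.exp (2 * Real.pi * I * n * t) *
      T0 p (-n) t) volume 0 1 :=
    intervalIntegrable_mul_continuousOn (intervalIntegrable_freq hqi n) (prim_T0 hpi (-n)).continuousOn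
  have i2 : IntervalIntegrable (fun t => T0 q n t * (p t *
      Complex.exp (2 * Real.pi * I * (-n : ℤ) * t))) volume 0 1 := by
    simpa only [mul_comm] using intervalIntegrable_mul_continuousOn ip hc
  have i3 : IntervalIntegrable (fun t : ℝ => T0 q n 1 * (t * p t *
      Complex.exp (2 * Real.pi * I * (-n : ℤ) * t))) volume 0 1 :=
    (intervalIntegrable_freq (memLp_intervalIntegrable (memLp_ofReal_mul hp)) (-n)).const_mul _
  rw [intervalIntegral.integral_add i1 i2] at hbp
  have e0 : T0 q n 0 = 0 := by simp [T0]
  have e1 : ∫ x in (0 : ℝ)..1, p x * g x =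
      (∫ t in (0 : ℝ)..1, T0 q n t * (p t * Complex.exp (2 * Real.pi * I * (-n : ℤ) * t))) -
        T0 q n 1 * T0 (fun x : ℝ => x * p x) (-n) 1 := by
    rw [T0_one_eq_integral (fun x : ℝ => x * p x), ← intervalIntegral.integral_const_mul,
      ← intervalIntegral.integral_sub i2 i3]
    refine intervalIntegral.integral_congr fun x _ => ?_
    simp only [hg]
    ring
  have e2 : D0 q p n = T0 q n 1 * T0 p (-n) 1 - T0 q n 1 * T0 (fun x : ℝ => x * p x) (-n) 1 -
      ∑' k : ℤ, T0 p (-k) 1 * T0 g k 1 := by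
    rw [hS.tsum_eq, e1]
    beta_reduce at hbp
    rw [e0] at hbp
    rw [D0]
    linear_combination -hbp
  set a : ℤ → ℝ := fun k => ‖T0 p (-k) 1‖ * ‖T0 q k 1‖ * hilbertKernel (k - n) with ha
  have ha0 : ∀ k, 0 ≤ a k := fun k => mul_nonneg (by positivity) (hilbertKernel_nonneg _)
  have has : Summable a := by
    refine Summable.of_nonneg_of_le ha0 (fun k => ?_) (summable_norm_T0_mul hq hp)
    exact mul_le_of_le_one_right (by positivity) (hilbertKernel_le_one _)
  set s : ℝ := ‖T0 p (-n) 1‖ * (‖T0 q n 1‖ + ‖T0 (fun x : ℝ => x * q x) n 1‖) with hs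
  have hs0 : 0 ≤ s := by positivity
  -- The majorant gives the resonant index k = n the separate bound s, and every other index its
  -- kernel term.
  have hsum2 : HasSum (fun k : ℤ => (if k = n then s else 0) + a k) (s + ∑' k, a k) := by
    refine HasSum.add ?_ has.hasSum
    exact hasSum_ite_eq n s
  have hle : ∀ k : ℤ, ‖T0 p (-k) 1 * T0 g k 1‖ ≤ (if k = n then s else 0) + a k := by
    intro k
    rw [norm_mul]
    by_cases hk : k = n
    · subst hk
      rw [if_pos rfl]
      refine le_trans ?_ (le_add_of_nonneg_right (ha0 k))
      refine mul_le_mul_of_nonneg_left ?_ (norm_nonneg _)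
      rw [hg, T0_sub_linear_freq_self hqi]
      refine (norm_sub_le _ _).trans (add_le_add ?_ le_rfl)
      rw [norm_div]
      simp only [Complex.norm_ofNat]
      linarith [norm_nonneg (T0 q k 1)]
    · rw [if_neg hk, zero_add, hg, T0_sub_linear_freq hqi hk, norm_neg, norm_mul, ← mul_assoc]
      rfl
  have h3 : ‖∑' k : ℤ, T0 p (-k) 1 * T0 g k 1‖ ≤ s + ∑' k, a k :=
    tsum_of_norm_bounded hsum2 hle
  rw [e2]
  refine (norm_sub_le _ _).trans ?_
  have h4 := norm_sub_le (T0 q n 1 * T0 p (-n) 1) (T0 q n 1 * T0 (fun x : ℝ => x * p x) (-n) 1)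
  rw [norm_mul, norm_mul] at h4
  linarith

end SecondOrder

/-! ### Sums of d-th powers. -/

section PowerSums

open Complex (I)

/-- This is the embedding of ℓ¹ into ℓᵈ: each term is at most X, so X ^ (d - 1) can be split off its
d-th power. -/
theorem sum_rpow_le_rpow {ι : Type*} {F : Finset ι} {x : ι → ℝ} {X d : ℝ} (hd : 1 ≤ d)
    (hx : ∀ n ∈ F, 0 ≤ x n) (hX : ∑ n ∈ F, x n ≤ X) : ∑ n ∈ F, x n ^ d ≤ X ^ d := by
  have hX0 : 0 ≤ X := (Finset.sum_nonneg hx).trans hX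
  have key : ∀ n ∈ F, x n ^ d ≤ x n * X ^ (d - 1) := by
    intro n hn
    have h1 : x n ≤ X := (Finset.single_le_sum hx hn).trans hX
    have h2 : x n ^ d = x n * x n ^ (d - 1) := by
      rw [← Real.rpow_one_add' (hx n hn) (by linarith)]; congr 1; ring
    rw [h2]
    exact mul_le_mul_of_nonneg_left (Real.rpow_le_rpow (hx n hn) h1 (by linarith)) (hx n hn)
  calc ∑ n ∈ F, x n ^ d ≤ ∑ n ∈ F, x n * X ^ (d - 1) := Finset.sum_le_sum key
    _ = (∑ n ∈ F, x n) * X ^ (d - 1) := (Finset.sum_mul _ _ _).symm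
    _ ≤ X * X ^ (d - 1) := mul_le_mul_of_nonneg_right hX (Real.rpow_nonneg hX0 _)
    _ = X ^ d := by rw [← Real.rpow_one_add' hX0 (by linarith)]; congr 1; ring

theorem add_rpow_le {x y d : ℝ} (hx : 0 ≤ x) (hy : 0 ≤ y) (hd : 0 ≤ d) :
    (x + y) ^ d ≤ 2 ^ d * (x ^ d + y ^ d) := by
  have hx' := Real.rpow_nonneg hx d
  have hy' := Real.rpow_nonneg hy d
  rcases le_total x y with h | h
  · calc (x + y) ^ d ≤ (2 * y) ^ d := Real.rpow_le_rpow (by positivity) (by linarith) hd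
      _ = 2 ^ d * y ^ d := Real.mul_rpow (by norm_num) hy
      _ ≤ _ := by gcongr; linarith
  · calc (x + y) ^ d ≤ (2 * x) ^ d := Real.rpow_le_rpow (by positivity) (by linarith) hd
      _ = 2 ^ d * x ^ d := Real.mul_rpow (by norm_num) hx
      _ ≤ _ := by gcongr; linarith

theorem sum_rpow_add_le {ι : Type*} {F : Finset ι} {e x y : ι → ℝ} {X Y d : ℝ} (hd : 0 ≤ d)
    (he0 : ∀ n ∈ F, 0 ≤ e n)
    (he : ∀ n ∈ F, e n ≤ x n + y n) (hx : ∀ n ∈ F, 0 ≤ x n) (hy : ∀ n ∈ F, 0 ≤ y n)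
    (hX : ∑ n ∈ F, x n ^ d ≤ X) (hY : ∑ n ∈ F, y n ^ d ≤ Y) :
    ∑ n ∈ F, e n ^ d ≤ 2 ^ d * (X + Y) := by
  calc ∑ n ∈ F, e n ^ d ≤ ∑ n ∈ F, 2 ^ d * (x n ^ d + y n ^ d) :=
        Finset.sum_le_sum fun n hn => (Real.rpow_le_rpow (he0 n hn) (he n hn) hd).trans
          (add_rpow_le (hx n hn) (hy n hn) hd)
    _ = 2 ^ d * (∑ n ∈ F, x n ^ d + ∑ n ∈ F, y n ^ d) := by
        rw [← Finset.mul_sum, Finset.sum_add_distrib]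
    _ ≤ _ := by gcongr

/-- The strict inequality d > 1 enters here: the kernel decays only like 1/|m|. -/
theorem summable_hilbertKernel_rpow {d : ℝ} (hd : 1 < d) :
    Summable fun m : ℤ => hilbertKernel m ^ d := by
  refine Summable.of_nonneg_of_le (fun m => Real.rpow_nonneg (hilbertKernel_nonneg m) _)
    (fun m => ?_) (Real.summable_abs_int_rpow hd)
  rw [Real.rpow_neg (abs_nonneg _), ← Real.inv_rpow (abs_nonneg _)]
  exact Real.rpow_le_rpow (hilbertKernel_nonneg m) (hilbertKernel_le m) (by linarith)

/-- Young's inequality `ℓ¹ * ℓᵈ ⊆ ℓᵈ` for the discrete Hilbert kernel. -/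
theorem sum_rpow_tsum_hilbertKernel_le {a : ℤ → ℝ} (ha0 : ∀ k, 0 ≤ a k) (ha : Summable a) {S d : ℝ}
    (hS : ∑' k, a k ≤ S) (hd : 1 < d) (F : Finset ℤ) :
    ∑ n ∈ F, (∑' k, a k * hilbertKernel (k - n)) ^ d ≤ S ^ d * ∑' m, hilbertKernel m ^ d := by
  have hd0 : 0 < d := by linarith
  have hS0 : 0 ≤ S := (tsum_nonneg ha0).trans hS
  have hZ0 : 0 ≤ ∑' m, hilbertKernel m ^ d :=
    tsum_nonneg fun m => Real.rpow_nonneg (hilbertKernel_nonneg m) _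
  have hs : ∀ n, Summable fun k => a k * hilbertKernel (k - n) := fun n =>
    Summable.of_nonneg_of_le (fun k => mul_nonneg (ha0 k) (hilbertKernel_nonneg _))
      (fun k => mul_le_of_le_one_right (ha0 k) (hilbertKernel_le_one _)) ha
  -- Continuity of the d-th power, in each of finitely many n, reduces the claim to finite sums over
  -- k.
  have hlim : Tendsto (fun G : Finset ℤ => ∑ n ∈ F, (∑ k ∈ G, a k * hilbertKernel (k - n)) ^ d)
      atTop (𝓝 (∑ n ∈ F, (∑' k, a k * hilbertKernel (k - n)) ^ d)) := by
    refine tendsto_finsetSum _ fun n _ => ?_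
    exact ((Real.continuous_rpow_const hd0.le).tendsto _).comp (hs n).hasSum
  refine le_of_tendsto' hlim fun G => ?_
  have hG : ∑ k ∈ G, a k ≤ S := (ha.sum_le_tsum G fun k _ => ha0 k).trans hS
  have hG0 : 0 ≤ ∑ k ∈ G, a k := Finset.sum_nonneg fun k _ => ha0 k
  have hker : ∀ k, ∑ n ∈ F, hilbertKernel (k - n) ^ d ≤ ∑' m, hilbertKernel m ^ d := by
    intro k
    have hsm := (Equiv.subLeft k).summable_iff.2 (summable_hilbertKernel_rpow hd)
    rw [← (Equiv.subLeft k).tsum_eq]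
    exact hsm.sum_le_tsum F fun n _ => Real.rpow_nonneg (hilbertKernel_nonneg _) _
  -- Hölder's inequality with weights a k moves the power d onto the kernel alone, whose sum over n
  -- is then independent of k.
  have hjen : ∀ n, (∑ k ∈ G, a k * hilbertKernel (k - n)) ^ d ≤
      S ^ (d - 1) * ∑ k ∈ G, a k * hilbertKernel (k - n) ^ d := by
    intro n
    have hT0 : 0 ≤ ∑ k ∈ G, a k * hilbertKernel (k - n) ^ d :=
      Finset.sum_nonneg fun k _ => mul_nonneg (ha0 k) (Real.rpow_nonneg (hilbertKernel_nonneg _) _)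
    have h1 := Real.inner_le_weight_mul_Lp_of_nonneg G hd.le a (fun k => hilbertKernel (k - n))
      ha0 (fun k => hilbertKernel_nonneg _)
    have h2 := Real.rpow_le_rpow (Finset.sum_nonneg fun k _ =>
      mul_nonneg (ha0 k) (hilbertKernel_nonneg _)) h1 hd0.le
    refine h2.trans ?_
    rw [Real.mul_rpow (Real.rpow_nonneg hG0 _) (Real.rpow_nonneg hT0 _), ← Real.rpow_mul hG0,
      ← Real.rpow_mul hT0, inv_mul_cancel₀ hd0.ne', Real.rpow_one, sub_mul, one_mul,
      inv_mul_cancel₀ hd0.ne']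
    exact mul_le_mul_of_nonneg_right (Real.rpow_le_rpow hG0 hG (by linarith)) hT0
  calc ∑ n ∈ F, (∑ k ∈ G, a k * hilbertKernel (k - n)) ^ d
      ≤ ∑ n ∈ F, S ^ (d - 1) * ∑ k ∈ G, a k * hilbertKernel (k - n) ^ d :=
        Finset.sum_le_sum fun n _ => hjen n
    _ = S ^ (d - 1) * ∑ k ∈ G, a k * ∑ n ∈ F, hilbertKernel (k - n) ^ d := by
        rw [← Finset.mul_sum, Finset.sum_comm]
        simp only [Finset.mul_sum]
    _ ≤ S ^ (d - 1) * ∑ k ∈ G, a k * ∑' m, hilbertKernel m ^ d := by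
        gcongr with k _
        · exact ha0 k
        · exact hker k
    _ = S ^ (d - 1) * ((∑ k ∈ G, a k) * ∑' m, hilbertKernel m ^ d) := by rw [Finset.sum_mul]
    _ ≤ S ^ (d - 1) * (S * ∑' m, hilbertKernel m ^ d) := by gcongr
    _ = (S * S ^ (d - 1)) * ∑' m, hilbertKernel m ^ d := by ring
    _ = _ := by rw [← Real.rpow_one_add' hS0 (by linarith)]; congr 2; ring

theorem sum_mul_le_of_sum_sq_le {ι : Type*} {F : Finset ι} {x y : ι → ℝ} {K : ℝ}
    (hx : ∑ n ∈ F, x n ^ 2 ≤ K) (hy : ∑ n ∈ F, y n ^ 2 ≤ K) : ∑ n ∈ F, x n * y n ≤ K := by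
  have : ∑ n ∈ F, x n * y n ≤ ∑ n ∈ F, (x n ^ 2 + y n ^ 2) / 2 :=
    Finset.sum_le_sum fun n _ => by nlinarith [sq_nonneg (x n - y n)]
  rw [← Finset.sum_div, Finset.sum_add_distrib] at this
  linarith

theorem sum_neg_le {f : ℤ → ℝ} {K : ℝ} (h : ∀ F : Finset ℤ, ∑ n ∈ F, f n ≤ K) (F : Finset ℤ) :
    ∑ n ∈ F, f (-n) ≤ K := by
  have := h (F.map (Equiv.neg ℤ).toEmbedding)
  simpa using this

/-- The second order terms are in `ℓᵈ` for all `d > 1`, uniformly on bounded sets. -/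
theorem sum_D0_rpow_le {d K : ℝ} (hd : 1 < d) : ∃ C : ℝ, ∀ q p : ℝ → ℂ,
    MemLp q 2 μ₀ → MemLp p 2 μ₀ → L2n q ≤ K → L2n p ≤ K → ∀ F : Finset ℤ,
    ∑ n ∈ F, ‖D0 q p n‖ ^ d ≤ C := by
  -- In `norm_D0_le` there are four products of Fourier coefficients, each summing to at most K²,
  -- which accounts for 4K². The other term is the convolution, with an ℓ¹ factor of norm at most
  -- K².
  refine ⟨2 ^ d * ((4 * K ^ 2) ^ d + (K ^ 2) ^ d * ∑' m, hilbertKernel m ^ d), ?_⟩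
  intro q p hq hp hqK hpK F
  have hb : ∀ f : ℝ → ℂ, MemLp f 2 μ₀ → L2n f ≤ K → ∀ F : Finset ℤ,
      ∑ n ∈ F, ‖T0 f n 1‖ ^ 2 ≤ K ^ 2 := fun f hf hfK F =>
    (sum_sq_T0_le hf F (by simp)).trans (pow_le_pow_left₀ (L2n_nonneg f) hfK 2)
  have bq := hb q hq hqK F
  have bp := sum_neg_le (fun F => hb p hp hpK F) F
  have bxq := hb _ (memLp_ofReal_mul hq) ((L2n_ofReal_mul_le hq).trans hqK) F
  have bxp := sum_neg_le (fun F => hb _ (memLp_ofReal_mul hp) ((L2n_ofReal_mul_le hp).trans hpK) F) F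
  refine sum_rpow_add_le (by linarith) (fun n _ => norm_nonneg _)
    (fun n _ => norm_D0_le hq hp n) (fun n _ => by positivity)
    (fun n _ => tsum_nonneg fun k => mul_nonneg (by positivity) (hilbertKernel_nonneg _)) ?_ ?_
  · refine sum_rpow_le_rpow hd.le (fun n _ => by positivity) ?_
    have h1 := sum_mul_le_of_sum_sq_le bq bp
    have h2 := sum_mul_le_of_sum_sq_le bq bxp
    have h3 := sum_mul_le_of_sum_sq_le bp bq
    have h4 := sum_mul_le_of_sum_sq_le bp bxq
    simp only [mul_add, Finset.sum_add_distrib]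
    linarith
  · refine sum_rpow_tsum_hilbertKernel_le (fun k => by positivity) (summable_norm_T0_mul hq hp) ?_
      hd F
    refine (summable_norm_T0_mul hq hp).tsum_le_of_sum_le fun G => ?_
    exact sum_mul_le_of_sum_sq_le (sum_neg_le (fun F => hb p hp hpK F) G) (hb q hq hqK G)

end PowerSums

/-! ### Norms of the coefficients -/

section Coefficients

open Complex (I)

theorem norm_qFun_le (v : PotentialC) (x : ℝ) : ‖qFun v x‖ ≤ 2 * ‖v x‖ := by
  have h0 := PiLp.norm_apply_le (v x) 0
  have h1 := PiLp.norm_apply_le (v x) 1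
  calc ‖qFun v x‖ ≤ ‖v x 1‖ + ‖I * v x 0‖ := norm_add_le _ _
    _ ≤ 2 * ‖v x‖ := by rw [norm_mul, Complex.norm_I]; linarith

theorem norm_pFun_le (v : PotentialC) (x : ℝ) : ‖pFun v x‖ ≤ 2 * ‖v x‖ := by
  have h0 := PiLp.norm_apply_le (v x) 0
  have h1 := PiLp.norm_apply_le (v x) 1
  calc ‖pFun v x‖ ≤ ‖v x 1‖ + ‖I * v x 0‖ := norm_sub_le _ _
    _ ≤ 2 * ‖v x‖ := by rw [norm_mul, Complex.norm_I]; linarith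

theorem L2n_le_of_norm_le {f : ℝ → ℂ} {v : PotentialC} {c : ℝ} (hc : 0 ≤ c)
    (h : ∀ x, ‖f x‖ ≤ c * ‖v x‖) (hf : MemLp f 2 μ₀) : L2n f ≤ c * ‖v‖ := by
  rw [L2n, ← sqrt_integral_norm_sq v]
  refine Real.sqrt_le_iff.2 ⟨by positivity, ?_⟩
  rw [mul_pow, Real.sq_sqrt (intervalIntegral.integral_nonneg zero_le_one fun x _ => sq_nonneg _),
    ← intervalIntegral.integral_const_mul]
  refine integral_mono_unit (memLp_sq_intervalIntegrable hf)
    ((memLp_sq_intervalIntegrable (Lp.memLp v)).const_mul _) fun x _ => ?_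
  rw [← mul_pow]
  exact pow_le_pow_left₀ (norm_nonneg _) (h x) 2

theorem L2n_qFun_le (v : PotentialC) : L2n (qFun v) ≤ 2 * ‖v‖ :=
  L2n_le_of_norm_le zero_le_two (norm_qFun_le v) (memLp_qFun v)

theorem L2n_pFun_le (v : PotentialC) : L2n (pFun v) ≤ 2 * ‖v‖ :=
  L2n_le_of_norm_le zero_le_two (norm_pFun_le v) (memLp_pFun v)

theorem coeFn_complexify (w : Potential) : ∀ᵐ x ∂μ₀, complexify w x = ofRealVec (w x) :=
  ofRealVec.coeFn_compLp w

theorem ofRealVec_apply (a : EuclideanSpace ℝ (Fin 2)) (k : Fin 2) :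
    ofRealVec a k = (a k : ℂ) := rfl

theorem norm_ofRealVec (a : EuclideanSpace ℝ (Fin 2)) : ‖ofRealVec a‖ = ‖a‖ := by
  simp [EuclideanSpace.norm_eq, ofRealVec_apply]

theorem norm_complexify (w : Potential) : ‖complexify w‖ = ‖w‖ := by
  rw [Lp.norm_def, Lp.norm_def]
  congr 1
  refine eLpNorm_congr_norm_ae ?_
  filter_upwards [coeFn_complexify w] with x hx
  rw [hx, norm_ofRealVec]

theorem complexify_sub (w u : Potential) : complexify (w - u) = complexify w - complexify u :=
  (ofRealVec.compLpL 2 μ₀).map_sub w u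

/-- In the new coordinates reality of the potential means that p is the conjugate of q. For real λ
this makes a the conjugate of b. -/
theorem pFun_complexify (w : Potential) :
    ∀ᵐ x ∂μ₀, pFun (complexify w) x = (starRingEnd ℂ) (qFun (complexify w) x) := by
  filter_upwards [coeFn_complexify w] with x hx
  simp [pFun, qFun, hx, ofRealVec_apply, sub_eq_add_neg]

theorem norm_pFun_complexify (w : Potential) :
    ∀ᵐ x ∂μ₀, ‖pFun (complexify w) x‖ = ‖w x‖ := by
  filter_upwards [coeFn_complexify w] with x hx
  simp only [pFun, hx, ofRealVec_apply]
  rw [EuclideanSpace.norm_eq, ← Real.sqrt_sq (norm_nonneg _), ← Complex.normSq_eq_norm_sq,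
    Complex.normSq_apply]
  congr 1
  simp [Fin.sum_univ_two]
  ring

theorem norm_qFun_complexify (w : Potential) :
    ∀ᵐ x ∂μ₀, ‖qFun (complexify w) x‖ = ‖w x‖ := by
  filter_upwards [norm_pFun_complexify w, pFun_complexify w] with x hx h
  rw [← hx, h, RCLike.norm_conj]

theorem integral_norm_pFun_complexify_le (w : Potential) :
    ∫ x in (0 : ℝ)..1, ‖pFun (complexify w) x‖ ≤ ‖w‖ := by
  rw [integral_congr_unitInterval (norm_pFun_complexify w) (right_mem_Icc.2 zero_le_one)]
  exact integral_norm_le_norm w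

theorem qFun_sub (v u : PotentialC) : ∀ᵐ x ∂μ₀, qFun v x - qFun u x = qFun (v - u) x := by
  filter_upwards [Lp.coeFn_sub v u] with x hx
  simp only [qFun, hx, Pi.sub_apply, PiLp.sub_apply]
  ring

theorem pFun_sub (v u : PotentialC) : ∀ᵐ x ∂μ₀, pFun v x - pFun u x = pFun (v - u) x := by
  filter_upwards [Lp.coeFn_sub v u] with x hx
  simp only [pFun, hx, Pi.sub_apply, PiLp.sub_apply]
  ring

end Coefficients

/-! ### The Prüfer angle of a real potential -/

section Pruefer

open Complex (I)

theorem Prim.conj {F f : ℝ → ℂ} (h : Prim F f) :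
    Prim (fun x => (starRingEnd ℂ) (F x)) (fun x => (starRingEnd ℂ) (f x)) :=
  h.clm (Complex.conjCLE : ℂ →L[ℝ] ℂ)

/-- Conjugation exchanges the two equations of the system when λ is real, and the initial values are
real; uniqueness does the rest. -/
theorem aSol_eq_conj (w : Potential) (l : ℝ) {x : ℝ} (hx : x ∈ Icc (0 : ℝ) 1) :
    aSol (complexify w) l x = (starRingEnd ℂ) (bSol (complexify w) l x) := by
  have h := isSystem_sol (complexify w) l
  have h' : IsSystem (qFun (complexify w)) (pFun (complexify w)) l
      (fun x => (starRingEnd ℂ) (bSol (complexify w) l x))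
      (fun x => (starRingEnd ℂ) (aSol (complexify w) l x)) := by
    refine ⟨h.2.conj.congr (fun _ _ => rfl) ?_, h.1.conj.congr (fun _ _ => rfl) ?_⟩
    · filter_upwards [ae_unitInterval (pFun_complexify w)] with x hx hx'
      simp [hx hx', Complex.conj_ofReal]
    · filter_upwards [ae_unitInterval (pFun_complexify w)] with x hx hx'
      simp [hx hx', Complex.conj_ofReal]
  exact (h.unique h' (memLp_intervalIntegrable (memLp_qFun _))
    (memLp_intervalIntegrable (memLp_pFun _)) (by simp [aSol_zero, bSol_zero])
    (by simp [aSol_zero, bSol_zero]) hx).1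

theorem prim_re {F f : ℝ → ℂ} (h : Prim F f) : Prim (fun x => (F x).re) (fun x => (f x).re) :=
  h.clm Complex.reCLM

theorem prim_im {F f : ℝ → ℂ} (h : Prim F f) : Prim (fun x => (F x).im) (fun x => (f x).im) :=
  h.clm Complex.imCLM

/-- `|b|²` grows or decays at most at the rate `2|p|`. -/
theorem prim_norm_sq_bSol (w : Potential) (l : ℝ) : ∃ y' : ℝ → ℝ,
    Prim (fun x => ‖bSol (complexify w) l x‖ ^ 2) y' ∧ ∀ᵐ x, x ∈ Ioo (0 : ℝ) 1 →
      |y' x| ≤ 2 * ‖pFun (complexify w) x‖ * ‖bSol (complexify w) l x‖ ^ 2 := by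
  have h := isSystem_sol (complexify w) l
  refine ⟨_, (prim_re (h.1.mul h.2)).congr (fun x hx => ?_) (ae_of_all _ fun x _ => rfl), ?_⟩
  · rw [aSol_eq_conj w l hx, mul_comm, Complex.mul_conj, Complex.normSq_eq_norm_sq]
    norm_cast
  · filter_upwards [ae_unitInterval (pFun_complexify w)] with x hx hx'
    have hx := hx hx'
    have e : (-(I * l) * aSol (complexify w) l x + qFun (complexify w) x * bSol (complexify w) l x)
        * bSol (complexify w) l x + aSol (complexify w) l x *
        (I * l * bSol (complexify w) l x + pFun (complexify w) x * aSol (complexify w) l x) =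
        qFun (complexify w) x * bSol (complexify w) l x ^ 2 +
          pFun (complexify w) x * aSol (complexify w) l x ^ 2 := by ring
    rw [e, hx, aSol_eq_conj w l (Ioo_subset_Icc_self hx'), RCLike.norm_conj]
    refine (Complex.abs_re_le_norm _).trans ((norm_add_le _ _).trans (le_of_eq ?_))
    simp only [norm_mul, norm_pow, RCLike.norm_conj]
    ring

/-- Multiplying |b|² by exp(±2∫|p|) gives monotone functions of x, and ∫|p| ≤ ‖w‖ because |p| = |w|
pointwise. -/
theorem norm_bSol_bounds (w : Potential) (l : ℝ) {x : ℝ} (hx : x ∈ Icc (0 : ℝ) 1) :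
    Real.exp (-‖w‖) ≤ ‖bSol (complexify w) l x‖ ∧ ‖bSol (complexify w) l x‖ ≤ Real.exp ‖w‖ := by
  obtain ⟨y', hy, hy'⟩ := prim_norm_sq_bSol w l
  have hp := (memLp_intervalIntegrable (memLp_pFun (complexify w))).norm
  have hK := prim_integral (hp.const_mul 2)
  have hKn := prim_integral (hp.const_mul (-2))
  have hInt : ∫ t in (0 : ℝ)..x, ‖pFun (complexify w) t‖ ≤ ‖w‖ :=
    (integral_norm_mono hp (fun _ => norm_nonneg _) hx).trans (integral_norm_pFun_complexify_le w)
  have h0 : (0 : ℝ) ≤ ‖bSol (complexify w) l x‖ := norm_nonneg _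
  constructor
  · have := (hy.mul hK.rexp).mono (by
      filter_upwards [hy'] with t ht ht'
      have h1 := neg_le_of_abs_le (ht ht')
      have h2 := Real.exp_pos (∫ s in (0 : ℝ)..t, 2 * ‖pFun (complexify w) s‖)
      nlinarith) hx
    simp only [bSol_zero, intervalIntegral.integral_same, intervalIntegral.integral_const_mul,
      Real.exp_zero, norm_one, one_pow, mul_one] at this
    rw [mul_comm 2, Real.exp_mul, Real.rpow_two, ← mul_pow] at this
    have h3 : 1 ≤ ‖bSol (complexify w) l x‖ * Real.exp (∫ t in (0 : ℝ)..x, ‖pFun (complexify w) t‖) :=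
      by
        by_contra! hc
        have := pow_lt_one₀ (by positivity) hc two_ne_zero
        linarith
    have h4 : 1 ≤ ‖bSol (complexify w) l x‖ * Real.exp ‖w‖ :=
      h3.trans (mul_le_mul_of_nonneg_left (Real.exp_le_exp.2 hInt) h0)
    rw [Real.exp_neg]
    exact (inv_le_iff_one_le_mul₀ (Real.exp_pos _)).2 h4
  · have hm : Prim (fun x => -(‖bSol (complexify w) l x‖ ^ 2 *
        Real.exp (∫ t in (0 : ℝ)..x, -2 * ‖pFun (complexify w) t‖))) _ :=
      (hy.mul hKn.rexp).clm (-ContinuousLinearMap.id ℝ ℝ)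
    have := hm.mono (by
      filter_upwards [hy'] with t ht ht'
      have h1 := le_of_abs_le (ht ht')
      have h2 := Real.exp_pos (∫ s in (0 : ℝ)..t, -2 * ‖pFun (complexify w) s‖)
      simp only [neg_apply, ContinuousLinearMap.id_apply]
      nlinarith) hx
    simp only [bSol_zero, intervalIntegral.integral_same, intervalIntegral.integral_const_mul,
      Real.exp_zero, norm_one, one_pow, mul_one, neg_le_neg_iff] at this
    rw [neg_mul, Real.exp_neg] at this
    rw [mul_comm 2, Real.exp_mul, Real.rpow_two, ← div_eq_mul_inv,
      div_le_one (by positivity)] at this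
    exact (abs_le_of_sq_le_sq' this (Real.exp_pos _).le).2.trans (Real.exp_le_exp.2 hInt)

theorem bSol_ne_zero (w : Potential) (l : ℝ) {x : ℝ} (hx : x ∈ Icc (0 : ℝ) 1) :
    bSol (complexify w) l x ≠ 0 :=
  norm_pos_iff.1 ((Real.exp_pos _).trans_le (norm_bSol_bounds w l hx).1)

/-- The logarithm of `e^{-iλx} b`. -/
noncomputable def logB (w : Potential) (l x : ℝ) : ℂ :=
  ∫ t in (0 : ℝ)..x, pFun (complexify w) t *
    (aSol (complexify w) l t / bSol (complexify w) l t)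

/-- The Prüfer angle. -/
noncomputable def angle (w : Potential) (l x : ℝ) : ℝ := l * x + (logB w l x).im

theorem intervalIntegrable_logB (w : Potential) (l : ℝ) :
    IntervalIntegrable (fun t => pFun (complexify w) t *
      (aSol (complexify w) l t / bSol (complexify w) l t)) volume 0 1 :=
  intervalIntegrable_mul_continuousOn (memLp_intervalIntegrable (memLp_pFun _))
    ((isSystem_sol (complexify w) l).1.continuousOn.div
      (isSystem_sol (complexify w) l).2.continuousOn fun _ hx => bSol_ne_zero w l hx)

theorem prim_logB (w : Potential) (l : ℝ) : Prim (logB w l) (fun t => pFun (complexify w) t *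
    (aSol (complexify w) l t / bSol (complexify w) l t)) :=
  prim_integral (intervalIntegrable_logB w l)

theorem Prim.eq_of_ae_zero {E : Type*} [NormedAddCommGroup E] [NormedSpace ℝ E] {F f : ℝ → E}
    (h : Prim F f) (hf : ∀ᵐ x ∂μ₀, f x = 0) {x : ℝ} (hx : x ∈ Icc (0 : ℝ) 1) : F x = F 0 := by
  rw [h.2 x hx, integral_congr_unitInterval hf hx]
  simp

/-- Defining the logarithm as an integral avoids any choice of branch: e^{-iλx} b e^{-`logB`} has
derivative zero. -/
theorem bSol_eq_exp (w : Potential) (l : ℝ) {x : ℝ} (hx : x ∈ Icc (0 : ℝ) 1) :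
    bSol (complexify w) l x = Complex.exp (I * l * x + logB w l x) := by
  have h := (isSystem_sol (complexify w) l).2
  have hL : Prim (fun x => -logB w l x) _ := (prim_logB w l).clm (-ContinuousLinearMap.id ℝ ℂ)
  have h2 := (prim_cexp (-(I * l))).mul (h.mul hL.cexp)
  have h3 := h2.eq_of_ae_zero (by
    filter_upwards [ae_restrict_mem measurableSet_Ioo] with t ht
    have hb := bSol_ne_zero w l (Ioo_subset_Icc_self ht)
    simp
    field_simp
    ring) hx
  have h0 : logB w l 0 = 0 := intervalIntegral.integral_same
  simp only [bSol_zero, h0, Complex.ofReal_zero, mul_zero, neg_zero, Complex.exp_zero, mul_one] at h3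
  rw [mul_left_comm, ← Complex.exp_add, ← neg_mul_eq_neg_mul, ← neg_add, Complex.exp_neg,
    mul_inv_eq_one₀ (Complex.exp_ne_zero _)] at h3
  exact h3

theorem exp_logB (w : Potential) (l x : ℝ) : I * l * x + logB w l x =
    ((logB w l x).re : ℂ) + angle w l x * I := by
  apply Complex.ext <;> simp [angle]

theorem bSol_eq_polar (w : Potential) (l : ℝ) {x : ℝ} (hx : x ∈ Icc (0 : ℝ) 1) :
    bSol (complexify w) l x =
      ‖bSol (complexify w) l x‖ * Complex.exp (angle w l x * I) := by
  rw [bSol_eq_exp w l hx, exp_logB, Complex.exp_add, norm_mul, Complex.norm_exp_ofReal_mul_I,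
    Complex.norm_exp, Complex.ofReal_re, mul_one, Complex.ofReal_exp]

theorem aSol_eq_polar (w : Potential) (l : ℝ) {x : ℝ} (hx : x ∈ Icc (0 : ℝ) 1) :
    aSol (complexify w) l x =
      ‖bSol (complexify w) l x‖ * Complex.exp (-(angle w l x * I)) := by
  rw [aSol_eq_conj w l hx]
  nth_rewrite 1 [bSol_eq_polar w l hx]
  rw [map_mul, Complex.conj_ofReal, ← Complex.exp_conj]
  simp

theorem theta_one_one_complexify (w : Potential) (l : ℝ) :
    theta (complexify w) l 1 1 =
      ((‖bSol (complexify w) l 1‖ * Real.sin (angle w l 1) : ℝ) : ℂ) := by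
  have h1 := right_mem_Icc.2 (zero_le_one (α := ℝ))
  rw [theta_one_one, aSol_eq_polar w l h1]
  nth_rewrite 2 [bSol_eq_polar w l h1]
  push_cast
  rw [Complex.sin]
  ring_nf

theorem theta_one_zero_complexify (w : Potential) (l : ℝ) :
    theta (complexify w) l 1 0 =
      ((‖bSol (complexify w) l 1‖ * Real.cos (angle w l 1) : ℝ) : ℂ) := by
  have h1 := right_mem_Icc.2 (zero_le_one (α := ℝ))
  rw [theta_one_zero, aSol_eq_polar w l h1]
  nth_rewrite 2 [bSol_eq_polar w l h1]
  push_cast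
  rw [Complex.cos]
  ring_nf

theorem ofReal_mem_eigenvalues_iff (w : Potential) (l : ℝ) :
    (l : ℂ) ∈ eigenvalues 1 1 (complexify w) ↔ ∃ n : ℤ, angle w l 1 = Real.pi * n := by
  have hb := norm_ne_zero_iff.2 (bSol_ne_zero w l (right_mem_Icc.2 zero_le_one))
  rw [mem_eigenvalues_iff, theta_one_one_complexify, Complex.ofReal_eq_zero,
    mul_eq_zero_iff_left hb, Real.sin_eq_zero_iff]
  simp only [mul_comm Real.pi, eq_comm]

/-- The Prüfer equation. -/
theorem prim_angle (w : Potential) (l : ℝ) : Prim (angle w l) (fun x =>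
    l + (pFun (complexify w) x * Complex.exp (-(2 * angle w l x * I))).im) := by
  have h1 : Prim (fun x : ℝ => l * x) (fun _ => l * 1) :=
    prim_id.clm (ContinuousLinearMap.mul ℝ ℝ l)
  refine (h1.add (prim_im (prim_logB w l))).congr (fun _ _ => rfl) (ae_of_all _ fun x hx => ?_)
  have hx := Ioo_subset_Icc_self hx
  have hb := Complex.ofReal_ne_zero.2 (norm_ne_zero_iff.2 (bSol_ne_zero w l hx))
  rw [mul_one, aSol_eq_polar w l hx]
  nth_rewrite 2 [bSol_eq_polar w l hx]
  rw [mul_div_mul_left _ _ hb, ← Complex.exp_sub]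
  ring_nf

theorem angle_zero (w : Potential) (l : ℝ) : angle w l 0 = 0 := by
  simp [angle, logB]

end Pruefer

/-! ### Monotonicity of the Prüfer angle and enumeration of the real eigenvalues. -/

section Comparison

open Complex (I)

theorem cexp_neg_two_sub (α β : ℝ) :
    Complex.exp (-(2 * α * I)) - Complex.exp (-(2 * β * I)) =
      -2 * I * Complex.exp (-((α + β) * I)) * (Real.sin (α - β) : ℂ) := by
  have e1 : Complex.exp (-(2 * α * I)) =
      Complex.exp (-((α + β) * I)) * Complex.exp (-(α - β) * I) := by
    rw [← Complex.exp_add]; ring_nf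
  have e2 : Complex.exp (-(2 * β * I)) =
      Complex.exp (-((α + β) * I)) * Complex.exp ((α - β) * I) := by
    rw [← Complex.exp_add]; ring_nf
  rw [e1, e2, Complex.ofReal_sin, Complex.sin]
  push_cast
  ring_nf
  simp [Complex.I_sq]
  ring

theorem norm_cexp_neg_mul_I (α : ℝ) : ‖Complex.exp (-(α * I))‖ = 1 := by
  rw [neg_mul_eq_neg_mul, ← Complex.ofReal_neg, Complex.norm_exp_ofReal_mul_I]

theorem norm_cexp_neg_two_sub_le (α β : ℝ) :
    ‖Complex.exp (-(2 * α * I)) - Complex.exp (-(2 * β * I))‖ ≤ 2 * |α - β| := by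
  rw [cexp_neg_two_sub]
  have := norm_cexp_neg_mul_I (α + β)
  push_cast at this
  simp only [norm_mul, this, norm_neg, Complex.norm_I, Complex.norm_real, Real.norm_eq_abs]
  have h2 : ‖(2 : ℂ)‖ = 2 := by simp
  have := Real.abs_sin_le_abs (x := α - β)
  rw [h2]
  linarith

theorem integral_norm_pFun_sub_le (w u : Potential) :
    ∫ t in (0 : ℝ)..1, ‖pFun (complexify w) t - pFun (complexify u) t‖ ≤ ‖w - u‖ := by
  rw [integral_congr_unitInterval (g := fun t => ‖pFun (complexify (w - u)) t‖) ?_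
    (right_mem_Icc.2 zero_le_one)]
  · exact integral_norm_pFun_complexify_le _
  · filter_upwards [pFun_sub (complexify w) (complexify u)] with x hx
    rw [hx, complexify_sub]

/-- The right-hand side of the Prüfer equation is Lipschitz in the angle with weight 2|p|, so
Grönwall applies. Only ‖u‖ occurs in the exponential, which matches a ball whose radius is
prescribed by its center. -/
theorem abs_angle_sub_le (w u : Potential) (l m : ℝ) {x : ℝ} (hx : x ∈ Icc (0 : ℝ) 1) :
    |angle w l x - angle u m x| ≤ (|l - m| + ‖w - u‖) * Real.exp (2 * ‖u‖) := by
  have hd := (prim_angle w l).sub (prim_angle u m)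
  have hpw := memLp_intervalIntegrable (memLp_pFun (complexify w))
  have hpu := memLp_intervalIntegrable (memLp_pFun (complexify u))
  have hc : ContinuousOn (fun x => |angle w l x - angle u m x|) (Icc 0 1) := hd.continuousOn.abs
  have hk : IntervalIntegrable (fun t => 2 * ‖pFun (complexify u) t‖) volume 0 1 :=
    hpu.norm.const_mul 2
  have hi1 : IntervalIntegrable (fun t => |l - m| +
      ‖pFun (complexify w) t - pFun (complexify u) t‖) volume 0 1 :=
    intervalIntegrable_const.add (hpw.sub hpu).norm
  have hi2 : IntervalIntegrable (fun t => 2 * ‖pFun (complexify u) t‖ *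
      |angle w l t - angle u m t|) volume 0 1 := intervalIntegrable_mul_continuousOn hk hc
  have key : ∀ x ∈ Icc (0 : ℝ) 1, |angle w l x - angle u m x| ≤ (|l - m| + ‖w - u‖) +
      ∫ t in (0 : ℝ)..x, 2 * ‖pFun (complexify u) t‖ * |angle w l t - angle u m t| := by
    intro x hx
    have h0 := left_mem_Icc.2 (zero_le_one (α := ℝ))
    have hv := hd.2 x hx
    simp only [angle_zero, sub_self, zero_add] at hv
    rw [hv]
    have hb : |∫ t in (0 : ℝ)..x, (l + (pFun (complexify w) t *
        Complex.exp (-(2 * angle w l t * I))).im -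
        (m + (pFun (complexify u) t * Complex.exp (-(2 * angle u m t * I))).im))| ≤
        ∫ t in (0 : ℝ)..x, ((|l - m| + ‖pFun (complexify w) t - pFun (complexify u) t‖) +
          2 * ‖pFun (complexify u) t‖ * |angle w l t - angle u m t|) := by
      rw [← Real.norm_eq_abs]
      refine intervalIntegral.norm_integral_le_of_norm_le hx.1 (ae_of_all _ fun t _ => ?_)
        ((intervalIntegrable_sub hi1 h0 hx).add (intervalIntegrable_sub hi2 h0 hx))
      -- The mixed term is inserted so that the difference of the exponentials is multiplied by p of
      -- u, not of w.
      have e : l + (pFun (complexify w) t * Complex.exp (-(2 * angle w l t * I))).im -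
          (m + (pFun (complexify u) t * Complex.exp (-(2 * angle u m t * I))).im) =
          (l - m) + ((pFun (complexify w) t - pFun (complexify u) t) *
            Complex.exp (-(2 * angle w l t * I)) + pFun (complexify u) t *
            (Complex.exp (-(2 * angle w l t * I)) - Complex.exp (-(2 * angle u m t * I)))).im := by
        simp only [Complex.add_im, Complex.sub_im, Complex.mul_im, Complex.sub_re]
        ring
      rw [e, Real.norm_eq_abs]
      refine (abs_add_le _ _).trans ?_
      rw [add_assoc]
      gcongr
      refine (Complex.abs_im_le_norm _).trans ((norm_add_le _ _).trans ?_)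
      have h1 := norm_cexp_neg_mul_I (2 * angle w l t)
      push_cast at h1
      have h2 := mul_le_mul_of_nonneg_left (norm_cexp_neg_two_sub_le (angle w l t) (angle u m t))
        (norm_nonneg (pFun (complexify u) t))
      rw [norm_mul, norm_mul, h1]
      linarith
    refine hb.trans ?_
    rw [intervalIntegral.integral_add (intervalIntegrable_sub hi1 h0 hx)
      (intervalIntegrable_sub hi2 h0 hx)]
    gcongr
    refine (integral_norm_mono hi1 (fun t => by positivity) hx).trans ?_
    rw [intervalIntegral.integral_add intervalIntegrable_const (hpw.sub hpu).norm]
    have := integral_norm_pFun_sub_le w u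
    simp
    linarith
  refine (gronwall hc hk (fun t => by positivity) key hx).trans ?_
  gcongr
  refine (integral_norm_mono hk (fun t => by positivity) hx).trans ?_
  rw [intervalIntegral.integral_const_mul]
  have := integral_norm_pFun_complexify_le u
  linarith

theorem continuous_angle (w : Potential) : Continuous (fun l => angle w l 1) := by
  have : LipschitzWith (Real.exp (2 * ‖w‖)).toNNReal (fun l => angle w l 1) :=
    LipschitzWith.of_dist_le_mul fun l m => by
      have := abs_angle_sub_le w w l m (right_mem_Icc.2 zero_le_one)
      rw [Real.dist_eq, Real.dist_eq, Real.coe_toNNReal _ (Real.exp_pos _).le]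
      simpa [mul_comm] using this
  exact this.continuous

/-- The difference y of two angles satisfies a linear equation y' = (l - m) + k y, and an
integrating factor shows y(1) > 0. Writing sin y = y sinc y provides a continuous coefficient
without dividing by y. -/
theorem strictMono_angle (w : Potential) : StrictMono (fun l => angle w l 1) := by
  intro m l hml
  have h1 := right_mem_Icc.2 (zero_le_one (α := ℝ))
  have hd := (prim_angle w l).sub (prim_angle w m)
  have hpw := memLp_intervalIntegrable (memLp_pFun (complexify w))
  set k : ℝ → ℝ := fun t => (pFun (complexify w) t *
    (-2 * I * Complex.exp (-((angle w l t + angle w m t) * I)) *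
      (Real.sinc (angle w l t - angle w m t) : ℂ))).im with hk
  have hkc : ContinuousOn (fun t => -2 * I * Complex.exp (-((angle w l t + angle w m t) * I)) *
      (Real.sinc (angle w l t - angle w m t) : ℂ)) (Icc 0 1) := by
    have hl := (prim_angle w l).continuousOn
    have hm := (prim_angle w m).continuousOn
    have hs := Real.continuous_sinc.comp_continuousOn (hl.sub hm)
    have hl' := Complex.continuous_ofReal.comp_continuousOn hl
    have hm' := Complex.continuous_ofReal.comp_continuousOn hm
    have hs' := Complex.continuous_ofReal.comp_continuousOn hs
    exact (continuousOn_const.mul (((hl'.add hm').mul continuousOn_const).neg.cexp)).mul hs'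
  have hki : IntervalIntegrable k volume 0 1 :=
    (prim_im (prim_integral (intervalIntegrable_mul_continuousOn hpw hkc))).1
  have hK : Prim (fun x => -∫ t in (0 : ℝ)..x, k t) _ :=
    (prim_integral hki).clm (-ContinuousLinearMap.id ℝ ℝ)
  have hE := hK.rexp
  have hprod := (hd.mul hE).congr (g := fun x => (l - m) * Real.exp (-∫ t in (0 : ℝ)..x, k t))
    (fun _ _ => rfl) (ae_of_all _ fun x _ => by
      have e : l + (pFun (complexify w) x * Complex.exp (-(2 * angle w l x * I))).im -
          (m + (pFun (complexify w) x * Complex.exp (-(2 * angle w m x * I))).im) =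
          (l - m) + k x * (angle w l x - angle w m x) := by
        have e2 : (pFun (complexify w) x * Complex.exp (-(2 * angle w l x * I))).im -
            (pFun (complexify w) x * Complex.exp (-(2 * angle w m x * I))).im =
            k x * (angle w l x - angle w m x) := by
          rw [← Complex.sub_im, ← mul_sub, cexp_neg_two_sub, hk, mul_comm _ (angle w l x - _),
            ← Complex.im_ofReal_mul]
          congr 1
          have : Real.sin (angle w l x - angle w m x) =
              (angle w l x - angle w m x) * Real.sinc (angle w l x - angle w m x) := by
            rcases eq_or_ne (angle w l x - angle w m x) 0 with h | h
            · simp [h]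
            · rw [Real.sinc_of_ne_zero h]; field_simp
          rw [this]
          push_cast
          ring
        linarith
      rw [e]
      simp only [neg_apply, ContinuousLinearMap.id_apply]
      ring)
  have hval := hprod.2 1 h1
  simp only [angle_zero, sub_self, zero_mul, zero_add] at hval
  have hpos : 0 < ∫ t in (0 : ℝ)..1, (l - m) * Real.exp (-∫ s in (0 : ℝ)..t, k s) :=
    intervalIntegral.intervalIntegral_pos_of_pos hprod.1
      (fun x => mul_pos (sub_pos.2 hml) (Real.exp_pos _)) zero_lt_one
  rw [← hval] at hpos
  exact sub_pos.1 (pos_of_mul_pos_left hpos (Real.exp_pos _).le)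

/-- For real λ the quotient a/b has modulus 1, so the integrand of `logB` has modulus |p|. -/
theorem abs_angle_sub_self_le (w : Potential) (l : ℝ) : |angle w l 1 - l| ≤ ‖w‖ := by
  have h1 := right_mem_Icc.2 (zero_le_one (α := ℝ))
  have e : angle w l 1 - l = (logB w l 1).im := by simp [angle]
  rw [e]
  refine (Complex.abs_im_le_norm _).trans (le_trans ?_ (integral_norm_pFun_complexify_le w))
  refine norm_integral_le_unit (memLp_intervalIntegrable (memLp_pFun _)).norm
    (fun _ => norm_nonneg _) (fun t ht => ?_) h1
  rw [norm_mul, norm_div, aSol_eq_conj w l ht, RCLike.norm_conj,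
    div_self (norm_ne_zero_iff.2 (bSol_ne_zero w l ht)), mul_one]

theorem exists_angle_eq (w : Potential) (c : ℝ) : ∃ l, angle w l 1 = c := by
  refine mem_range_of_exists_le_of_exists_ge (continuous_angle w) ⟨c - ‖w‖, ?_⟩ ⟨c + ‖w‖, ?_⟩
  · have := (abs_le.1 (abs_angle_sub_self_le w (c - ‖w‖))).2
    linarith
  · have := (abs_le.1 (abs_angle_sub_self_le w (c + ‖w‖))).1
    linarith

/-- The point at which the Prüfer angle at `1` takes the value `πn`. -/
noncomputable def nuSeq (w : Potential) (n : ℤ) : ℝ := (exists_angle_eq w (Real.pi * n)).choose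

theorem angle_nuSeq (w : Potential) (n : ℤ) : angle w (nuSeq w n) 1 = Real.pi * n :=
  (exists_angle_eq w (Real.pi * n)).choose_spec

theorem abs_nuSeq_sub_le (w : Potential) (n : ℤ) : |nuSeq w n - Real.pi * n| ≤ ‖w‖ := by
  rw [← angle_nuSeq w n, abs_sub_comm]
  exact abs_angle_sub_self_le w _

theorem strictMono_nuSeq (w : Potential) : StrictMono (nuSeq w) := by
  intro m n h
  refine (strictMono_angle w).lt_iff_lt.1 ?_
  simp only [angle_nuSeq]
  exact mul_lt_mul_of_pos_left (Int.cast_lt.2 h) Real.pi_pos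

/-- The eigenvalues of a real potential are real. -/
theorem im_eq_zero_of_mem_eigenvalues {w : Potential} {z : ℂ}
    (hz : z ∈ eigenvalues 1 1 (complexify w)) : z.im = 0 := by
  rw [mem_eigenvalues_iff, theta_one_one] at hz
  have hab : aSol (complexify w) z 1 = bSol (complexify w) z 1 := by
    have : I * (aSol (complexify w) z 1 - bSol (complexify w) z 1) = 0 := by
      linear_combination 2 * hz
    exact sub_eq_zero.1 ((mul_eq_zero.1 this).resolve_left Complex.I_ne_zero)
  have h1 := right_mem_Icc.2 (zero_le_one (α := ℝ))
  set a := aSol (complexify w) z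
  set b := bSol (complexify w) z
  have ha0 : a 0 = 1 := aSol_zero _ _
  have hb0 : b 0 = 1 := bSol_zero _ _
  have h := isSystem_sol (complexify w) z
  -- The off-diagonal terms cancel by p = conj q, leaving (|a|² - |b|²)' = 2 Im z (|a|² + |b|²). For
  -- an eigenvalue the left side integrates to zero, which forces Im z = 0.
  have hy := (h.1.mul h.1.conj).sub (h.2.mul h.2.conj)
  have hy2 := (prim_re hy).congr (g := fun x => 2 * z.im * (‖a x‖ ^ 2 + ‖b x‖ ^ 2))
    (fun _ _ => rfl) (by
      filter_upwards [ae_unitInterval (pFun_complexify w)] with x hx hx'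
      rw [hx hx', ← Complex.normSq_eq_norm_sq, ← Complex.normSq_eq_norm_sq, Complex.normSq_apply,
        Complex.normSq_apply]
      simp [a, b]
      ring)
  have hval : (a 1 * (starRingEnd ℂ) (a 1) - b 1 * (starRingEnd ℂ) (b 1)).re =
      (a 0 * (starRingEnd ℂ) (a 0) - b 0 * (starRingEnd ℂ) (b 0)).re +
        ∫ t in (0 : ℝ)..1, 2 * z.im * (‖a t‖ ^ 2 + ‖b t‖ ^ 2) := hy2.2 1 h1
  rw [hab, ha0, hb0, sub_self, sub_self, Complex.zero_re, zero_add,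
    intervalIntegral.integral_const_mul] at hval
  have hcont : ContinuousOn (fun x => ‖a x‖ ^ 2 + ‖b x‖ ^ 2) (Icc 0 1) :=
    (h.1.continuousOn.norm.pow 2).add (h.2.continuousOn.norm.pow 2)
  have hpos : 0 < ∫ t in (0 : ℝ)..1, (‖a t‖ ^ 2 + ‖b t‖ ^ 2) :=
    intervalIntegral.integral_pos zero_lt_one hcont (fun x _ => by positivity)
      ⟨0, left_mem_Icc.2 zero_le_one, by simp [ha0, hb0]⟩
  have := (mul_eq_zero.1 hval.symm).resolve_right hpos.ne'
  linarith

theorem range_nuSeq (w : Potential) :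
    range (fun n => (nuSeq w n : ℂ)) = eigenvalues 1 1 (complexify w) := by
  ext z
  constructor
  · rintro ⟨n, rfl⟩
    exact (ofReal_mem_eigenvalues_iff w _).2 ⟨n, angle_nuSeq w n⟩
  · intro hz
    have hre : z = (z.re : ℂ) :=
      Complex.ext rfl (by simpa using im_eq_zero_of_mem_eigenvalues hz)
    rw [hre] at hz
    obtain ⟨n, hn⟩ := (ofReal_mem_eigenvalues_iff w _).1 hz
    refine ⟨n, ?_⟩
    change (nuSeq w n : ℂ) = z
    rw [hre, (strictMono_angle w).injective ((angle_nuSeq w n).trans hn.symm)]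

end Comparison

/-! ### Asymptotic labelling of the real eigenvalues, and uniqueness of the labelling. -/

section Labelling

open Complex (I)

/-- Expansions of the solution, uniformly on bounded sets of potentials. -/
theorem sol_expansion {D K : ℝ} (hD : 0 ≤ D) (hK : 0 ≤ K) :
    ∃ C : ℝ, 0 ≤ C ∧ ∀ v : PotentialC, ‖v‖ ≤ K → ∀ (n : ℤ) (δ z : ℂ), ‖δ‖ ≤ D →
      z = Real.pi * n + δ →
      (∀ x ∈ Icc (0 : ℝ) 1,
        ‖Complex.exp (I * z * x) * aSol v z x - 1‖ ≤
          C * (‖T0 (qFun v) n x‖ + fSize (qFun v) n) ∧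
        ‖Complex.exp (-(I * z) * x) * bSol v z x - 1‖ ≤
          C * (‖T0 (pFun v) (-n) x‖ + fSize (pFun v) (-n))) ∧
      ‖Complex.exp (I * z) * aSol v z 1 - 1 - T0 (qFun v) n 1 - D0 (qFun v) (pFun v) n‖ ≤
        C * (‖δ‖ * (fSize (qFun v) n + fSize (pFun v) (-n)) + fSize (qFun v) n ^ 2 +
          ∫ t in (0 : ℝ)..1, ‖pFun v t‖ * ‖T0 (qFun v) n t‖ ^ 2) ∧
      ‖Complex.exp (-(I * z)) * bSol v z 1 - 1 - T0 (pFun v) (-n) 1 -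
          D0 (pFun v) (qFun v) (-n)‖ ≤
        C * (‖δ‖ * (fSize (qFun v) n + fSize (pFun v) (-n)) + fSize (pFun v) (-n) ^ 2 +
          ∫ t in (0 : ℝ)..1, ‖qFun v t‖ * ‖T0 (pFun v) (-n) t‖ ^ 2) := by
  obtain ⟨C, hC, h⟩ := system_expansion (D := D) (K := 2 * K) hD (by positivity)
  refine ⟨C, hC, fun v hv n δ z hδ hz => ?_⟩
  have hqK : L2n (qFun v) ≤ 2 * K := (L2n_qFun_le v).trans (by linarith)
  have hpK : L2n (pFun v) ≤ 2 * K := (L2n_pFun_le v).trans (by linarith)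
  have h1 := isSystem_sol v z
  -- The expansion of b is that of a for the exchanged system at -n and -δ.
  have h2 := h1.symm
  have hz2 : -z = Real.pi * (-n : ℤ) + -δ := by rw [hz]; push_cast; ring
  rw [hz2] at h2
  nth_rewrite 1 [hz] at h1
  obtain ⟨h3, h4⟩ := h _ _ (memLp_qFun v) (memLp_pFun v) hqK hpK n δ hδ _ _ h1 (aSol_zero v z)
    (bSol_zero v z)
  obtain ⟨h5, h6⟩ := h _ _ (memLp_pFun v) (memLp_qFun v) hpK hqK (-n) (-δ) (by simpa using hδ) _ _
    h2 (bSol_zero v z) (aSol_zero v z)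
  rw [← hz2] at h5 h6
  rw [← hz] at h3 h4
  rw [norm_neg, neg_neg, add_comm (fSize (pFun v) (-n)), mul_neg] at h6
  refine ⟨fun x hx => ⟨h3 x hx, ?_⟩, h4, h6⟩
  have := h5 x hx
  rwa [mul_neg] at this

theorem tendsto_fSize {f : ℝ → ℂ} (hf : MemLp f 2 μ₀) : Tendsto (fSize f) cofinite (𝓝 0) := by
  have hs : Summable (fun n => fSize f n ^ 2) :=
    summable_of_sum_le (fun n => sq_nonneg _) (sum_sq_fSize_le hf)
  have h := (Real.continuous_sqrt.tendsto 0).comp hs.tendsto_cofinite_zero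
  rw [Real.sqrt_zero] at h
  refine h.congr fun n => ?_
  simp [Real.sqrt_sq (fSize_nonneg f n)]

theorem tendsto_fSize_add (v : PotentialC) :
    Tendsto (fun n : ℤ => fSize (qFun v) n + fSize (pFun v) (-n)) cofinite (𝓝 0) := by
  have h := (tendsto_fSize (memLp_pFun v)).comp (neg_injective (G := ℤ)).tendsto_cofinite
  simpa using (tendsto_fSize (memLp_qFun v)).add h

theorem exists_nat_of_eventually_cofinite {P : ℤ → Prop} (h : ∀ᶠ n in cofinite, P n) :
    ∃ N : ℕ, ∀ n : ℤ, (N : ℤ) < |n| → P n := by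
  have hf : {n : ℤ | ¬P n}.Finite := h
  refine ⟨hf.toFinset.sup Int.natAbs, fun n hn => ?_⟩
  by_contra hc
  have : n.natAbs ≤ hf.toFinset.sup Int.natAbs := Finset.le_sup (hf.mem_toFinset.2 hc)
  rw [Int.abs_eq_natAbs] at hn
  omega

theorem integral_mul_norm_T0_add_le {f p : ℝ → ℂ} (hf : IntervalIntegrable f volume 0 1)
    (hp : MemLp p 2 μ₀) (n : ℤ) :
    ∫ t in (0 : ℝ)..1, ‖p t‖ * (‖T0 f n t‖ + fSize f n) ≤ 2 * L2n p * fSize f n := by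
  have h1 := integral_mul_norm_T0_le hf hp n
  have h2 : ∫ t in (0 : ℝ)..1, ‖p t‖ ≤ L2n p := integral_norm_le_sqrt hp
  have hi := (memLp_intervalIntegrable hp).norm
  simp only [mul_add]
  rw [intervalIntegral.integral_add
    (intervalIntegrable_mul_continuousOn hi (prim_T0 hf n).continuousOn.norm) (hi.mul_const _),
    intervalIntegral.integral_mul_const]
  have := mul_le_mul_of_nonneg_right h2 (fSize_nonneg f n)
  linarith

/-- Since p a/b = P A/B, the logarithm is ∫P plus ∫P(A - B)/B. The former is a shifted Fourier
integral; in the latter A - B is of first order and |B| = |b| is bounded below. -/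
theorem norm_logB_le (w : Potential) {D : ℝ} (hD : 0 ≤ D) : ∃ C : ℝ, 0 ≤ C ∧ ∀ (n : ℤ) (l : ℝ),
    |l - Real.pi * n| ≤ D → ‖logB w l 1‖ ≤
      C * (fSize (qFun (complexify w)) n + fSize (pFun (complexify w)) (-n)) := by
  obtain ⟨C, hC, h⟩ := sol_expansion (D := D) (K := ‖w‖) hD (norm_nonneg _)
  set v := complexify w with hv
  have hvn : ‖v‖ = ‖w‖ := norm_complexify w
  have hLp := L2n_nonneg (pFun v)
  refine ⟨Real.exp (2 * D) * (1 + 2 * D) + Real.exp ‖w‖ * (C * (2 * L2n (pFun v))), by positivity,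
    fun n l hl => ?_⟩
  have hp := memLp_intervalIntegrable (memLp_pFun v)
  have hq := memLp_intervalIntegrable (memLp_qFun v)
  have h1 := right_mem_Icc.2 (zero_le_one (α := ℝ))
  obtain ⟨hAB, -, -⟩ := h v hvn.le n ((l - Real.pi * n : ℝ) : ℂ) l
    (by rw [Complex.norm_real]; exact hl) (by push_cast; ring)
  set δ : ℂ := ((l - Real.pi * n : ℝ) : ℂ) with hδ
  set A : ℝ → ℂ := fun x => Complex.exp (I * l * x) * aSol v l x with hA
  set B : ℝ → ℂ := fun x => Complex.exp (-(I * l) * x) * bSol v l x with hB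
  have hBn : ∀ x, ‖B x‖ = ‖bSol v l x‖ := fun x => by
    rw [hB, norm_mul, norm_cexp_mul_ofReal]; simp
  have hB0 : ∀ x ∈ Icc (0 : ℝ) 1, B x ≠ 0 := fun x hx =>
    norm_ne_zero_iff.1 (by rw [hBn]; exact norm_ne_zero_iff.2 (bSol_ne_zero w l hx))
  set P : ℝ → ℂ := fun t => pFun v t * Complex.exp (2 * Real.pi * I * (-n : ℤ) * t) *
    Complex.exp (-(2 * I * δ) * t) with hP
  have hPn : ∀ t, ‖P t‖ = ‖pFun v t‖ := fun t => by
    rw [hP, norm_mul, norm_mul, norm_cexp_freq, norm_cexp_mul_ofReal, hδ]; simp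
  have hPi : IntervalIntegrable P volume 0 1 :=
    intervalIntegrable_mul_continuousOn (intervalIntegrable_freq hp (-n))
      (by fun_prop : Continuous fun t : ℝ => Complex.exp (-(2 * I * δ) * t)).continuousOn
  have hAc : ContinuousOn A (Icc 0 1) :=
    (by fun_prop : Continuous fun x : ℝ => Complex.exp (I * l * x)).continuousOn.mul
      (isSystem_sol v l).1.continuousOn
  have hBc : ContinuousOn B (Icc 0 1) :=
    (by fun_prop : Continuous fun x : ℝ => Complex.exp (-(I * l) * x)).continuousOn.mul
      (isSystem_sol v l).2.continuousOn
  have hPAi : IntervalIntegrable (fun t => P t * ((A t - B t) / B t)) volume 0 1 :=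
    intervalIntegrable_mul_continuousOn hPi ((hAc.sub hBc).div hBc hB0)
  have e : logB w l 1 = (∫ t in (0 : ℝ)..1, P t) + ∫ t in (0 : ℝ)..1, P t * ((A t - B t) / B t) := by
    rw [logB, ← intervalIntegral.integral_add hPi hPAi]
    refine intervalIntegral.integral_congr fun t ht => ?_
    rw [uIcc_of_le zero_le_one] at ht
    have hb := bSol_ne_zero w l ht
    have hBt := hB0 t ht
    have e1 : P t + P t * ((A t - B t) / B t) = P t * (A t / B t) := by
      field_simp
      ring
    have e2 : A t / B t = Complex.exp (2 * I * l * t) * (aSol v l t / bSol v l t) := by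
      rw [hA, hB]
      simp only
      rw [neg_mul, Complex.exp_neg, show 2 * I * (l : ℂ) * t = I * l * t + I * l * t by ring,
        Complex.exp_add]
      have := Complex.exp_ne_zero (I * l * t)
      field_simp
    change pFun v t * (aSol v l t / bSol v l t) = P t + P t * ((A t - B t) / B t)
    rw [e1, e2, hP]
    simp only
    have e3 : Complex.exp (2 * Real.pi * I * (-n : ℤ) * t) * Complex.exp (-(2 * I * δ) * t) *
        Complex.exp (2 * I * l * t) = 1 := by
      rw [← Complex.exp_add, ← Complex.exp_add, hδ, ← Complex.exp_zero]
      congr 1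
      push_cast
      ring
    linear_combination -(pFun v t * (aSol v l t / bSol v l t)) * e3
  have hb1 : ‖∫ t in (0 : ℝ)..1, P t‖ ≤ Real.exp (2 * D) * (1 + 2 * D) * fSize (pFun v) (-n) := by
    have hc : ‖-(2 * I * δ)‖ ≤ 2 * D := by
      rw [norm_neg, norm_mul, hδ, Complex.norm_real, Real.norm_eq_abs]
      simpa using hl
    refine (norm_integral_shift_le hp (-n) hc h1).trans ?_
    rw [mul_assoc (Real.exp (2 * D))]
    gcongr
    have : ‖T0 (pFun v) (-n) 1‖ ≤ fSize (pFun v) (-n) := le_add_of_nonneg_right (L2n_nonneg _)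
    linarith
  have hTq := fun n => (prim_T0 hq n).continuousOn.norm
  have hTp := fun n => (prim_T0 hp n).continuousOn.norm
  have hi1 : IntervalIntegrable (fun t => ‖pFun v t‖ * (‖T0 (qFun v) n t‖ + fSize (qFun v) n))
      volume 0 1 := intervalIntegrable_mul_continuousOn hp.norm ((hTq n).add continuousOn_const)
  have hi2 : IntervalIntegrable (fun t => ‖pFun v t‖ * (‖T0 (pFun v) (-n) t‖ + fSize (pFun v) (-n)))
      volume 0 1 := intervalIntegrable_mul_continuousOn hp.norm ((hTp (-n)).add continuousOn_const)
  have hb2 : ‖∫ t in (0 : ℝ)..1, P t * ((A t - B t) / B t)‖ ≤ Real.exp ‖w‖ * (C * (2 * L2n (pFun v)))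
      * (fSize (qFun v) n + fSize (pFun v) (-n)) := by
    refine (norm_integral_le_unit (g := fun t => Real.exp ‖w‖ * C *
      (‖pFun v t‖ * (‖T0 (qFun v) n t‖ + fSize (qFun v) n) +
        ‖pFun v t‖ * (‖T0 (pFun v) (-n) t‖ + fSize (pFun v) (-n)))) ((hi1.add hi2).const_mul _)
      (fun t => ?_) (fun t ht => ?_) h1).trans ?_
    · have := fSize_nonneg (qFun v) n
      have := fSize_nonneg (pFun v) (-n)
      positivity
    · have hA1 := (hAB t ht).1
      have hB1 := (hAB t ht).2
      have hB2 : ‖B t‖⁻¹ ≤ Real.exp ‖w‖ := by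
        rw [hBn]
        have := (norm_bSol_bounds w l ht).1
        rw [Real.exp_neg] at this
        exact inv_le_of_inv_le₀ (Real.exp_pos _) this
      rw [norm_mul, norm_div, hPn, div_eq_mul_inv]
      have hAB' : ‖A t - B t‖ ≤ C * (‖T0 (qFun v) n t‖ + fSize (qFun v) n) +
          C * (‖T0 (pFun v) (-n) t‖ + fSize (pFun v) (-n)) := by
        have : A t - B t = (A t - 1) - (B t - 1) := by ring
        rw [this]
        exact (norm_sub_le _ _).trans (add_le_add hA1 hB1)
      calc ‖pFun v t‖ * (‖A t - B t‖ * ‖B t‖⁻¹) ≤ ‖pFun v t‖ *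
          ((C * (‖T0 (qFun v) n t‖ + fSize (qFun v) n) +
          C * (‖T0 (pFun v) (-n) t‖ + fSize (pFun v) (-n))) * Real.exp ‖w‖) := by
            have := (norm_nonneg _).trans hAB'
            gcongr
        _ = _ := by ring
    · rw [intervalIntegral.integral_const_mul, intervalIntegral.integral_add hi1 hi2]
      have i1 := integral_mul_norm_T0_add_le hq (memLp_pFun v) n
      have i2 := integral_mul_norm_T0_add_le hp (memLp_pFun v) (-n)
      calc _ ≤ Real.exp ‖w‖ * C * (2 * L2n (pFun v) * fSize (qFun v) n +
          2 * L2n (pFun v) * fSize (pFun v) (-n)) := by gcongr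
        _ = _ := by ring
  have hfq := fSize_nonneg (qFun v) n
  have hE : 0 ≤ Real.exp (2 * D) * (1 + 2 * D) * fSize (qFun v) n := by positivity
  rw [e]
  refine (norm_add_le _ _).trans ((add_le_add hb1 hb2).trans ?_)
  linarith

theorem exists_abs_angle_sub_le (w : Potential) {D η : ℝ} (hD : 0 ≤ D) (hη : 0 < η) :
    ∃ N : ℕ, ∀ n : ℤ, (N : ℤ) < |n| → ∀ l : ℝ, |l - Real.pi * n| ≤ D → |angle w l 1 - l| ≤ η := by
  obtain ⟨C, hC, h⟩ := norm_logB_le w hD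
  have ht := (tendsto_fSize_add (complexify w)).const_mul C
  rw [mul_zero] at ht
  obtain ⟨N, hN⟩ := exists_nat_of_eventually_cofinite (ht.eventually (gt_mem_nhds hη))
  refine ⟨N, fun n hn l hl => ?_⟩
  have e : angle w l 1 - l = (logB w l 1).im := by simp [angle]
  rw [e]
  exact (Complex.abs_im_le_norm _).trans ((h n l hl).trans (hN n hn).le)

theorem tendsto_nuSeq (w : Potential) :
    Tendsto (fun n => nuSeq w n - nu₀ n) cofinite (𝓝 0) := by
  obtain ⟨C, hC, h⟩ := norm_logB_le w (norm_nonneg w)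
  have ht := (tendsto_fSize_add (complexify w)).const_mul C
  rw [mul_zero] at ht
  refine squeeze_zero_norm (fun n => ?_) ht
  have e : angle w (nuSeq w n) 1 - nuSeq w n = (logB w (nuSeq w n) 1).im := by simp [angle]
  rw [angle_nuSeq] at e
  rw [Real.norm_eq_abs, abs_sub_comm, nu₀, e]
  exact (Complex.abs_im_le_norm _).trans (h n _ (abs_nuSeq_sub_le w n))

theorem isEigenvalueSeq_nuSeq (w : Potential) : IsEigenvalueSeq 1 1 nu₀ w (nuSeq w) :=
  ⟨strictMono_nuSeq w, range_nuSeq w, tendsto_nuSeq w⟩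

/-- Surjectivity leaves no gap between consecutive values, so each step is exactly one. -/
theorem eq_add_of_strictMono_of_surjective {e : ℤ → ℤ} (he : StrictMono e)
    (hs : Function.Surjective e) (n : ℤ) : e n = n + e 0 := by
  have hstep : ∀ n, e (n + 1) = e n + 1 := by
    intro n
    obtain ⟨m, hm⟩ := hs (e n + 1)
    have h1 : n < m := he.lt_iff_lt.1 (by omega)
    have h2 : e (n + 1) ≤ e m := he.monotone (by omega)
    have h3 : e n < e (n + 1) := he (by omega)
    omega
  induction n using Int.induction_on with
  | zero => simp
  | succ i ih => rw [hstep, ih]; ring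
  | pred i ih =>
    have := hstep (-(i : ℤ) - 1)
    rw [sub_add_cancel, ih] at this
    omega

/-- Two increasing enumerations of the same set differ by a translation of the index. A translation
by k changes s₀ by πk, which is compatible with both limits only for k = 0. -/
theorem IsEigenvalueSeq.unique {i j : Fin 2} {s₀ : ℤ → ℝ} {v : Potential} {s s' : ℤ → ℝ}
    (hs₀ : ∀ n k, s₀ (n + k) - s₀ n = Real.pi * k) (h : IsEigenvalueSeq i j s₀ v s)
    (h' : IsEigenvalueSeq i j s₀ v s') : s' = s := by
  obtain ⟨hm, hr, ht⟩ := h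
  obtain ⟨hm', hr', ht'⟩ := h'
  have hex : ∀ n, ∃ m, s m = s' n := fun n => by
    have : (s' n : ℂ) ∈ range (fun n => (s n : ℂ)) := by rw [hr, ← hr']; exact ⟨n, rfl⟩
    obtain ⟨m, hm⟩ := this
    exact ⟨m, Complex.ofReal_injective hm⟩
  choose e he using hex
  have hemono : StrictMono e := fun a b hab => hm.lt_iff_lt.1 (by rw [he, he]; exact hm' hab)
  have hesurj : Function.Surjective e := fun m => by
    have : (s m : ℂ) ∈ range (fun n => (s' n : ℂ)) := by rw [hr', ← hr]; exact ⟨m, rfl⟩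
    obtain ⟨n, hn⟩ := this
    exact ⟨n, hm.injective ((he n).trans (Complex.ofReal_injective hn))⟩
  have hlin := eq_add_of_strictMono_of_surjective hemono hesurj
  have h1 : Tendsto (fun n : ℤ => s (n + e 0) - s₀ (n + e 0)) cofinite (𝓝 0) :=
    ht.comp (add_left_injective (e 0)).tendsto_cofinite
  have h2 := ht'.sub h1
  have h3 : Tendsto (fun _ : ℤ => Real.pi * (e 0 : ℝ)) cofinite (𝓝 (0 - 0)) := by
    refine h2.congr fun n => ?_
    rw [← he n, hlin n, ← hs₀ n (e 0)]
    ring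
  have h4 := tendsto_nhds_unique h3 tendsto_const_nhds
  have h5 : (e 0 : ℝ) = 0 := by
    rw [sub_zero] at h4
    exact (mul_eq_zero.1 h4.symm).resolve_left Real.pi_ne_zero
  funext n
  rw [← he n, hlin n, Int.cast_eq_zero.1 h5, add_zero]

theorem eigenvalueSeq_eq {i j : Fin 2} {s₀ : ℤ → ℝ} {v : Potential} {s : ℤ → ℝ}
    (hs₀ : ∀ n k, s₀ (n + k) - s₀ n = Real.pi * k) (h : IsEigenvalueSeq i j s₀ v s) :
    eigenvalueSeq i j s₀ v = s :=
  h.unique hs₀ (Classical.epsilon_spec ⟨s, h⟩)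

theorem nu_eq (w : Potential) : nu w = nuSeq w :=
  eigenvalueSeq_eq (fun n k => by simp only [nu₀]; push_cast; ring) (isEigenvalueSeq_nuSeq w)

theorem abs_log_norm_bSol_le (w : Potential) (l : ℝ) :
    |Real.log ‖bSol (complexify w) l 1‖| ≤ ‖w‖ := by
  obtain ⟨h1, h2⟩ := norm_bSol_bounds w l (right_mem_Icc.2 (zero_le_one (α := ℝ)))
  have h3 := (Real.exp_pos _).trans_le h1
  exact abs_le.2 ⟨(Real.le_log_iff_exp_le h3).2 h1, (Real.log_le_iff_le_exp h3).2 h2⟩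

theorem cos_pi_mul_int (n : ℤ) : Real.cos (Real.pi * n) = (-1) ^ n := by
  rw [mul_comm, Real.cos_int_mul_pi]

theorem theta_one_zero_nuSeq (w : Potential) (n : ℤ) :
    theta (complexify w) (nuSeq w n) 1 0 =
      (((-1) ^ n * ‖bSol (complexify w) (nuSeq w n) 1‖ : ℝ) : ℂ) := by
  rw [theta_one_zero_complexify, angle_nuSeq, cos_pi_mul_int, mul_comm]

theorem normS_eq (w : Potential) (n : ℤ) :
    normS w n = -Real.log ‖bSol (complexify w) (nuSeq w n) 1‖ := by
  rw [normS, nu_eq, theta_one_zero_nuSeq]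
  simp

theorem abs_normS_le (w : Potential) (n : ℤ) : |normS w n| ≤ ‖w‖ := by
  rw [normS_eq, abs_neg]
  exact abs_log_norm_bSol_le w _

end Labelling

/-! ### Perturbed zeros of the sine -/

section Zeros

open Complex (I)

open scoped ContDiff

theorem norm_one_sub_cos_le {δ : ℂ} (hδ : ‖δ‖ ≤ 1) : ‖1 - Complex.cos δ‖ ≤ 56 / 100 := by
  have h := Complex.cos_bound hδ
  have h2 : ‖δ‖ ^ 2 ≤ 1 := pow_le_one₀ (norm_nonneg _) hδ
  have h4 : ‖δ‖ ^ 4 ≤ 1 := pow_le_one₀ (norm_nonneg _) hδ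
  have e : 1 - Complex.cos δ = δ ^ 2 / 2 - (Complex.cos δ - (1 - δ ^ 2 / 2)) := by ring
  rw [e]
  refine (norm_sub_le _ _).trans ?_
  rw [norm_div, norm_pow]
  simp only [Complex.norm_ofNat]
  linarith

theorem norm_sub_sin_le {δ : ℂ} (hδ : ‖δ‖ ≤ 1) : ‖δ - Complex.sin δ‖ ≤ 1 / 5 := by
  have h := Complex.sin_bound hδ
  have h2 : ‖δ‖ ^ 3 ≤ 1 := pow_le_one₀ (norm_nonneg _) hδ
  have h4 : ‖δ‖ ^ 5 ≤ 1 := pow_le_one₀ (norm_nonneg _) hδ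
  have e : δ - Complex.sin δ = δ ^ 3 / 6 - (Complex.sin δ - (δ - δ ^ 3 / 6)) := by ring
  rw [e]
  refine (norm_sub_le _ _).trans ?_
  rw [norm_div, norm_pow]
  simp only [Complex.norm_ofNat]
  linarith

variable {g : ℂ → ℂ}

/-- Cauchy's estimate on circles of radius 1/2; this is why the hypothesis is required on the disc
of radius 3/2. -/
theorem norm_deriv_sub_cos_le (hg : Differentiable ℂ g)
    (h : ∀ δ, ‖δ‖ ≤ 3 / 2 → ‖g δ - Complex.sin δ‖ ≤ 1 / 20) {δ : ℂ} (hδ : ‖δ‖ ≤ 1) :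
    ‖deriv g δ - Complex.cos δ‖ ≤ 1 / 10 := by
  have hd : Differentiable ℂ fun δ => g δ - Complex.sin δ := hg.sub Complex.differentiable_sin
  have h1 := Complex.norm_deriv_le_of_forall_mem_sphere_norm_le (c := δ) (R := 1 / 2) (C := 1 / 20)
    (by norm_num) hd.diffContOnCl (fun z hz => h z (by
      have h2 : ‖z - δ‖ = 1 / 2 := by simpa [dist_eq_norm] using hz
      have h3 := norm_add_le (z - δ) δ
      rw [sub_add_cancel] at h3
      linarith))
  have e : deriv (fun δ => g δ - Complex.sin δ) δ = deriv g δ - Complex.cos δ := by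
    rw [deriv_fun_sub hg.differentiableAt Complex.differentiable_sin.differentiableAt,
      Complex.deriv_sin]
  rw [e] at h1
  linarith

theorem norm_one_sub_deriv_le (hg : Differentiable ℂ g)
    (h : ∀ δ, ‖δ‖ ≤ 3 / 2 → ‖g δ - Complex.sin δ‖ ≤ 1 / 20) {δ : ℂ} (hδ : ‖δ‖ ≤ 1) :
    ‖1 - deriv g δ‖ ≤ 2 / 3 := by
  have h1 := norm_deriv_sub_cos_le hg h hδ
  have h2 := norm_one_sub_cos_le hδ
  have e : 1 - deriv g δ = (1 - Complex.cos δ) - (deriv g δ - Complex.cos δ) := by ring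
  rw [e]
  refine (norm_sub_le _ _).trans ?_
  linarith

theorem deriv_ne_zero_of_near_sin (hg : Differentiable ℂ g)
    (h : ∀ δ, ‖δ‖ ≤ 3 / 2 → ‖g δ - Complex.sin δ‖ ≤ 1 / 20) {δ : ℂ} (hδ : ‖δ‖ ≤ 1) :
    deriv g δ ≠ 0 := by
  intro h0
  have := norm_one_sub_deriv_le hg h hδ
  rw [h0, sub_zero, norm_one] at this
  norm_num at this

theorem norm_sub_sub_le_of_near_sin (hg : Differentiable ℂ g)
    (h : ∀ δ, ‖δ‖ ≤ 3 / 2 → ‖g δ - Complex.sin δ‖ ≤ 1 / 20) {x y : ℂ} (hx : ‖x‖ ≤ 1)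
    (hy : ‖y‖ ≤ 1) : ‖(y - g y) - (x - g x)‖ ≤ 2 / 3 * ‖y - x‖ := by
  refine (convex_closedBall (0 : ℂ) 1).norm_image_sub_le_of_norm_deriv_le (𝕜 := ℂ)
    (f := fun δ => δ - g δ) (fun z _ => differentiableAt_id.sub hg.differentiableAt)
    (fun z hz => ?_) (by simpa using hx) (by simpa using hy)
  rw [deriv_fun_sub differentiableAt_fun_id hg.differentiableAt, deriv_id'']
  exact norm_one_sub_deriv_le hg h (by simpa using hz)

/-- The map δ ↦ δ - g δ has Lipschitz constant 2/3 on the closed unit disc, and its values there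
have modulus at most 1/5 + 1/20. Its fixed points are the zeros of g, so the one zero lies well
inside the open disc. -/
theorem exists_zero_of_near_sin (hg : Differentiable ℂ g)
    (h : ∀ δ, ‖δ‖ ≤ 3 / 2 → ‖g δ - Complex.sin δ‖ ≤ 1 / 20) :
    ∃ δ : ℂ, ‖δ‖ < 1 ∧ g δ = 0 ∧ ∀ δ', ‖δ'‖ < 1 → g δ' = 0 → δ' = δ := by
  have hsmall : ∀ δ, ‖δ‖ ≤ 1 → ‖δ - g δ‖ ≤ 1 / 4 := fun δ hδ => by
    have h1 := h δ (by linarith)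
    have h2 := norm_sub_sin_le hδ
    have e : δ - g δ = (δ - Complex.sin δ) - (g δ - Complex.sin δ) := by ring
    rw [e]
    refine (norm_sub_le _ _).trans ?_
    linarith
  have hmaps : MapsTo (fun δ => δ - g δ) (Metric.closedBall (0 : ℂ) 1) (Metric.closedBall 0 1) :=
    fun δ hδ => by
      have := hsmall δ (by simpa using hδ)
      simp only [Metric.mem_closedBall, dist_zero_right]
      linarith
  have hcontr : ContractingWith (2 / 3) (hmaps.restrict _ _ _) := by
    refine ⟨by
      rw [div_lt_one (by norm_num)]
      norm_num, LipschitzWith.of_dist_le_mul fun x y => ?_⟩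
    have hx : ‖(x : ℂ)‖ ≤ 1 := mem_closedBall_zero_iff.1 x.2
    have hy : ‖(y : ℂ)‖ ≤ 1 := mem_closedBall_zero_iff.1 y.2
    rw [Subtype.dist_eq, Subtype.dist_eq, dist_eq_norm, dist_eq_norm]
    simpa using norm_sub_sub_le_of_near_sin hg h hy hx
  obtain ⟨δ, hδ, hfix, -⟩ := hcontr.exists_fixedPoint' Metric.isClosed_closedBall.isComplete hmaps
    (x := 0) (by simp) (edist_ne_top _ _)
  have hfix' : δ - g δ = δ := hfix
  have hδ1 : ‖δ‖ ≤ 1 := by simpa using hδ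
  have hg0 : g δ = 0 := by simpa using hfix'
  refine ⟨δ, ?_, hg0, fun δ' hδ' hg' => ?_⟩
  · have := hsmall δ hδ1
    rw [hfix'] at this
    linarith
  · have := norm_sub_sub_le_of_near_sin hg h hδ1 hδ'.le
    rw [hg0, hg', sub_zero, sub_zero] at this
    have h0 : ‖δ' - δ‖ ≤ 0 := by linarith [norm_nonneg (δ' - δ)]
    exact sub_eq_zero.1 (norm_le_zero_iff.1 h0)

/-- A function that parametrizes the zero set of an analytic function with invertible partial
derivative is analytic. -/
theorem analyticAt_of_implicit {X : Type*} [NormedAddCommGroup X] [NormedSpace ℂ X]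
    [CompleteSpace X] {F : X × ℂ → ℂ} {s : X → ℂ} {x : X} (hF : AnalyticAt ℂ F (x, s x))
    (h0 : F (x, s x) = 0) (hd : deriv (fun z => F (x, z)) (s x) ≠ 0)
    (hs : ∀ᶠ y in 𝓝 (x, s x), F y = 0 → y.2 = s y.1) : AnalyticAt ℂ s x := by
  have cdf : ContDiffAt ℂ ω F (x, s x) := hF.contDiffAt
  have hne : (ω : WithTop ℕ∞) ≠ 0 := by simp
  have hval : (fderiv ℂ F (x, s x) ∘L .inr ℂ X ℂ) 1 = deriv (fun z => F (x, z)) (s x) := by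
    have h1 : HasFDerivAt (fun z : ℂ => (x, z)) (ContinuousLinearMap.inr ℂ X ℂ) (s x) :=
      hasFDerivAt_prodMk_right x (s x)
    exact ((hF.differentiableAt.hasFDerivAt.comp (s x) h1).hasDerivAt).deriv.symm
  have hinv : (fderiv ℂ F (x, s x) ∘L .inr ℂ X ℂ).IsInvertible := by
    refine ⟨ContinuousLinearEquiv.unitsEquivAut ℂ (Units.mk0 _ hd), ?_⟩
    ext
    rw [hval]
    simp
  have hφ := cdf.contDiffAt_implicitFunction hne hinv
  -- No continuity of s is assumed: near the point, the graph of the implicit function lies in the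
  -- zero set, and there `hs` identifies it with s.
  have hφs : ∀ᶠ y in 𝓝 x, cdf.implicitFunction hne hinv y = s y := by
    have h2 : Tendsto (fun y => (y, cdf.implicitFunction hne hinv y)) (𝓝 x) (𝓝 (x, s x)) := by
      have := (continuousAt_id.prodMk hφ.continuousAt).tendsto
      rwa [cdf.implicitFunction_apply_self hne hinv] at this
    filter_upwards [h2.eventually hs, cdf.eventually_apply_implicitFunction hne hinv] with y hy hy'
    exact hy (hy'.trans h0)
  exact hφ.analyticAt.congr hφs

end Zeros

/-! ### Solutions for complex potentials in the ball, compared with the unperturbed ones. -/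

section ComplexEigenvalues

open Complex (I)

theorem exp_eight_fifths_le : Real.exp (8 / 5) ≤ 5 := by
  have h1 := Real.exp_one_lt_d9
  have h2 : Real.exp (8 / 5) ^ 5 = Real.exp 1 ^ 8 := by
    rw [← Real.exp_nat_mul, ← Real.exp_nat_mul]
    norm_num
  have h3 : Real.exp (8 / 5) ^ 5 ≤ 5 ^ 5 := by
    rw [h2]
    calc Real.exp 1 ^ 8 ≤ 2.7182818286 ^ 8 := by gcongr
      _ ≤ 5 ^ 5 := by norm_num
  exact le_of_pow_le_pow_left₀ (by norm_num) (by norm_num) h3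

theorem radius_le (u : Potential) : (1 / 4 ^ 4) * Real.exp (-3 * ‖u‖) ≤ 1 / 256 := by
  have : Real.exp (-3 * ‖u‖) ≤ 1 := Real.exp_le_one_iff.2 (by linarith [norm_nonneg u])
  linarith

theorem norm_sub_lt_of_mem {u : Potential} {v : PotentialC} (hv : v ∈ complexBall u) :
    ‖v - complexify u‖ < (1 / 4 ^ 4) * Real.exp (-3 * ‖u‖) := by
  rw [← dist_eq_norm]
  exact hv

theorem norm_le_of_mem {u : Potential} {v : PotentialC} (hv : v ∈ complexBall u) :
    ‖v‖ ≤ ‖u‖ + 1 := by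
  have h1 := norm_sub_lt_of_mem hv
  have h2 := radius_le u
  have h3 := norm_sub_norm_le v (complexify u)
  rw [norm_complexify] at h3
  linarith

/-- The solutions for a potential in the ball stay close to those for its center. -/
theorem norm_sol_sub_le {u : Potential} {v : PotentialC} (hv : v ∈ complexBall u) {z : ℂ}
    (hz : |z.im| ≤ 3 / 2) :
    ‖aSol v z 1 - aSol (complexify u) z 1‖ ≤ 1 / 25 ∧
      ‖bSol v z 1 - bSol (complexify u) z 1‖ ≤ 1 / 25 := by
  set c := complexify u with hc
  set h := v - c with hh
  have h1 := right_mem_Icc.2 (zero_le_one (α := ℝ))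
  have hsv := isSystem_sol v z
  have hsu := isSystem_sol c z
  have hqv := memLp_intervalIntegrable (memLp_qFun v)
  have hpv := memLp_intervalIntegrable (memLp_pFun v)
  have hqu := memLp_intervalIntegrable (memLp_qFun c)
  have hpu := memLp_intervalIntegrable (memLp_pFun c)
  have hun := (memLp_intervalIntegrable (Lp.memLp u)).norm
  have hhn := (memLp_intervalIntegrable (Lp.memLp h)).norm
  have hiu := integral_norm_le_norm u
  have hih : ∫ x in (0 : ℝ)..1, ‖h x‖ ≤ (1 / 4 ^ 4) * Real.exp (-3 * ‖u‖) :=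
    (integral_norm_le_norm h).trans (norm_sub_lt_of_mem hv).le
  have hub : ∀ x ∈ Icc (0 : ℝ) 1, max ‖aSol c z x‖ ‖bSol c z x‖ ≤
      Real.exp (3 / 2 * x) * Real.exp ‖u‖ := by
    intro x hx
    refine (hsu.bound hqu hpu hun (fun _ => norm_nonneg _)
      ((norm_qFun_complexify u).mono fun _ => le_of_eq)
      ((norm_pFun_complexify u).mono fun _ => le_of_eq) (M := 1) (by simp [aSol_zero])
      (by simp [bSol_zero]) hx).trans ?_
    rw [one_mul]
    gcongr
    · exact hx.1
    · exact (integral_norm_mono hun (fun _ => norm_nonneg _) hx).trans hiu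
  have ha : Prim (fun x => aSol v z x - aSol c z x) (fun x => -(I * z) *
      (aSol v z x - aSol c z x) + (qFun v x * bSol v z x - qFun c x * bSol c z x)) :=
    (hsv.1.sub hsu.1).congr (fun _ _ => rfl) (ae_of_all _ fun x _ => by ring)
  have hb : Prim (fun x => bSol v z x - bSol c z x) (fun x => I * z *
      (bSol v z x - bSol c z x) + (pFun v x * aSol v z x - pFun c x * aSol c z x)) :=
    (hsv.2.sub hsu.2).congr (fun _ _ => rfl) (ae_of_all _ fun x _ => by ring)
  -- With h = v - u, the coefficient of the difference system is bounded by |u| + 2|h|. The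
  -- inhomogeneity is the coefficient of h times the solution for u, which grows at most like
  -- e^{3x/2 + ‖u‖}.
  have key := system_bound (M := 0) (k := fun x => ‖u x‖ + 2 * ‖h x‖)
    (r := fun x => 2 * Real.exp ‖u‖ * ‖h x‖) hz ha hb
    ((intervalIntegrable_mul_continuousOn hqv hsv.2.continuousOn).sub
      (intervalIntegrable_mul_continuousOn hqu hsu.2.continuousOn))
    ((intervalIntegrable_mul_continuousOn hpv hsv.1.continuousOn).sub
      (intervalIntegrable_mul_continuousOn hpu hsu.1.continuousOn))
    (hun.add (hhn.const_mul 2)) (fun x => by positivity) (hhn.const_mul _)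
    (fun x => by positivity)
    (by
      filter_upwards [norm_qFun_complexify u, qFun_sub v c, ae_restrict_mem measurableSet_Ioo]
        with x hx1 hx2 hx3
      have e : qFun v x * bSol v z x - qFun c x * bSol c z x =
          (qFun c x + qFun h x) * (bSol v z x - bSol c z x) + qFun h x * bSol c z x := by
        rw [← hx2]; ring
      have hb1 := (le_max_right _ _).trans (hub x (Ioo_subset_Icc_self hx3))
      have hq := norm_qFun_le h x
      rw [e]
      calc _ ≤ ‖(qFun c x + qFun h x) * (bSol v z x - bSol c z x)‖ + ‖qFun h x * bSol c z x‖ :=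
            norm_add_le _ _
        _ ≤ (‖u x‖ + 2 * ‖h x‖) * max ‖aSol v z x - aSol c z x‖ ‖bSol v z x - bSol c z x‖ +
            2 * ‖h x‖ * (Real.exp (3 / 2 * x) * Real.exp ‖u‖) := by
          rw [norm_mul, norm_mul]
          gcongr
          · exact (norm_add_le _ _).trans (by rw [hx1]; gcongr)
          · exact le_max_right _ _
        _ = _ := by ring)
    (by
      filter_upwards [norm_pFun_complexify u, pFun_sub v c, ae_restrict_mem measurableSet_Ioo]
        with x hx1 hx2 hx3
      have e : pFun v x * aSol v z x - pFun c x * aSol c z x =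
          (pFun c x + pFun h x) * (aSol v z x - aSol c z x) + pFun h x * aSol c z x := by
        rw [← hx2]; ring
      have hb1 := (le_max_left _ _).trans (hub x (Ioo_subset_Icc_self hx3))
      have hq := norm_pFun_le h x
      rw [e]
      calc _ ≤ ‖(pFun c x + pFun h x) * (aSol v z x - aSol c z x)‖ + ‖pFun h x * aSol c z x‖ :=
            norm_add_le _ _
        _ ≤ (‖u x‖ + 2 * ‖h x‖) * max ‖aSol v z x - aSol c z x‖ ‖bSol v z x - bSol c z x‖ +
            2 * ‖h x‖ * (Real.exp (3 / 2 * x) * Real.exp ‖u‖) := by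
          rw [norm_mul, norm_mul]
          gcongr
          · exact (norm_add_le _ _).trans (by rw [hx1]; gcongr)
          · exact le_max_left _ _
        _ = _ := by ring)
    (by simp [aSol_zero]) (by simp [bSol_zero]) h1
  -- Here the radius is used: its factor e^{-3‖u‖} outweighs one e^{‖u‖} from the solution for u and
  -- one from Grönwall, and 2 · 4⁻⁴ = 1/128. The remaining exponent is at most 8/5, and 5/128 ≤
  -- 1/25.
  have hfin : Real.exp (3 / 2 * 1) * ((0 + ∫ t in (0 : ℝ)..1, 2 * Real.exp ‖u‖ * ‖h t‖) *
      Real.exp (∫ t in (0 : ℝ)..1, (‖u t‖ + 2 * ‖h t‖))) ≤ 1 / 25 := by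
    rw [intervalIntegral.integral_add hun (hhn.const_mul 2), intervalIntegral.integral_const_mul,
      intervalIntegral.integral_const_mul, zero_add]
    have hr := radius_le u
    have hu0 := norm_nonneg u
    calc _ ≤ Real.exp (3 / 2 * 1) * ((2 * Real.exp ‖u‖ * ((1 / 4 ^ 4) * Real.exp (-3 * ‖u‖))) *
          Real.exp (‖u‖ + 1 / 128)) := by
          gcongr
          linarith
      _ = 1 / 128 * Real.exp (3 / 2 * 1 + ‖u‖ + -3 * ‖u‖ + (‖u‖ + 1 / 128)) := by
          rw [Real.exp_add _ (‖u‖ + _), Real.exp_add _ (-3 * ‖u‖), Real.exp_add (3 / 2 * 1)]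
          ring
      _ ≤ 1 / 128 * Real.exp (8 / 5) := by
          gcongr
          linarith
      _ ≤ 1 / 25 := by linarith [exp_eight_fifths_le]
  exact ⟨(le_max_left _ _).trans (key.trans hfin), (le_max_right _ _).trans (key.trans hfin)⟩

/-- The large-n expansion is used for the center u only, with error 1/100, and the passage to v
costs 1/25. This makes N independent of v. -/
theorem exists_norm_sol_sub_exp_le (u : Potential) : ∃ N : ℕ, ∀ n : ℤ, (N : ℤ) < |n| →
    ∀ v ∈ complexBall u, ∀ δ : ℂ, ‖δ‖ ≤ 3 / 2 →
      ‖aSol v (Real.pi * n + δ) 1 - Complex.exp (-(I * (Real.pi * n + δ)))‖ ≤ 1 / 20 ∧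
      ‖bSol v (Real.pi * n + δ) 1 - Complex.exp (I * (Real.pi * n + δ))‖ ≤ 1 / 20 := by
  obtain ⟨C, hC, h⟩ := sol_expansion (D := 3 / 2) (K := ‖u‖) (by norm_num) (norm_nonneg _)
  have ht := (tendsto_fSize_add (complexify u)).const_mul (Real.exp (3 / 2) * (C * 2))
  rw [mul_zero] at ht
  obtain ⟨N, hN⟩ := exists_nat_of_eventually_cofinite
    (ht.eventually (gt_mem_nhds (show (0 : ℝ) < 1 / 100 by norm_num)))
  refine ⟨N, fun n hn v hv δ hδ => ?_⟩
  have h1 := right_mem_Icc.2 (zero_le_one (α := ℝ))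
  have hsmall := (hN n hn).le
  have hfq := fSize_nonneg (qFun (complexify u)) n
  have hfp := fSize_nonneg (pFun (complexify u)) (-n)
  obtain ⟨hAB, -⟩ := h (complexify u) (norm_complexify u).le n δ _ hδ rfl
  obtain ⟨hA, hB⟩ := hAB 1 h1
  set z : ℂ := Real.pi * n + δ with hz
  have him : z.im = δ.im := by rw [hz]; simp
  have himz : |z.im| ≤ 3 / 2 := by rw [him]; exact (Complex.abs_im_le_norm _).trans hδ
  obtain ⟨hd1, hd2⟩ := norm_sol_sub_le hv himz
  rw [Complex.ofReal_one, mul_one] at hA hB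
  have hTq : ‖T0 (qFun (complexify u)) n 1‖ ≤ fSize (qFun (complexify u)) n :=
    le_add_of_nonneg_right (L2n_nonneg _)
  have hTp : ‖T0 (pFun (complexify u)) (-n) 1‖ ≤ fSize (pFun (complexify u)) (-n) :=
    le_add_of_nonneg_right (L2n_nonneg _)
  have hE1 : ‖Complex.exp (-(I * z))‖ ≤ Real.exp (3 / 2) := by
    rw [Complex.norm_exp]
    refine Real.exp_le_exp.2 ?_
    simpa using (le_abs_self _).trans himz
  have hE2 : ‖Complex.exp (I * z)‖ ≤ Real.exp (3 / 2) := by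
    rw [Complex.norm_exp]
    refine Real.exp_le_exp.2 ?_
    simpa using (neg_le_abs _).trans himz
  have hmul : Complex.exp (-(I * z)) * Complex.exp (I * z) = 1 := by
    rw [← Complex.exp_add]; simp
  constructor
  · have e : aSol v z 1 - Complex.exp (-(I * z)) = (aSol v z 1 - aSol (complexify u) z 1) +
        Complex.exp (-(I * z)) * (Complex.exp (I * z) * aSol (complexify u) z 1 - 1) := by
      linear_combination -aSol (complexify u) z 1 * hmul
    rw [e]
    refine (norm_add_le _ _).trans ?_
    have : ‖Complex.exp (-(I * z)) * (Complex.exp (I * z) * aSol (complexify u) z 1 - 1)‖ ≤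
        1 / 100 := by
      rw [norm_mul]
      calc _ ≤ Real.exp (3 / 2) * (C * (2 * (fSize (qFun (complexify u)) n +
            fSize (pFun (complexify u)) (-n)))) := by
            gcongr
            refine hA.trans ?_
            gcongr
            linarith
        _ ≤ 1 / 100 := le_trans (le_of_eq (by ring)) hsmall
    linarith
  · have e : bSol v z 1 - Complex.exp (I * z) = (bSol v z 1 - bSol (complexify u) z 1) +
        Complex.exp (I * z) * (Complex.exp (-(I * z)) * bSol (complexify u) z 1 - 1) := by
      linear_combination -bSol (complexify u) z 1 * hmul
    rw [e]
    refine (norm_add_le _ _).trans ?_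
    have : ‖Complex.exp (I * z) * (Complex.exp (-(I * z)) * bSol (complexify u) z 1 - 1)‖ ≤
        1 / 100 := by
      rw [norm_mul]
      calc _ ≤ Real.exp (3 / 2) * (C * (2 * (fSize (qFun (complexify u)) n +
            fSize (pFun (complexify u)) (-n)))) := by
            gcongr
            refine hB.trans ?_
            gcongr
            linarith
        _ ≤ 1 / 100 := le_trans (le_of_eq (by ring)) hsmall
    linarith

theorem neg_one_zpow_mul_self (n : ℤ) : ((-1 : ℂ) ^ n) * (-1) ^ n = 1 := by
  rw [← mul_zpow]; simp

theorem norm_neg_one_zpow (n : ℤ) : ‖(-1 : ℂ) ^ n‖ = 1 := by simp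

theorem sin_add_int_mul_pi (z : ℂ) (n : ℤ) :
    Complex.sin (z + n * Real.pi) = (-1) ^ n * Complex.sin z :=
  n.cast_negOnePow ℂ ▸ Complex.sin_antiperiodic.add_int_mul_eq n

theorem cos_add_int_mul_pi (z : ℂ) (n : ℤ) :
    Complex.cos (z + n * Real.pi) = (-1) ^ n * Complex.cos z :=
  n.cast_negOnePow ℂ ▸ Complex.cos_antiperiodic.add_int_mul_eq n

theorem exists_norm_theta_sub_le (u : Potential) : ∃ N : ℕ, ∀ n : ℤ, (N : ℤ) < |n| →
    ∀ v ∈ complexBall u, ∀ δ : ℂ, ‖δ‖ ≤ 3 / 2 →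
      ‖(-1) ^ n * theta v (Real.pi * n + δ) 1 1 - Complex.sin δ‖ ≤ 1 / 20 ∧
      ‖(-1) ^ n * theta v (Real.pi * n + δ) 1 0 - Complex.cos δ‖ ≤ 1 / 20 := by
  obtain ⟨N, hN⟩ := exists_norm_sol_sub_exp_le u
  refine ⟨N, fun n hn v hv δ hδ => ?_⟩
  obtain ⟨ha, hb⟩ := hN n hn v hv δ hδ
  set z : ℂ := Real.pi * n + δ with hz
  have hs : Complex.sin δ = (-1) ^ n * Complex.sin z := by
    rw [hz, add_comm, mul_comm (Real.pi : ℂ), sin_add_int_mul_pi, ← mul_assoc,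
      neg_one_zpow_mul_self, one_mul]
  have hc : Complex.cos δ = (-1) ^ n * Complex.cos z := by
    rw [hz, add_comm, mul_comm (Real.pi : ℂ), cos_add_int_mul_pi, ← mul_assoc,
      neg_one_zpow_mul_self, one_mul]
  have hsum : ∀ x y : ℂ, ‖x‖ ≤ 1 / 20 → ‖y‖ ≤ 1 / 20 → ‖(x + y) / 2‖ ≤ 1 / 20 := by
    intro x y hx hy
    rw [norm_div, Complex.norm_ofNat]
    linarith [norm_add_le x y]
  constructor
  · rw [hs, ← mul_sub, norm_mul, norm_neg_one_zpow, one_mul, theta_one_one, Complex.sin]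
    have e : I * (aSol v z 1 - bSol v z 1) / 2 -
        (Complex.exp (-z * I) - Complex.exp (z * I)) * I / 2 =
        (I * (aSol v z 1 - Complex.exp (-(I * z))) +
          -I * (bSol v z 1 - Complex.exp (I * z))) / 2 := by
      rw [show -z * I = -(I * z) by ring, show z * I = I * z by ring]
      ring
    rw [e]
    exact hsum _ _ (by simpa using ha) (by simpa using hb)
  · rw [hc, ← mul_sub, norm_mul, norm_neg_one_zpow, one_mul, theta_one_zero, Complex.cos]
    have e : (aSol v z 1 + bSol v z 1) / 2 -
        (Complex.exp (z * I) + Complex.exp (-z * I)) / 2 =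
        ((aSol v z 1 - Complex.exp (-(I * z))) + (bSol v z 1 - Complex.exp (I * z))) / 2 := by
      rw [show -z * I = -(I * z) by ring, show z * I = I * z by ring]
      ring
    rw [e]
    exact hsum _ _ ha hb

end ComplexEigenvalues

/-! ### Analytic continuation of the eigenvalues and norming constants. -/

section Continuation

open Complex (I)

open Classical in
/-- The eigenvalue of a complex potential at distance less than `1` from `πn`. -/
noncomputable def eigC (n : ℤ) (v : PotentialC) : ℂ :=
  -- The default value plays no role on the ball for large |n|, where `exists_eigC_spec` shows that
  -- such a zero exists.
  if h : ∃ z : ℂ, ‖z - Real.pi * n‖ < 1 ∧ theta v z 1 1 = 0 then h.choose else 0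

/-- The norming constant of a complex potential. -/
noncomputable def normC (n : ℤ) (v : PotentialC) : ℂ :=
  -Complex.log ((-1) ^ n * theta v (eigC n v) 1 0)

theorem analyticAt_theta_one_one (y : PotentialC × ℂ) :
    AnalyticAt ℂ (fun y : PotentialC × ℂ => theta y.1 y.2 1 1) y := by
  simp only [theta_one_one]
  exact (analyticAt_const.mul ((analyticAt_aSol 1 y).sub (analyticAt_bSol 1 y))).div
    analyticAt_const two_ne_zero

theorem analyticAt_theta_one_zero (y : PotentialC × ℂ) :
    AnalyticAt ℂ (fun y : PotentialC × ℂ => theta y.1 y.2 1 0) y := by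
  simp only [theta_one_zero]
  exact ((analyticAt_aSol 1 y).add (analyticAt_bSol 1 y)).div analyticAt_const two_ne_zero

theorem differentiable_theta_one_one (v : PotentialC) :
    Differentiable ℂ (fun z => theta v z 1 1) := fun z =>
  (analyticAt_theta_one_one (v, z)).differentiableAt.comp z
    ((differentiableAt_const v).prodMk differentiableAt_id)

/-- `exists_zero_of_near_sin` is applied to the second component of ϑ(1, πn + δ), with the sign
(-1)^n removed. The nonvanishing derivative serves the implicit function theorem; the final bound
keeps the argument of the logarithm in `normC` away from its cut. -/
theorem exists_eigC_spec (u : Potential) : ∃ N : ℕ, ∀ n : ℤ, (N : ℤ) < |n| →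
    ∀ v ∈ complexBall u, ‖eigC n v - Real.pi * n‖ < 1 ∧ theta v (eigC n v) 1 1 = 0 ∧
      (∀ z : ℂ, ‖z - Real.pi * n‖ < 1 → theta v z 1 1 = 0 → z = eigC n v) ∧
      deriv (fun z => theta v z 1 1) (eigC n v) ≠ 0 ∧
      ‖(-1) ^ n * theta v (eigC n v) 1 0 - 1‖ ≤ 7 / 10 := by
  obtain ⟨N, hN⟩ := exists_norm_theta_sub_le u
  refine ⟨N, fun n hn v hv => ?_⟩
  set g : ℂ → ℂ := fun δ => (-1) ^ n * theta v (Real.pi * n + δ) 1 1 with hg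
  have hθ := differentiable_theta_one_one v
  have hgd : Differentiable ℂ g :=
    (hθ.comp (differentiable_id.const_add (Real.pi * n : ℂ))).const_mul _
  have hgs : ∀ δ, ‖δ‖ ≤ 3 / 2 → ‖g δ - Complex.sin δ‖ ≤ 1 / 20 := fun δ hδ => (hN n hn v hv δ hδ).1
  have hpow : (-1 : ℂ) ^ n ≠ 0 := zpow_ne_zero _ (by norm_num)
  have hg0 : ∀ z : ℂ, theta v z 1 1 = 0 ↔ g (z - Real.pi * n) = 0 := fun z => by
    rw [hg]
    simp [hpow]
  obtain ⟨δ, hδ, hδ0, huniq⟩ := exists_zero_of_near_sin hgd hgs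
  have hex : ∃ z : ℂ, ‖z - Real.pi * n‖ < 1 ∧ theta v z 1 1 = 0 :=
    ⟨Real.pi * n + δ, by simpa using hδ, by rw [hg0]; simpa using hδ0⟩
  have hspec : ‖eigC n v - Real.pi * n‖ < 1 ∧ theta v (eigC n v) 1 1 = 0 := by
    rw [eigC, dif_pos hex]
    exact hex.choose_spec
  have hall : ∀ z : ℂ, ‖z - Real.pi * n‖ < 1 → theta v z 1 1 = 0 → z - Real.pi * n = δ :=
    fun z hz hz0 => huniq _ hz ((hg0 z).1 hz0)
  have heq := hall _ hspec.1 hspec.2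
  have heq' : eigC n v = Real.pi * n + δ := by rw [← heq]; ring
  refine ⟨hspec.1, hspec.2, fun z hz hz0 => ?_, fun hd => ?_, ?_⟩
  · rw [heq', ← hall z hz hz0]; ring
  · refine deriv_ne_zero_of_near_sin hgd hgs hδ.le ?_
    have h1 : HasDerivAt (fun z => theta v z 1 1) 0 (Real.pi * n + δ) := by
      rw [← heq', ← hd]
      exact (hθ _).hasDerivAt
    have h2 := ((h1.comp_const_add (Real.pi * n : ℂ) δ).const_mul ((-1 : ℂ) ^ n)).deriv
    rw [mul_zero] at h2
    exact h2
  · have h1 := (hN n hn v hv δ (by linarith)).2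
    have h2 := norm_one_sub_cos_le hδ.le
    rw [heq']
    have e : (-1) ^ n * theta v (Real.pi * n + δ) 1 0 - 1 =
        ((-1) ^ n * theta v (Real.pi * n + δ) 1 0 - Complex.cos δ) - (1 - Complex.cos δ) := by ring
    rw [e]
    refine (norm_sub_le _ _).trans ?_
    linarith

theorem exists_continuation (u : Potential) : ∃ N : ℕ, ∀ n : ℤ, (N : ℤ) < |n| →
    AnalyticOnNhd ℂ (eigC n) (complexBall u) ∧ AnalyticOnNhd ℂ (normC n) (complexBall u) ∧
    (∀ w : Potential, complexify w ∈ complexBall u →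
      eigC n (complexify w) = nu w n ∧ normC n (complexify w) = normS w n) ∧
    ∀ v ∈ complexBall u, eigenvalues 1 1 v ∩ Metric.ball (nu₀ n : ℂ) 1 = {eigC n v} := by
  obtain ⟨N₁, hN₁⟩ := exists_eigC_spec u
  obtain ⟨N₂, hN₂⟩ := exists_abs_angle_sub_le u (D := ‖u‖ + 1) (η := 1 / 2)
    (by positivity) (by norm_num)
  refine ⟨max N₁ N₂, fun n hn => ?_⟩
  have hn1 : (N₁ : ℤ) < |n| := lt_of_le_of_lt (by exact_mod_cast le_max_left _ _) hn
  have hn2 : (N₂ : ℤ) < |n| := lt_of_le_of_lt (by exact_mod_cast le_max_right _ _) hn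
  have hspec := hN₁ n hn1
  have hopen : IsOpen (complexBall u) := Metric.isOpen_ball
  have han : AnalyticOnNhd ℂ (eigC n) (complexBall u) := fun v hv => by
    obtain ⟨h1, h2, h3, h4, h5⟩ := hspec v hv
    refine analyticAt_of_implicit (F := fun y => theta y.1 y.2 1 1) (analyticAt_theta_one_one _) h2
      h4 ?_
    have e1 : ∀ᶠ y : PotentialC × ℂ in 𝓝 (v, eigC n v), y.1 ∈ complexBall u :=
      continuous_fst.continuousAt.eventually_mem (hopen.mem_nhds hv)
    have e2 : ∀ᶠ y : PotentialC × ℂ in 𝓝 (v, eigC n v), ‖y.2 - Real.pi * n‖ < 1 := by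
      have hc : Continuous fun y : PotentialC × ℂ => ‖y.2 - Real.pi * n‖ := by fun_prop
      exact hc.continuousAt.eventually (gt_mem_nhds h1)
    filter_upwards [e1, e2] with y hy1 hy2 hy0
    exact (hspec y.1 hy1).2.2.1 y.2 hy2 hy0
  refine ⟨han, fun v hv => ?_, fun w hw => ?_, fun v hv => ?_⟩
  · obtain ⟨h1, h2, h3, h4, h5⟩ := hspec v hv
    have hA : AnalyticAt ℂ (fun v => (-1) ^ n * theta v (eigC n v) 1 0) v :=
      analyticAt_const.mul (AnalyticAt.comp (g := fun y : PotentialC × ℂ => theta y.1 y.2 1 0)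
        (f := fun v => (v, eigC n v)) (analyticAt_theta_one_zero (v, eigC n v))
        (analyticAt_id.prod (han v hv)))
    refine (hA.clog ?_).neg
    refine Complex.mem_slitPlane_of_norm_lt_one (z := _ - 1) ?_ |> fun h => by simpa using h
    exact h5.trans_lt (by norm_num)
  · have hball := hspec _ hw
    have hwu : ‖w - u‖ < (1 / 4 ^ 4) * Real.exp (-3 * ‖u‖) := by
      rw [← norm_complexify, complexify_sub]
      exact norm_sub_lt_of_mem hw
    have hwn : ‖w‖ ≤ ‖u‖ + 1 := by
      rw [← norm_complexify w]
      exact norm_le_of_mem hw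
    have hν := (abs_nuSeq_sub_le w n).trans hwn
    -- It must be shown that ν_n(w) lies within 1 of πn, with N independent of w. The angle of w is
    -- within 1/256 of that of u, and the angle of u is within 1/2 of λ for large |n|; the range D =
    -- ‖u‖ + 1 covers the a priori position of ν_n(w).
    have h1 := hN₂ n hn2 _ hν
    have h2 := abs_angle_sub_le w u (nuSeq w n) (nuSeq w n) (right_mem_Icc.2 zero_le_one)
    have h3 : ‖w - u‖ * Real.exp (2 * ‖u‖) ≤ 1 / 256 := by
      calc _ ≤ (1 / 4 ^ 4) * Real.exp (-3 * ‖u‖) * Real.exp (2 * ‖u‖) := by gcongr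
        _ = 1 / 256 * Real.exp (-‖u‖) := by
          rw [mul_assoc, ← Real.exp_add]; ring_nf
        _ ≤ 1 / 256 := by
          have : Real.exp (-‖u‖) ≤ 1 := Real.exp_le_one_iff.2 (by linarith [norm_nonneg u])
          linarith
    rw [sub_self, abs_zero, zero_add, angle_nuSeq] at h2
    have h4 : |nuSeq w n - Real.pi * n| < 1 := by
      have e : nuSeq w n - Real.pi * n = -((Real.pi * n - angle u (nuSeq w n) 1) +
          (angle u (nuSeq w n) 1 - nuSeq w n)) := by ring
      rw [e, abs_neg]
      refine (abs_add_le _ _).trans_lt ?_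
      linarith
    have heig : eigC n (complexify w) = nu w n := by
      rw [nu_eq]
      refine (hball.2.2.1 _ ?_ ?_).symm
      · rw [← Real.norm_eq_abs, ← Complex.norm_real] at h4
        simpa using h4
      · rw [← mem_eigenvalues_iff, ← range_nuSeq]
        exact ⟨n, rfl⟩
    refine ⟨heig, ?_⟩
    rw [normC, heig, nu_eq, theta_one_zero_nuSeq, normS_eq]
    push_cast
    rw [← mul_assoc, neg_one_zpow_mul_self, one_mul, Complex.ofReal_log (norm_nonneg _)]
  · obtain ⟨h1, h2, h3, -⟩ := hspec v hv
    have hnu : ((nu₀ n : ℝ) : ℂ) = Real.pi * n := by simp [nu₀]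
    ext z
    rw [mem_inter_iff, mem_eigenvalues_iff, Metric.mem_ball, dist_eq_norm, hnu, mem_singleton_iff]
    exact ⟨fun h => h3 z h.2 h.1, fun h => by rw [h]; exact ⟨h2, h1⟩⟩

end Continuation

/-! ### Remainders -/

section Remainders

open Complex (I)

theorem norm_one_sub_cos_le_sq {δ : ℂ} (hδ : ‖δ‖ ≤ 1) : ‖Complex.cos δ - 1‖ ≤ ‖δ‖ ^ 2 := by
  have h := Complex.cos_bound hδ
  have h4 : ‖δ‖ ^ 4 ≤ ‖δ‖ ^ 2 := pow_le_pow_of_le_one (norm_nonneg _) hδ (by norm_num)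
  have e : Complex.cos δ - 1 = (Complex.cos δ - (1 - δ ^ 2 / 2)) - δ ^ 2 / 2 := by ring
  rw [e]
  refine (norm_sub_le _ _).trans ?_
  rw [norm_div, norm_pow, Complex.norm_ofNat]
  nlinarith [sq_nonneg ‖δ‖]

theorem norm_sub_sin_le_sq {δ : ℂ} (hδ : ‖δ‖ ≤ 1) : ‖δ - Complex.sin δ‖ ≤ ‖δ‖ ^ 2 / 5 := by
  have h := Complex.sin_bound hδ
  have h3 : ‖δ‖ ^ 3 ≤ ‖δ‖ ^ 2 := pow_le_pow_of_le_one (norm_nonneg _) hδ (by norm_num)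
  have h5 : ‖δ‖ ^ 5 ≤ ‖δ‖ ^ 2 := pow_le_pow_of_le_one (norm_nonneg _) hδ (by norm_num)
  have e : δ - Complex.sin δ = δ ^ 3 / 6 - (Complex.sin δ - (δ - δ ^ 3 / 6)) := by ring
  rw [e]
  refine (norm_sub_le _ _).trans ?_
  rw [norm_div, norm_pow, Complex.norm_ofNat]
  nlinarith [sq_nonneg ‖δ‖]

theorem norm_cexp_sub_one_le_three {c : ℂ} (hc : ‖c‖ ≤ 1) : ‖Complex.exp c - 1‖ ≤ 3 * ‖c‖ := by
  have h := norm_cexp_sub_one_le c hc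
  have h1 := Real.exp_one_lt_d9
  nlinarith [norm_nonneg c]

theorem norm_cexp_le_three {c : ℂ} (hc : ‖c‖ ≤ 1) : ‖Complex.exp c‖ ≤ 3 := by
  have h1 := Real.exp_one_lt_d9
  rw [Complex.norm_exp]
  have := Real.exp_le_exp.2 ((Complex.re_le_norm c).trans hc)
  linarith

/-- Second order expansion of a zero `δ` of `e^{iδ}(1 + β) - e^{-iδ}(1 + α)`. -/
theorem zero_expansion {α β δ E : ℂ} {s S : ℝ} (hδ : ‖δ‖ ≤ 1)
    (hα : Complex.exp (-(I * δ)) * (1 + α) = E) (hβ : Complex.exp (I * δ) * (1 + β) = E)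
    (hαs : ‖α‖ ≤ s) (hβs : ‖β‖ ≤ s) (hsS : s ≤ S) (hE : ‖E - 1‖ ≤ 7 / 10) :
    ‖δ‖ ≤ 4 * s ∧ ‖δ - -(I / 2) * (α - β)‖ ≤ 16 * s ^ 2 ∧
      ‖-Complex.log E - -(1 / 2) * (α + β)‖ ≤ (28 + 2 * (1 + 28 * S) ^ 2) * s ^ 2 := by
  have hs0 : 0 ≤ s := (norm_nonneg _).trans hαs
  have hI : ‖I * δ‖ ≤ 1 := by simpa using hδ
  have hI' : ‖-(I * δ)‖ ≤ 1 := by simpa using hδ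
  have hn : ‖I * δ‖ = ‖δ‖ := by simp
  have hn' : ‖-(I * δ)‖ = ‖δ‖ := by simp
  have e1 := norm_cexp_sub_one_le_three hI
  have e2 := norm_cexp_sub_one_le_three hI'
  have e3 := norm_cexp_le_three hI
  have e4 := norm_cexp_le_three hI'
  rw [hn] at e1
  rw [hn'] at e2
  -- Half the difference and half the sum of the two hypotheses give sin δ and E - cos δ as linear
  -- expressions in α and β.
  have hsin : Complex.sin δ =
      -(I / 2) * (Complex.exp (-(I * δ)) * α - Complex.exp (I * δ) * β) := by
    rw [Complex.sin, show -δ * I = -(I * δ) by ring, show δ * I = I * δ by ring]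
    linear_combination (-I / 2) * hβ + I / 2 * hα
  have hcos : E = Complex.cos δ +
      (Complex.exp (-(I * δ)) * α + Complex.exp (I * δ) * β) / 2 := by
    rw [Complex.cos, show -δ * I = -(I * δ) by ring, show δ * I = I * δ by ring]
    linear_combination -hβ / 2 - hα / 2
  have hI2 : ‖-(I / 2)‖ = 1 / 2 := by simp
  have hsinle : ‖Complex.sin δ‖ ≤ 3 * s := by
    rw [hsin, norm_mul, hI2]
    have h1 : ‖Complex.exp (-(I * δ)) * α‖ ≤ 3 * s := by rw [norm_mul]; gcongr
    have h2 : ‖Complex.exp (I * δ) * β‖ ≤ 3 * s := by rw [norm_mul]; gcongr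
    linarith [norm_sub_le (Complex.exp (-(I * δ)) * α) (Complex.exp (I * δ) * β)]
  have hds := norm_sub_sin_le_sq hδ
  -- Since |δ| ≤ 1, the bound |δ - sin δ| ≤ |δ|²/5 allows absorption: (4/5)|δ| ≤ |sin δ| ≤ 3s.
  have hδs : ‖δ‖ ≤ 4 * s := by
    have h1 := norm_sub_norm_le δ (Complex.sin δ)
    nlinarith [norm_nonneg δ]
  have hδsq : ‖δ‖ ^ 2 ≤ 16 * s ^ 2 := by
    calc ‖δ‖ ^ 2 ≤ (4 * s) ^ 2 := by gcongr
      _ = 16 * s ^ 2 := by ring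
  have p1 : ‖(Complex.exp (-(I * δ)) - 1) * α‖ ≤ 12 * s ^ 2 := by
    rw [norm_mul]
    calc _ ≤ (3 * (4 * s)) * s := by gcongr; exact e2.trans (by gcongr)
      _ = 12 * s ^ 2 := by ring
  have p2 : ‖(Complex.exp (I * δ) - 1) * β‖ ≤ 12 * s ^ 2 := by
    rw [norm_mul]
    calc _ ≤ (3 * (4 * s)) * s := by gcongr; exact e1.trans (by gcongr)
      _ = 12 * s ^ 2 := by ring
  refine ⟨hδs, ?_, ?_⟩
  · have e : δ - -(I / 2) * (α - β) = (δ - Complex.sin δ) +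
        -(I / 2) * ((Complex.exp (-(I * δ)) - 1) * α - (Complex.exp (I * δ) - 1) * β) := by
      linear_combination hsin
    rw [e]
    refine (norm_add_le _ _).trans ?_
    rw [norm_mul, hI2]
    linarith [norm_sub_le ((Complex.exp (-(I * δ)) - 1) * α) ((Complex.exp (I * δ) - 1) * β),
      sq_nonneg s]
  · have hw : ‖E - 1 - (α + β) / 2‖ ≤ 28 * s ^ 2 := by
      have e : E - 1 - (α + β) / 2 = (Complex.cos δ - 1) +
          ((Complex.exp (-(I * δ)) - 1) * α + (Complex.exp (I * δ) - 1) * β) / 2 := by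
        linear_combination hcos
      rw [e]
      refine (norm_add_le _ _).trans ?_
      rw [norm_div, Complex.norm_ofNat]
      linarith [norm_add_le ((Complex.exp (-(I * δ)) - 1) * α) ((Complex.exp (I * δ) - 1) * β),
        norm_one_sub_cos_le_sq hδ]
    -- The bound S turns the quadratic error 28s² into a linear one, so that |E - 1|² is again of
    -- order s².
    have hE1 : ‖E - 1‖ ≤ (1 + 28 * S) * s := by
      have e : E - 1 = (E - 1 - (α + β) / 2) + (α + β) / 2 := by ring
      rw [e]
      refine (norm_add_le _ _).trans ?_
      have : ‖(α + β) / 2‖ ≤ s := by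
        rw [norm_div, Complex.norm_ofNat]
        linarith [norm_add_le α β]
      nlinarith
    have hlog := Complex.norm_log_one_add_sub_self_le (z := E - 1) (by linarith)
    rw [add_sub_cancel] at hlog
    have hinv : (1 - ‖E - 1‖)⁻¹ ≤ 4 := by
      rw [inv_le_comm₀ (by linarith) (by norm_num)]
      linarith
    have hlog' : ‖Complex.log E - (E - 1)‖ ≤ 2 * ((1 + 28 * S) * s) ^ 2 := by
      refine hlog.trans ?_
      calc ‖E - 1‖ ^ 2 * (1 - ‖E - 1‖)⁻¹ / 2 ≤ ((1 + 28 * S) * s) ^ 2 * 4 / 2 := by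
            have : 0 ≤ (1 - ‖E - 1‖)⁻¹ := inv_nonneg.2 (by linarith)
            gcongr
        _ = _ := by ring
    have e : -Complex.log E - -(1 / 2) * (α + β) =
        -((Complex.log E - (E - 1)) + (E - 1 - (α + β) / 2)) := by ring
    rw [e, norm_neg]
    refine (norm_add_le _ _).trans ((add_le_add hlog' hw).trans (le_of_eq ?_))
    ring

theorem fSize_le {f : ℝ → ℂ} (hf : MemLp f 2 μ₀) (n : ℤ) : fSize f n ≤ 2 * L2n f := by
  have h := sum_sq_fSize_le hf {n}
  rw [Finset.sum_singleton] at h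
  have h0 := L2n_nonneg f
  exact (abs_le_of_sq_le_sq' (by linarith [mul_pow 2 (L2n f) 2]) (by positivity)).2

theorem norm_T0_one_le {f : ℝ → ℂ} (hf : MemLp f 2 μ₀) (n : ℤ) : ‖T0 f n 1‖ ≤ 2 * L2n f :=
  le_trans (le_add_of_nonneg_right (L2n_nonneg _)) (fSize_le hf n)

theorem J₁_mulVec_zero (y : Fin 2 → ℂ) : J₁.mulVec y 0 = y 0 := by
  simp [J₁, Matrix.mulVec, dotProduct, Fin.sum_univ_two]

theorem J₁_mulVec_one (y : Fin 2 → ℂ) : J₁.mulVec y 1 = -y 1 := by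
  simp [J₁, Matrix.mulVec, dotProduct, Fin.sum_univ_two]

theorem expJ_mulVec_zero (t : ℝ) (y : Fin 2 → ℂ) :
    (expJ t).mulVec y 0 = Real.cos t * y 0 + Real.sin t * y 1 := by
  simp [expJ, Matrix.mulVec, dotProduct, Fin.sum_univ_two]

theorem expJ_mulVec_one (t : ℝ) (y : Fin 2 → ℂ) :
    (expJ t).mulVec y 1 = -Real.sin t * y 0 + Real.cos t * y 1 := by
  simp [expJ, Matrix.mulVec, dotProduct, Fin.sum_univ_two]

/-- The rotation e^{2πnxJ} is diagonal in the eigenbasis of J. The resulting combinations of Fourier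
coefficients are those in which α and β occur in `zero_expansion`. -/
theorem fourier_eq (v : PotentialC) (n : ℤ) :
    J₁.mulVec (fourier (fun x => v x) n) 0 =
      -(I / 2) * (T0 (qFun v) n 1 - T0 (pFun v) (-n) 1) ∧
    J₁.mulVec (fourier (fun x => v x) n) 1 =
      -(1 / 2) * (T0 (qFun v) n 1 + T0 (pFun v) (-n) 1) := by
  have hq := intervalIntegrable_freq (memLp_intervalIntegrable (memLp_qFun v)) n
  have hp := intervalIntegrable_freq (memLp_intervalIntegrable (memLp_pFun v)) (-n)
  have hE : ∀ x : ℝ, Complex.exp (2 * Real.pi * I * n * x) =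
      Real.cos (2 * Real.pi * n * x) + Real.sin (2 * Real.pi * n * x) * I := fun x => by
    rw [show (2 * Real.pi * I * n * x : ℂ) = ((2 * Real.pi * n * x : ℝ) : ℂ) * I by
      push_cast; ring, Complex.exp_mul_I]
    push_cast
    rfl
  have hE' : ∀ x : ℝ, Complex.exp (2 * Real.pi * I * (-n : ℤ) * x) =
      Real.cos (2 * Real.pi * n * x) - Real.sin (2 * Real.pi * n * x) * I := fun x => by
    rw [show (2 * Real.pi * I * (-n : ℤ) * x : ℂ) = ((-(2 * Real.pi * n * x) : ℝ) : ℂ) * I by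
      push_cast; ring, Complex.exp_mul_I, ← Complex.ofReal_cos, ← Complex.ofReal_sin, Real.cos_neg,
      Real.sin_neg]
    push_cast
    ring
  constructor
  · rw [J₁_mulVec_zero, fourier, T0, T0, ← intervalIntegral.integral_sub hq hp,
      ← intervalIntegral.integral_const_mul, ← setIntegral_eq_intervalIntegral]
    refine integral_congr_ae (ae_of_all _ fun x => ?_)
    simp only
    rw [hE, hE', expJ_mulVec_zero, qFun, pFun]
    linear_combination ((v x 0) * Real.cos (2 * Real.pi * n * x) +
      (v x 1) * Real.sin (2 * Real.pi * n * x)) * Complex.I_sq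
  · rw [J₁_mulVec_one, fourier, T0, T0, ← intervalIntegral.integral_add hq hp,
      ← intervalIntegral.integral_const_mul, ← setIntegral_eq_intervalIntegral, ← integral_neg]
    refine integral_congr_ae (ae_of_all _ fun x => ?_)
    simp only
    rw [hE, hE', expJ_mulVec_one, qFun, pFun]
    linear_combination ((v x 0) * Real.sin (2 * Real.pi * n * x)) * Complex.I_sq

end Remainders

/-! ### Remainder estimates and the theorem for the Neumann eigenvalues. -/

section Asymptotics

open Complex (I)

theorem cexp_I_mul_pi_add (n : ℤ) (δ : ℂ) :
    Complex.exp (I * (Real.pi * n + δ)) = (-1) ^ n * Complex.exp (I * δ) := by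
  rw [mul_add, Complex.exp_add, show I * (Real.pi * n) = n * (Real.pi * I) by ring,
    Complex.exp_int_mul, Complex.exp_pi_mul_I]

theorem cexp_neg_I_mul_pi_add (n : ℤ) (δ : ℂ) :
    Complex.exp (-(I * (Real.pi * n + δ))) = (-1) ^ n * Complex.exp (-(I * δ)) := by
  rw [Complex.exp_neg, cexp_I_mul_pi_add, mul_inv, ← Complex.exp_neg,
    inv_eq_of_mul_eq_one_left (neg_one_zpow_mul_self n)]

/-- The summable part of the remainder. -/
noncomputable def remTerm (v : PotentialC) (n : ℤ) : ℝ :=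
  (fSize (qFun v) n + fSize (pFun v) (-n)) ^ 2 +
    ((∫ t in (0 : ℝ)..1, ‖pFun v t‖ * ‖T0 (qFun v) n t‖ ^ 2) +
      ∫ t in (0 : ℝ)..1, ‖qFun v t‖ * ‖T0 (pFun v) (-n) t‖ ^ 2)

theorem integral_mul_sq_nonneg (p f : ℝ → ℂ) (n : ℤ) :
    0 ≤ ∫ t in (0 : ℝ)..1, ‖p t‖ * ‖T0 f n t‖ ^ 2 :=
  intervalIntegral.integral_nonneg zero_le_one fun _ _ => by positivity

theorem remTerm_nonneg (v : PotentialC) (n : ℤ) : 0 ≤ remTerm v n :=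
  add_nonneg (sq_nonneg _) (add_nonneg (integral_mul_sq_nonneg _ _ _)
    (integral_mul_sq_nonneg _ _ _))

theorem add_sq_add_le {C s r f i j : ℝ} (hC : 0 ≤ C) (hs : 0 ≤ s) (hr : r ≤ 4 * (2 * C * s))
    (hf : 0 ≤ f) (hfs : f ≤ s) (hi : 0 ≤ i) (hj : 0 ≤ j) :
    r * s + f ^ 2 + i ≤ (8 * C + 1) * (s ^ 2 + (i + j)) := by
  have h4 : r * s ≤ 4 * (2 * C * s) * s := by gcongr
  have h5 : f ^ 2 ≤ s ^ 2 := by gcongr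
  nlinarith [mul_nonneg hC (add_nonneg hi hj)]

-- At an eigenvalue a(1) = b(1) = ϑ₁(1), so the gauged solutions at 1, written as 1 + α and 1 + β,
-- satisfy the two equations of `zero_expansion`. The resulting |δ| = O(s) makes the terms |δ|s of
-- the expansions of α and β quadratic, hence bounded by `remTerm`.
set_option maxHeartbeats 400000 in
theorem exists_remainder_le {K : ℝ} (hK : 0 ≤ K) : ∃ C : ℝ, 0 ≤ C ∧ ∀ v : PotentialC, ‖v‖ ≤ K →
    ∀ (n : ℤ) (z : ℂ), ‖z - Real.pi * n‖ ≤ 1 → theta v z 1 1 = 0 →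
      ‖(-1) ^ n * theta v z 1 0 - 1‖ ≤ 7 / 10 →
      ‖z - Real.pi * n - J₁.mulVec (fourier (fun x => v x) n) 0‖ ≤
        (‖D0 (qFun v) (pFun v) n‖ + ‖D0 (pFun v) (qFun v) (-n)‖) + C * remTerm v n ∧
      ‖-Complex.log ((-1) ^ n * theta v z 1 0) - J₁.mulVec (fourier (fun x => v x) n) 1‖ ≤
        (‖D0 (qFun v) (pFun v) n‖ + ‖D0 (pFun v) (qFun v) (-n)‖) + C * remTerm v n := by
  obtain ⟨C, hC, h⟩ := sol_expansion (D := 1) zero_le_one hK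
  set S : ℝ := 2 * C * (8 * K) with hS
  have hS0 : 0 ≤ S := by positivity
  set C' : ℝ := (16 + (28 + 2 * (1 + 28 * S) ^ 2)) * (4 * C ^ 2) + C * (8 * C + 1) with hC'
  refine ⟨C', by positivity, fun v hv n z hz hθ hE => ?_⟩
  set δ : ℂ := z - Real.pi * n with hδ
  have hzδ : z = Real.pi * n + δ := by rw [hδ]; ring
  obtain ⟨hAB, h2a, h2b⟩ := h v hv n δ z hz hzδ
  obtain ⟨hA, hB⟩ := hAB 1 (right_mem_Icc.2 zero_le_one)
  rw [Complex.ofReal_one, mul_one] at hA hB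
  set q := qFun v with hq
  set p := pFun v with hp
  have hTq : ‖T0 q n 1‖ ≤ fSize q n := le_add_of_nonneg_right (L2n_nonneg _)
  have hTp : ‖T0 p (-n) 1‖ ≤ fSize p (-n) := le_add_of_nonneg_right (L2n_nonneg _)
  have hfq := fSize_nonneg q n
  have hfp := fSize_nonneg p (-n)
  have hfqK : fSize q n ≤ 4 * K := by
    linarith [fSize_le (memLp_qFun v) n, L2n_qFun_le v]
  have hfpK : fSize p (-n) ≤ 4 * K := by
    linarith [fSize_le (memLp_pFun v) (-n), L2n_pFun_le v]
  set s : ℝ := fSize q n + fSize p (-n) with hs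
  have hs0 : 0 ≤ s := add_nonneg hfq hfp
  set α : ℂ := Complex.exp (I * z) * aSol v z 1 - 1 with hα
  set β : ℂ := Complex.exp (-(I * z)) * bSol v z 1 - 1 with hβ
  have hαs : ‖α‖ ≤ 2 * C * s := by
    refine hA.trans ?_
    calc C * (‖T0 q n 1‖ + fSize q n) ≤ C * (2 * s) := by gcongr; linarith
      _ = _ := by ring
  have hβs : ‖β‖ ≤ 2 * C * s := by
    refine hB.trans ?_
    calc C * (‖T0 p (-n) 1‖ + fSize p (-n)) ≤ C * (2 * s) := by gcongr; linarith
      _ = _ := by ring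
  have hsS : 2 * C * s ≤ S := by rw [hS]; gcongr; linarith
  have hab : aSol v z 1 = bSol v z 1 := by
    rw [theta_one_one] at hθ
    have : I * (aSol v z 1 - bSol v z 1) = 0 := by linear_combination 2 * hθ
    exact sub_eq_zero.1 ((mul_eq_zero.1 this).resolve_left Complex.I_ne_zero)
  have hθa : theta v z 1 0 = aSol v z 1 := by rw [theta_one_zero, ← hab]; ring
  have hpow := neg_one_zpow_mul_self n
  have hmulI : Complex.exp (-(I * δ)) * Complex.exp (I * δ) = 1 := by
    rw [← Complex.exp_add]; simp
  have e1 : Complex.exp (-(I * δ)) * (1 + α) = (-1) ^ n * theta v z 1 0 := by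
    rw [hθa, hα, hzδ, cexp_I_mul_pi_add]
    linear_combination (-1) ^ n * aSol v (Real.pi * n + δ) 1 * hmulI
  have e2 : Complex.exp (I * δ) * (1 + β) = (-1) ^ n * theta v z 1 0 := by
    rw [hθa, hab, hβ, hzδ, cexp_neg_I_mul_pi_add]
    linear_combination (-1) ^ n * bSol v (Real.pi * n + δ) 1 * hmulI
  obtain ⟨hδs, r1, r2⟩ := zero_expansion hz e1 e2 hαs hβs hsS hE
  set Iq : ℝ := ∫ t in (0 : ℝ)..1, ‖p t‖ * ‖T0 q n t‖ ^ 2 with hIq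
  set Ip : ℝ := ∫ t in (0 : ℝ)..1, ‖q t‖ * ‖T0 p (-n) t‖ ^ 2 with hIp
  have hIq0 : 0 ≤ Iq := integral_mul_sq_nonneg _ _ _
  have hIp0 : 0 ≤ Ip := integral_mul_sq_nonneg _ _ _
  have hrem : remTerm v n = s ^ 2 + (Iq + Ip) := rfl
  have ha2 : ‖α - T0 q n 1‖ ≤ ‖D0 q p n‖ + C * (8 * C + 1) * remTerm v n := by
    have e : α - T0 q n 1 = D0 q p n + (α - T0 q n 1 - D0 q p n) := by ring
    rw [e]
    refine (norm_add_le _ _).trans ?_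
    gcongr
    refine h2a.trans ?_
    have h3 : ‖δ‖ * s + fSize q n ^ 2 + Iq ≤ (8 * C + 1) * remTerm v n := by
      rw [hrem]
      exact add_sq_add_le hC hs0 hδs hfq (le_add_of_nonneg_right hfp) hIq0 hIp0
    calc _ ≤ C * ((8 * C + 1) * remTerm v n) := by gcongr
      _ = _ := by ring
  have hb2 : ‖β - T0 p (-n) 1‖ ≤ ‖D0 p q (-n)‖ + C * (8 * C + 1) * remTerm v n := by
    have e : β - T0 p (-n) 1 = D0 p q (-n) + (β - T0 p (-n) 1 - D0 p q (-n)) := by ring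
    rw [e]
    refine (norm_add_le _ _).trans ?_
    gcongr
    refine h2b.trans ?_
    have h3 : ‖δ‖ * s + fSize p (-n) ^ 2 + Ip ≤ (8 * C + 1) * remTerm v n := by
      rw [hrem, add_comm Iq]
      exact add_sq_add_le hC hs0 hδs hfp (le_add_of_nonneg_left hfq) hIp0 hIq0
    calc _ ≤ C * ((8 * C + 1) * remTerm v n) := by gcongr
      _ = _ := by ring
  have hsq : s ^ 2 ≤ remTerm v n := by rw [hrem]; linarith
  have hfin : ∀ k : ℝ, 0 ≤ k → k ≤ 16 + (28 + 2 * (1 + 28 * S) ^ 2) →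
      k * (2 * C * s) ^ 2 + 1 / 2 * (‖α - T0 q n 1‖ + ‖β - T0 p (-n) 1‖) ≤
        (‖D0 q p n‖ + ‖D0 p q (-n)‖) + C' * remTerm v n := by
    intro k hk0 hk
    have h5 : k * (2 * C * s) ^ 2 ≤
        (16 + (28 + 2 * (1 + 28 * S) ^ 2)) * (4 * C ^ 2) * remTerm v n := by
      calc k * (2 * C * s) ^ 2 = k * (4 * C ^ 2) * s ^ 2 := by ring
        _ ≤ _ := by gcongr
    have h6 := norm_nonneg (D0 q p n)
    have h7 := norm_nonneg (D0 p q (-n))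
    rw [hC', add_mul]
    linarith
  obtain ⟨hM0, hM1⟩ := fourier_eq v n
  constructor
  · rw [hM0]
    have e : δ - -(I / 2) * (T0 q n 1 - T0 p (-n) 1) = (δ - -(I / 2) * (α - β)) +
        (-(I / 2) * (α - T0 q n 1) - -(I / 2) * (β - T0 p (-n) 1)) := by ring
    rw [e]
    have hI2 : ‖-(I / 2)‖ = 1 / 2 := by simp
    refine (norm_add_le _ _).trans ((add_le_add r1 (norm_sub_le _ _)).trans ?_)
    rw [norm_mul, norm_mul, hI2, ← mul_add]
    exact hfin 16 (by norm_num) (by nlinarith [sq_nonneg (1 + 28 * S)])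
  · rw [hM1]
    have e : -Complex.log ((-1) ^ n * theta v z 1 0) - -(1 / 2) * (T0 q n 1 + T0 p (-n) 1) =
        (-Complex.log ((-1) ^ n * theta v z 1 0) - -(1 / 2) * (α + β)) -
          (1 / 2 * (α - T0 q n 1) + 1 / 2 * (β - T0 p (-n) 1)) := by ring
    rw [e]
    have hh : ‖(1 / 2 : ℂ)‖ = 1 / 2 := by simp
    refine (norm_sub_le _ _).trans ((add_le_add r2 (norm_add_le _ _)).trans ?_)
    rw [norm_mul, norm_mul, hh, ← mul_add]
    exact hfin _ (by positivity) (by linarith)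

theorem sum_remTerm_le {K : ℝ} (hK : 0 ≤ K) {v : PotentialC} (hv : ‖v‖ ≤ K) (F : Finset ℤ) :
    ∑ n ∈ F, remTerm v n ≤ 64 * K ^ 2 + 16 * K ^ 3 := by
  have hq := memLp_qFun v
  have hp := memLp_pFun v
  have hq0 := L2n_nonneg (qFun v)
  have hp0 := L2n_nonneg (pFun v)
  have hqK : L2n (qFun v) ≤ 2 * K := (L2n_qFun_le v).trans (by linarith)
  have hpK : L2n (pFun v) ≤ 2 * K := (L2n_pFun_le v).trans (by linarith)
  have hqK2 : L2n (qFun v) ^ 2 ≤ 4 * K ^ 2 := by nlinarith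
  have hpK2 : L2n (pFun v) ^ 2 ≤ 4 * K ^ 2 := by nlinarith
  have h1 := sum_sq_fSize_le hq F
  have h2 := sum_neg_le (f := fun n => fSize (pFun v) n ^ 2) (sum_sq_fSize_le hp) F
  have h3 := sum_integral_mul_sq_le hq hp F
  have h4 := sum_neg_le (f := fun n => ∫ t in (0 : ℝ)..1, ‖qFun v t‖ * ‖T0 (pFun v) n t‖ ^ 2)
    (sum_integral_mul_sq_le hp hq) F
  have h5 : ∑ n ∈ F, (fSize (qFun v) n + fSize (pFun v) (-n)) ^ 2 ≤
      ∑ n ∈ F, (2 * fSize (qFun v) n ^ 2 + 2 * fSize (pFun v) (-n) ^ 2) :=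
    Finset.sum_le_sum fun n _ => by nlinarith [sq_nonneg (fSize (qFun v) n - fSize (pFun v) (-n))]
  rw [Finset.sum_add_distrib, ← Finset.mul_sum, ← Finset.mul_sum] at h5
  have h6 : L2n (pFun v) * L2n (qFun v) ^ 2 ≤ 8 * K ^ 3 := by
    calc _ ≤ 2 * K * (4 * K ^ 2) := by gcongr
      _ = _ := by ring
  have h7 : L2n (qFun v) * L2n (pFun v) ^ 2 ≤ 8 * K ^ 3 := by
    calc _ ≤ 2 * K * (4 * K ^ 2) := by gcongr
      _ = _ := by ring
  simp only [remTerm, Finset.sum_add_distrib]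
  linarith

theorem exists_sum_remainder_le {K d : ℝ} (hK : 0 ≤ K) (hd : 1 < d) (C : ℝ) (hC : 0 ≤ C) :
    ∃ R : ℝ, 0 ≤ R ∧ ∀ v : PotentialC, ‖v‖ ≤ K → ∀ F : Finset ℤ,
      ∑ n ∈ F, ((‖D0 (qFun v) (pFun v) n‖ + ‖D0 (pFun v) (qFun v) (-n)‖) +
        C * remTerm v n) ^ d ≤ R := by
  obtain ⟨R, hR⟩ := sum_D0_rpow_le (d := d) (K := 2 * K) hd
  have hd0 : 0 ≤ d := by linarith
  -- The absolute value supplies the sign of the constant, which `sum_D0_rpow_le` does not record.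
  refine ⟨|2 ^ d * (2 ^ d * (R + R) + (C * (64 * K ^ 2 + 16 * K ^ 3)) ^ d)|, abs_nonneg _,
    fun v hv F => ?_⟩
  have hqK : L2n (qFun v) ≤ 2 * K := (L2n_qFun_le v).trans (by linarith)
  have hpK : L2n (pFun v) ≤ 2 * K := (L2n_pFun_le v).trans (by linarith)
  have h1 := hR _ _ (memLp_qFun v) (memLp_pFun v) hqK hpK F
  have h2 := sum_neg_le (f := fun n => ‖D0 (pFun v) (qFun v) n‖ ^ d)
    (hR _ _ (memLp_pFun v) (memLp_qFun v) hpK hqK) F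
  have h3 := sum_rpow_add_le (F := F) hd0 (fun n _ => by positivity) (fun n _ => le_rfl)
    (fun n _ => norm_nonneg (D0 (qFun v) (pFun v) n))
    (fun n _ => norm_nonneg (D0 (pFun v) (qFun v) (-n))) h1 h2
  have h4 : ∑ n ∈ F, (C * remTerm v n) ^ d ≤ (C * (64 * K ^ 2 + 16 * K ^ 3)) ^ d := by
    refine sum_rpow_le_rpow hd.le (fun n _ => mul_nonneg hC (remTerm_nonneg v n)) ?_
    rw [← Finset.mul_sum]
    exact mul_le_mul_of_nonneg_left (sum_remTerm_le hK hv F) hC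
  refine le_trans (sum_rpow_add_le (F := F) hd0 (fun n _ => ?_) (fun n _ => le_rfl)
    (fun n _ => by positivity) (fun n _ => mul_nonneg hC (remTerm_nonneg v n)) h3 h4)
    (le_abs_self _)
  have := mul_nonneg hC (remTerm_nonneg v n)
  positivity

theorem norm_fourier_le (v : PotentialC) (n : ℤ) (k : Fin 2) :
    ‖J₁.mulVec (fourier (fun x => v x) n) k‖ ≤ 4 * ‖v‖ := by
  have h1 := norm_T0_one_le (memLp_qFun v) n
  have h2 := norm_T0_one_le (memLp_pFun v) (-n)
  have h3 := L2n_qFun_le v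
  have h4 := L2n_pFun_le v
  obtain ⟨hM0, hM1⟩ := fourier_eq v n
  fin_cases k
  · change ‖J₁.mulVec (fourier (fun x => v x) n) 0‖ ≤ _
    have hI2 : ‖-(I / 2)‖ = 1 / 2 := by simp
    rw [hM0, norm_mul, hI2]
    linarith [norm_sub_le (T0 (qFun v) n 1) (T0 (pFun v) (-n) 1)]
  · change ‖J₁.mulVec (fourier (fun x => v x) n) 1‖ ≤ _
    have hI2 : ‖(-(1 / 2) : ℂ)‖ = 1 / 2 := by simp
    rw [hM1, norm_mul, hI2]
    linarith [norm_add_le (T0 (qFun v) n 1) (T0 (pFun v) (-n) 1)]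

theorem card_filter_abs_le (F : Finset ℤ) (N : ℕ) :
    ((F.filter fun n => ¬(N : ℤ) < |n|).card : ℝ) ≤ 2 * N + 1 := by
  have h : F.filter (fun n => ¬(N : ℤ) < |n|) ⊆ Finset.Icc (-(N : ℤ)) N := fun n hn => by
    rw [Finset.mem_filter, not_lt] at hn
    exact Finset.mem_Icc.2 (abs_le.1 hn.2)
  have h2 := Finset.card_le_card h
  rw [Int.card_Icc] at h2
  have h3 : (F.filter fun n => ¬(N : ℤ) < |n|).card ≤ 2 * N + 1 := by omega
  exact_mod_cast h3

theorem uniformAsymptotics_nu : UniformAsymptotics 1 1 nu₀ nu normS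
    (fun v n => J₁.mulVec (fourier (fun x => v x) n)) := by
  refine ⟨fun w => nu_eq w ▸ isEigenvalueSeq_nuSeq w, fun u => ?_⟩
  obtain ⟨N₁, hN₁⟩ := exists_continuation u
  obtain ⟨N₂, hN₂⟩ := exists_eigC_spec u
  have hle1 : ∀ n : ℤ, ((max N₁ N₂ : ℕ) : ℤ) < |n| → (N₁ : ℤ) < |n| := fun n hn =>
    lt_of_le_of_lt (by exact_mod_cast le_max_left _ _) hn
  have hle2 : ∀ n : ℤ, ((max N₁ N₂ : ℕ) : ℤ) < |n| → (N₂ : ℤ) < |n| := fun n hn =>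
    lt_of_le_of_lt (by exact_mod_cast le_max_right _ _) hn
  refine ⟨max N₁ N₂, eigC, normC, fun n hn => hN₁ n (hle1 n hn), fun d hd1 hd2 => ?_⟩
  set K : ℝ := ‖u‖ + 1 with hK
  have hK0 : 0 ≤ K := by positivity
  obtain ⟨C, hC, hrem⟩ := exists_remainder_le hK0
  obtain ⟨R, hR0, hR⟩ := exists_sum_remainder_le hK0 hd1 C hC
  have hd0 : 0 ≤ d := by linarith
  have hcomplex : ∀ v ∈ complexBall u, ∀ F : Finset ℤ,
      (∀ n ∈ F, ((max N₁ N₂ : ℕ) : ℤ) < |n|) →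
      ∑ n ∈ F, (‖eigC n v - nu₀ n - J₁.mulVec (fourier (fun x => v x) n) 0‖ ^ d +
        ‖normC n v - J₁.mulVec (fourier (fun x => v x) n) 1‖ ^ d) ≤ 2 * R := by
    intro v hv F hF
    have hvK := norm_le_of_mem hv
    have hterm : ∀ n ∈ F, ‖eigC n v - nu₀ n - J₁.mulVec (fourier (fun x => v x) n) 0‖ ^ d +
        ‖normC n v - J₁.mulVec (fourier (fun x => v x) n) 1‖ ^ d ≤
        2 * ((‖D0 (qFun v) (pFun v) n‖ + ‖D0 (pFun v) (qFun v) (-n)‖) + C * remTerm v n) ^ d := by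
      intro n hn
      obtain ⟨h1, h2, -, -, h5⟩ := hN₂ n (hle2 n (hF n hn)) v hv
      obtain ⟨r1, r2⟩ := hrem v hvK n (eigC n v) h1.le h2 h5
      have hnu : ((nu₀ n : ℝ) : ℂ) = Real.pi * n := by simp [nu₀]
      rw [hnu, two_mul]
      exact add_le_add (Real.rpow_le_rpow (norm_nonneg _) r1 hd0)
        (Real.rpow_le_rpow (norm_nonneg _) r2 hd0)
    refine (Finset.sum_le_sum hterm).trans ?_
    rw [← Finset.mul_sum]
    exact mul_le_mul_of_nonneg_left (hR v hvK F) zero_le_two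
  -- The second summand pays for the indices |n| ≤ N of real potentials: there are at most 2N + 1 of
  -- them. Each remainder is at most 5K, because the data are bounded by K and the main term by 4K.
  refine ⟨2 * R + (2 * (max N₁ N₂ : ℕ) + 1) * (2 * (5 * K) ^ d), fun w hw F => ?_,
    fun v hv F hF => (hcomplex v hv F hF).trans (le_add_of_nonneg_right (by positivity))⟩
  rw [← Finset.sum_filter_add_sum_filter_not F (fun n : ℤ => ((max N₁ N₂ : ℕ) : ℤ) < |n|)]
  refine add_le_add ?_ ?_
  · refine le_trans (le_of_eq (Finset.sum_congr rfl fun n hn => ?_)) (hcomplex _ hw _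
      fun n hn => (Finset.mem_filter.1 hn).2)
    obtain ⟨h1, h2⟩ := (hN₁ n (hle1 n (Finset.mem_filter.1 hn).2)).2.2.1 w hw
    rw [h1, h2, Complex.ofReal_sub]
  · have hwK : ‖complexify w‖ ≤ K := norm_le_of_mem hw
    have hwK' : ‖w‖ ≤ K := norm_complexify w ▸ hwK
    refine (Finset.sum_le_card_nsmul _ _ (2 * (5 * K) ^ d) fun n _ => ?_).trans ?_
    · have hM := norm_fourier_le (complexify w) n
      have h1 : ‖((nu w n - nu₀ n : ℝ) : ℂ)‖ ≤ K := by
        rw [Complex.norm_real, Real.norm_eq_abs, nu_eq]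
        exact (abs_nuSeq_sub_le w n).trans hwK'
      have h2 : ‖(normS w n : ℂ)‖ ≤ K := by
        rw [Complex.norm_real, Real.norm_eq_abs]
        exact (abs_normS_le w n).trans hwK'
      rw [two_mul]
      refine add_le_add (Real.rpow_le_rpow (norm_nonneg _) ?_ hd0)
        (Real.rpow_le_rpow (norm_nonneg _) ?_ hd0)
      · refine (norm_sub_le _ _).trans ?_
        linarith [hM 0]
      · refine (norm_sub_le _ _).trans ?_
        linarith [hM 1]
    · rw [nsmul_eq_mul]
      exact mul_le_mul_of_nonneg_right (card_filter_abs_le F _) (by positivity)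

end Asymptotics

/-! ### Mixed boundary conditions -/

section Rotation

open Complex (I)

/-- The rotation of `𝕜²` by the angle `t`. -/
noncomputable def rot {𝕜 : Type*} [RCLike 𝕜] (t : ℝ) (y : EuclideanSpace 𝕜 (Fin 2)) :
    EuclideanSpace 𝕜 (Fin 2) :=
  WithLp.toLp 2 ![(Real.cos t : 𝕜) * y 0 - (Real.sin t : 𝕜) * y 1,
    (Real.sin t : 𝕜) * y 0 + (Real.cos t : 𝕜) * y 1]

variable {𝕜 : Type*} [RCLike 𝕜]

theorem norm_rot (t : ℝ) (y : EuclideanSpace 𝕜 (Fin 2)) : ‖rot t y‖ = ‖y‖ := by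
  rw [EuclideanSpace.norm_eq, EuclideanSpace.norm_eq]
  congr 1
  simp only [Fin.sum_univ_two, rot, RCLike.norm_sq_eq_def, Matrix.cons_val_zero,
    Matrix.cons_val_one, map_add, map_sub, RCLike.mul_re, RCLike.mul_im, RCLike.ofReal_re,
    RCLike.ofReal_im]
  linear_combination (RCLike.re (y 0) ^ 2 + RCLike.re (y 1) ^ 2 + RCLike.im (y 0) ^ 2 +
    RCLike.im (y 1) ^ 2) * Real.sin_sq_add_cos_sq t

theorem continuous_rot :
    Continuous (fun s : ℝ × EuclideanSpace 𝕜 (Fin 2) => rot s.1 s.2) := by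
  unfold rot
  refine (PiLp.continuous_toLp 2 _).comp (continuous_pi fun k => ?_)
  have h0 : Continuous fun s : ℝ × EuclideanSpace 𝕜 (Fin 2) => s.2 0 := by fun_prop
  have h1 : Continuous fun s : ℝ × EuclideanSpace 𝕜 (Fin 2) => s.2 1 := by fun_prop
  have hc : Continuous fun s : ℝ × EuclideanSpace 𝕜 (Fin 2) => (Real.cos s.1 : 𝕜) :=
    RCLike.continuous_ofReal.comp (Real.continuous_cos.comp continuous_fst)
  have hs : Continuous fun s : ℝ × EuclideanSpace 𝕜 (Fin 2) => (Real.sin s.1 : 𝕜) :=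
    RCLike.continuous_ofReal.comp (Real.continuous_sin.comp continuous_fst)
  fin_cases k
  · exact (hc.mul h0).sub (hs.mul h1)
  · exact (hs.mul h0).add (hc.mul h1)

theorem memLp_rot (v : Lp (EuclideanSpace 𝕜 (Fin 2)) 2 μ₀) :
    MemLp (fun x => rot (Real.pi * x) (v x)) 2 μ₀ := by
  have h1 : Continuous fun x : ℝ => Real.pi * x := by fun_prop
  have h2 : AEStronglyMeasurable (fun x : ℝ => (Real.pi * x, v x)) μ₀ :=
    h1.aestronglyMeasurable.prodMk (Lp.aestronglyMeasurable v)
  have h3 := (continuous_rot (𝕜 := 𝕜)).comp_aestronglyMeasurable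
    (f := fun x : ℝ => (Real.pi * x, v x)) h2
  exact (Lp.memLp v).of_le h3 (ae_of_all _ fun _ => (norm_rot _ _).le)

/-- Multiplication by `e^{-πxJ}` on `L²`. -/
noncomputable def rotLp (v : Lp (EuclideanSpace 𝕜 (Fin 2)) 2 μ₀) :
    Lp (EuclideanSpace 𝕜 (Fin 2)) 2 μ₀ := (memLp_rot v).toLp _

theorem coeFn_rotLp (v : Lp (EuclideanSpace 𝕜 (Fin 2)) 2 μ₀) :
    ∀ᵐ x ∂μ₀, rotLp v x = rot (Real.pi * x) (v x) := (memLp_rot v).coeFn_toLp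

theorem norm_rotLp (v : Lp (EuclideanSpace 𝕜 (Fin 2)) 2 μ₀) : ‖rotLp v‖ = ‖v‖ := by
  rw [Lp.norm_def, Lp.norm_def]
  congr 1
  refine eLpNorm_congr_norm_ae ?_
  filter_upwards [coeFn_rotLp v] with x hx
  rw [hx, norm_rot]

/-- Multiplication by `e^{-πxJ}` as a continuous linear map. -/
noncomputable def rotCLM : PotentialC →L[ℂ] PotentialC :=
  LinearMap.mkContinuous
    { toFun := rotLp
      map_add' := fun v w => by
        refine Lp.ext ?_
        filter_upwards [coeFn_rotLp (v + w), coeFn_rotLp v, coeFn_rotLp w, Lp.coeFn_add v w,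
          Lp.coeFn_add (rotLp v) (rotLp w)] with x h1 h2 h3 h4 h5
        rw [h5, Pi.add_apply, h1, h2, h3, h4, Pi.add_apply]
        ext k
        fin_cases k <;> simp [rot] <;> ring
      map_smul' := fun c v => by
        refine Lp.ext ?_
        filter_upwards [coeFn_rotLp (c • v), coeFn_rotLp v, Lp.coeFn_smul c v,
          Lp.coeFn_smul c (rotLp v)] with x h1 h2 h3 h4
        rw [RingHom.id_apply, h4, Pi.smul_apply, h1, h2, h3, Pi.smul_apply]
        ext k
        fin_cases k <;> simp [rot] <;> ring } 1
    (fun v => by rw [one_mul]; exact (norm_rotLp v).le)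

theorem rotCLM_apply (v : PotentialC) : rotCLM v = rotLp v := rfl

theorem complexify_rotLp (w : Potential) : complexify (rotLp w) = rotCLM (complexify w) := by
  rw [rotCLM_apply]
  refine Lp.ext ?_
  filter_upwards [coeFn_complexify (rotLp w), coeFn_complexify w, coeFn_rotLp w,
    coeFn_rotLp (complexify w)] with x h1 h2 h3 h4
  rw [h1, h4, h3, h2]
  ext k
  fin_cases k <;> simp [rot, ofRealVec_apply]

theorem gaugeAdjoint_eq (v : PotentialC) :
    ∀ᵐ x ∂μ₀, gaugeAdjoint (fun x => v x) x = rotCLM v x := by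
  filter_upwards [coeFn_rotLp v] with x hx
  rw [rotCLM_apply, hx, gaugeAdjoint]
  funext k
  fin_cases k
  · simp [expJ, rot, Matrix.mulVec, dotProduct, Fin.sum_univ_two, ← Complex.cos_conj,
      ← Complex.sin_conj]
    ring
  · simp [expJ, rot, Matrix.mulVec, dotProduct, Fin.sum_univ_two, ← Complex.cos_conj,
      ← Complex.sin_conj]

theorem fourier_congr {f g : ℝ → Fin 2 → ℂ} (h : ∀ᵐ x ∂μ₀, f x = g x) (n : ℤ) :
    fourier f n = fourier g n := by
  funext k
  refine integral_congr_ae ?_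
  filter_upwards [h] with x hx
  rw [hx]

theorem qFun_rotCLM (v : PotentialC) :
    ∀ᵐ x ∂μ₀, qFun (rotCLM v) x = Complex.exp (-(I * Real.pi) * x) * qFun v x := by
  filter_upwards [coeFn_rotLp v] with x hx
  rw [qFun, rotCLM_apply, hx, qFun, show -(I * Real.pi) * (x : ℂ) = ((-(Real.pi * x) : ℝ) : ℂ) * I by
    push_cast; ring, Complex.exp_mul_I, ← Complex.ofReal_cos, ← Complex.ofReal_sin, Real.cos_neg,
    Real.sin_neg, Complex.ofReal_neg]
  simp only [rot, Matrix.cons_val_zero, Matrix.cons_val_one, Complex.coe_algebraMap]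
  linear_combination (Real.sin (Real.pi * x) * v x 0) * Complex.I_sq

theorem pFun_rotCLM (v : PotentialC) :
    ∀ᵐ x ∂μ₀, pFun (rotCLM v) x = Complex.exp (I * Real.pi * x) * pFun v x := by
  filter_upwards [coeFn_rotLp v] with x hx
  rw [pFun, rotCLM_apply, hx, pFun, show I * Real.pi * (x : ℂ) = ((Real.pi * x : ℝ) : ℂ) * I by
    push_cast; ring, Complex.exp_mul_I, ← Complex.ofReal_cos, ← Complex.ofReal_sin]
  simp only [rot, Matrix.cons_val_zero, Matrix.cons_val_one, Complex.coe_algebraMap]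
  linear_combination (Real.sin (Real.pi * x) * v x 0) * Complex.I_sq

/-- The factors e^{∓iπx/2} on a and b shift z by π/2 and multiply q and p by e^{∓iπx}, which is what
the rotation of the potential does. The initial values are unaffected, so uniqueness applies. -/
theorem sol_rotCLM (v : PotentialC) (z : ℂ) {x : ℝ} (hx : x ∈ Icc (0 : ℝ) 1) :
    aSol (rotCLM v) (z + Real.pi / 2) x = Complex.exp (-(I * (Real.pi / 2)) * x) * aSol v z x ∧
    bSol (rotCLM v) (z + Real.pi / 2) x = Complex.exp (I * (Real.pi / 2) * x) * bSol v z x := by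
  have h := isSystem_sol v z
  refine (isSystem_sol (rotCLM v) (z + Real.pi / 2)).unique
    (a' := fun x => Complex.exp (-(I * (Real.pi / 2)) * x) * aSol v z x)
    (b' := fun x => Complex.exp (I * (Real.pi / 2) * x) * bSol v z x) ⟨?_, ?_⟩
    (memLp_intervalIntegrable (memLp_qFun _)) (memLp_intervalIntegrable (memLp_pFun _))
    (by simp [aSol_zero]) (by simp [bSol_zero]) hx
  · refine ((prim_cexp (-(I * (Real.pi / 2)))).mul h.1).congr (fun _ _ => rfl) ?_
    filter_upwards [ae_unitInterval (qFun_rotCLM v)] with x hx hx'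
    rw [hx hx']
    have e : Complex.exp (-(I * Real.pi) * x) * Complex.exp (I * (Real.pi / 2) * x) =
        Complex.exp (-(I * (Real.pi / 2)) * x) := by
      rw [← Complex.exp_add]; ring_nf
    linear_combination -(qFun v x * bSol v z x) * e
  · refine ((prim_cexp (I * (Real.pi / 2))).mul h.2).congr (fun _ _ => rfl) ?_
    filter_upwards [ae_unitInterval (pFun_rotCLM v)] with x hx hx'
    rw [hx hx']
    have e : Complex.exp (I * Real.pi * x) * Complex.exp (-(I * (Real.pi / 2)) * x) =
        Complex.exp (I * (Real.pi / 2) * x) := by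
      rw [← Complex.exp_add]; ring_nf
    linear_combination -(pFun v x * aSol v z x) * e

/-- At x = 1 the two factors of `sol_rotCLM` are -i and i, which exchanges the sum and the
difference of a and b, that is, the two components of ϑ(1). -/
theorem theta_rotCLM (v : PotentialC) (z : ℂ) :
    theta (rotCLM v) (z + Real.pi / 2) 1 1 = theta v z 1 0 ∧
    theta (rotCLM v) (z + Real.pi / 2) 1 0 = -theta v z 1 1 := by
  obtain ⟨ha, hb⟩ := sol_rotCLM v z (right_mem_Icc.2 zero_le_one)
  have e1 : Complex.exp (I * (Real.pi / 2) * (1 : ℝ)) = I := by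
    rw [Complex.ofReal_one, mul_one, mul_comm, Complex.exp_pi_div_two_mul_I]
  have e2 : Complex.exp (-(I * (Real.pi / 2)) * (1 : ℝ)) = -I := by
    rw [neg_mul, Complex.exp_neg, e1, Complex.inv_I]
  rw [e2] at ha
  rw [e1] at hb
  rw [theta_one_one, theta_one_zero, theta_one_one, theta_one_zero, ha, hb]
  constructor
  · linear_combination (-(aSol v z 1) / 2 - bSol v z 1 / 2) * Complex.I_sq
  · ring

theorem mem_eigenvalues_rot (v : PotentialC) (z : ℂ) :
    z ∈ eigenvalues 1 0 v ↔ z + (Real.pi / 2 : ℝ) ∈ eigenvalues 1 1 (rotCLM v) := by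
  rw [mem_eigenvalues_iff, mem_eigenvalues_iff, ← (theta_rotCLM v z).1]
  push_cast
  rfl

end Rotation

/-! ### The reflection v ↦ -v, which exchanges the two mixed problems. -/

section Reflection

open Complex (I)

theorem qFun_neg (v : PotentialC) : ∀ᵐ x ∂μ₀, qFun (-v) x = -qFun v x := by
  filter_upwards [Lp.coeFn_neg v] with x hx
  simp only [qFun, hx, Pi.neg_apply, PiLp.neg_apply]
  ring

theorem pFun_neg (v : PotentialC) : ∀ᵐ x ∂μ₀, pFun (-v) x = -pFun v x := by
  filter_upwards [Lp.coeFn_neg v] with x hx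
  simp only [pFun, hx, Pi.neg_apply, PiLp.neg_apply]
  ring

/-- If `f` solves the equation for `v`, then `J f` solves the equation for `-v`. -/
theorem IsSolution.reflect {v : PotentialC} {z : ℂ} {f : ℝ → Fin 2 → ℂ} (hf : IsSolution v z f) :
    IsSolution (-v) z (fun x => ![f x 1, -f x 0]) := by
  have h := isSystem_of_isSolution hf
  have h1 := (h.const_mul I).1
  have h2 := (h.const_mul (-I)).2
  have hs : IsSystem (qFun (-v)) (pFun (-v)) z (fun x => I * (f x 0 - I * f x 1))
      (fun x => -I * (f x 0 + I * f x 1)) := by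
    refine ⟨h1.congr (fun _ _ => rfl) ?_, h2.congr (fun _ _ => rfl) ?_⟩
    · filter_upwards [ae_unitInterval (qFun_neg v)] with x hx hx'
      rw [hx hx']
      ring
    · filter_upwards [ae_unitInterval (pFun_neg v)] with x hx hx'
      rw [hx hx']
      ring
  convert isSolution_of_isSystem hs using 3 with x
  · linear_combination f x 1 * Complex.I_sq
  · congr 1
    linear_combination (-f x 0) * Complex.I_sq

/-- Applying J to a solution exchanges its components up to sign, and with them the two boundary
conditions. -/
theorem mem_eigenvalues_neg (v : PotentialC) (z : ℂ) :
    z ∈ eigenvalues 0 1 v ↔ z ∈ eigenvalues 1 0 (-v) := by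
  have hne : ∀ y : Fin 2 → ℂ, y ≠ 0 → ![y 1, -y 0] ≠ 0 := fun y hy h => hy (by
    have h0 := congrFun h 0
    have h1 := congrFun h 1
    funext k
    fin_cases k
    · simpa using h1
    · simpa using h0)
  constructor
  · rintro ⟨f, hf, ⟨x, hx, hx0⟩, h0, h1⟩
    exact ⟨_, hf.reflect, ⟨x, hx, hne _ hx0⟩, by simpa using h0, by simpa using h1⟩
  · rintro ⟨f, hf, ⟨x, hx, hx0⟩, h0, h1⟩
    have hr := hf.reflect
    rw [neg_neg] at hr
    exact ⟨_, hr, ⟨x, hx, hne _ hx0⟩, by simpa using h0, by simpa using h1⟩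

/-- Existence is inherited from ϑ: if ϑ belongs to -v, then -Jϑ solves the equation for v and starts
at (0, 1). -/
theorem phi_spec (v : PotentialC) (z : ℂ) : IsSolution v z (phi v z) ∧ phi v z 0 = ![0, 1] := by
  obtain ⟨h1, h2⟩ := theta_spec (-v) z
  have h3 := h1.reflect.const_smul (-1)
  rw [neg_neg] at h3
  have : ∃ f, IsSolution v z f ∧ f 0 = ![0, 1] := ⟨_, h3, by
    funext k
    fin_cases k <;> simp [h2]⟩
  exact Classical.epsilon_spec this

theorem phi_one_zero (v : PotentialC) (z : ℂ) : phi v z 1 0 = -theta (-v) z 1 1 := by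
  obtain ⟨h1, h2⟩ := phi_spec v z
  obtain ⟨h3, h4⟩ := theta_spec (-v) z
  have := congrFun (h1.reflect.unique h3 (by simp [h2, h4]) (right_mem_Icc.2 zero_le_one)) 1
  rw [← this]
  simp

end Reflection

/-! ### Transport of the asymptotics to the mixed problems. -/

section Transfer

/-- The eigenvalue asymptotics are transported by isometries of the space of potentials that shift
the eigenvalues. -/
theorem UniformAsymptotics.transfer {i j i' j' : Fin 2} {s₀ s₀' : ℤ → ℝ}
    {s c s' c' : Potential → ℤ → ℝ} {M M' : PotentialC → ℤ → Fin 2 → ℂ}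
    (h : UniformAsymptotics i j s₀ s c M) (W : PotentialC →L[ℂ] PotentialC)
    (V : Potential → Potential) (κ : ℝ) (hW : ∀ v, ‖W v‖ = ‖v‖)
    (hV : ∀ w, complexify (V w) = W (complexify w))
    (heig : ∀ v z, z ∈ eigenvalues i' j' v ↔ z + κ ∈ eigenvalues i j (W v))
    (hs₀ : ∀ n, s₀' n = s₀ n - κ) (hs : ∀ w n, s' w n = s (V w) n - κ)
    (hc : ∀ w n, c' w n = c (V w) n) (hM : ∀ v n, M' v n = M (W v) n) :
    UniformAsymptotics i' j' s₀' s' c' M' := by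
  obtain ⟨hseq, hasym⟩ := h
  -- The radius of the ball depends only on the norm of its center, so the isometry carries the ball
  -- around u into the one around V u.
  have hball : ∀ {u v}, v ∈ complexBall u → W v ∈ complexBall (V u) := fun {u v} hv => by
    have hVu : ‖V u‖ = ‖u‖ := by rw [← norm_complexify, hV, hW, norm_complexify]
    rw [complexBall, Metric.mem_ball, dist_eq_norm, hV, ← map_sub, hW, hVu]
    exact norm_sub_lt_of_mem hv
  refine ⟨fun w => ⟨fun m n hmn => ?_, ?_, ?_⟩, fun u => ?_⟩
  · rw [hs, hs]
    linarith [(hseq (V w)).1 hmn]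
  · ext z
    rw [heig, ← hV, ← (hseq (V w)).2.1]
    simp only [mem_range, hs]
    refine exists_congr fun n => ?_
    rw [Complex.ofReal_sub, sub_eq_iff_eq_add]
  · refine (hseq (V w)).2.2.congr fun n => ?_
    rw [hs, hs₀]
    ring
  · obtain ⟨N, sC, cC, hC, hd⟩ := hasym (V u)
    refine ⟨N, fun n v => sC n (W v) - κ, fun n v => cC n (W v), fun n hn => ?_,
      fun d hd1 hd2 => ?_⟩
    · obtain ⟨h1, h2, h3, h4⟩ := hC n hn
      refine ⟨fun v hv => ((h1 _ (hball hv)).comp (W.analyticAt v)).sub analyticAt_const,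
        fun v hv => (h2 _ (hball hv)).comp (W.analyticAt v), fun w hw => ?_, fun v hv => ?_⟩
      · have hw' := hball hw
        rw [← hV] at hw'
        obtain ⟨e1, e2⟩ := h3 _ hw'
        change sC n (W (complexify w)) - κ = _ ∧ cC n (W (complexify w)) = _
        rw [← hV, e1, e2, hs, hc]
        exact ⟨by push_cast; rfl, rfl⟩
      · have e := h4 _ (hball hv)
        ext z
        have hz := Set.ext_iff.1 e (z + κ)
        rw [mem_inter_iff, mem_singleton_iff, Metric.mem_ball, dist_eq_norm] at hz
        rw [mem_inter_iff, mem_singleton_iff, heig, Metric.mem_ball, dist_eq_norm, hs₀,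
          Complex.ofReal_sub, show z - ((s₀ n : ℂ) - κ) = z + κ - s₀ n by ring, hz,
          eq_sub_iff_add_eq]
    · obtain ⟨C, hC1, hC2⟩ := hd d hd1 hd2
      refine ⟨C, fun w hw F => ?_, fun v hv F hF => ?_⟩
      · have hw' := hball hw
        rw [← hV] at hw'
        refine le_trans (le_of_eq (Finset.sum_congr rfl fun n _ => ?_)) (hC1 _ hw' F)
        rw [hs, hc, hs₀, hM, ← hV, sub_sub_sub_cancel_right]
      · refine le_trans (le_of_eq (Finset.sum_congr rfl fun n _ => ?_)) (hC2 _ (hball hv) F hF)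
        rw [hM, hs₀, Complex.ofReal_sub, sub_sub_sub_cancel_right]

theorem tau₀_eq (n : ℤ) : tau₀ n = nu₀ n - Real.pi / 2 := by
  rw [tau₀, nu₀]
  ring

theorem tau₀_add (n k : ℤ) : tau₀ (n + k) - tau₀ n = Real.pi * k := by
  simp only [tau₀]
  push_cast
  ring

theorem UniformAsymptotics.eigenvalueSeq_eq {i j : Fin 2} {s₀ : ℤ → ℝ} {s c : Potential → ℤ → ℝ}
    {M : PotentialC → ℤ → Fin 2 → ℂ} (h : UniformAsymptotics i j s₀ s c M)
    (hs₀ : ∀ n k, s₀ (n + k) - s₀ n = Real.pi * k) (w : Potential) :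
    eigenvalueSeq i j s₀ w = s w :=
  ZS.eigenvalueSeq_eq hs₀ (h.1 w)

theorem uniformAsymptotics_rho : UniformAsymptotics 1 0 tau₀ rho normU
    (fun v n => J₁.mulVec (fourier (gaugeAdjoint (fun x => v x)) n)) := by
  -- The transfer is made twice. The eigenvalues ϱ are defined by choice, and this first transfer,
  -- with the shifted sequence in their place, identifies them; the second one can then use them and
  -- their norming constants.
  have h : UniformAsymptotics 1 0 tau₀ (fun w n => nu (rotLp w) n - Real.pi / 2)
      (fun w n => normS (rotLp w) n)
      (fun v n => J₁.mulVec (fourier (gaugeAdjoint (fun x => v x)) n)) :=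
    uniformAsymptotics_nu.transfer rotCLM rotLp (Real.pi / 2) norm_rotLp complexify_rotLp
      mem_eigenvalues_rot tau₀_eq (fun _ _ => rfl) (fun _ _ => rfl)
      (fun v n => by rw [fourier_congr (gaugeAdjoint_eq v)])
  have hrho : ∀ w n, rho w n = nu (rotLp w) n - Real.pi / 2 := fun w n =>
    congrFun (h.eigenvalueSeq_eq tau₀_add w) n
  refine uniformAsymptotics_nu.transfer rotCLM rotLp (Real.pi / 2) norm_rotLp complexify_rotLp
      mem_eigenvalues_rot tau₀_eq hrho (fun w n => ?_)
      (fun v n => by rw [fourier_congr (gaugeAdjoint_eq v)])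
  have e := (theta_rotCLM (complexify w) (rho w n)).2
  rw [← complexify_rotLp, hrho, Complex.ofReal_sub, Complex.ofReal_div, Complex.ofReal_ofNat,
    sub_add_cancel] at e
  rw [normU, normS, e, norm_neg, hrho, Complex.ofReal_sub, Complex.ofReal_div,
    Complex.ofReal_ofNat]

theorem complexify_neg (w : Potential) : complexify (-w) = -complexify w :=
  (ofRealVec.compLpL 2 μ₀).map_neg w

/-- The minus sign in the main term of the τ-asymptotics is that of the reflection v ↦ -v. -/
theorem neg_fourier_gaugeAdjoint (v : PotentialC) (n : ℤ) :
    -J₁.mulVec (fourier (gaugeAdjoint (fun x => v x)) n) =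
      J₁.mulVec (fourier (gaugeAdjoint (fun x => (-v : PotentialC) x)) n) := by
  rw [← Matrix.mulVec_neg]
  congr 1
  have h : ∀ᵐ x ∂μ₀, gaugeAdjoint (fun x => (-v : PotentialC) x) x =
      -gaugeAdjoint (fun x => v x) x := by
    filter_upwards [Lp.coeFn_neg v] with x hx
    simp only [gaugeAdjoint]
    rw [hx, Pi.neg_apply, WithLp.ofLp_neg, Matrix.mulVec_neg]
  rw [fourier_congr h]
  funext k
  simp only [fourier, Pi.neg_apply]
  rw [← integral_neg]
  simp only [Matrix.mulVec_neg, Pi.neg_apply]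

theorem uniformAsymptotics_tau : UniformAsymptotics 0 1 tau₀ tau normT
    (fun v n => -J₁.mulVec (fourier (gaugeAdjoint (fun x => v x)) n)) := by
  have hW : ∀ v : PotentialC, ‖(-ContinuousLinearMap.id ℂ PotentialC) v‖ = ‖v‖ := fun v =>
    norm_neg v
  have heig : ∀ (v : PotentialC) (z : ℂ), z ∈ eigenvalues 0 1 v ↔
      z + (0 : ℝ) ∈ eigenvalues 1 0 ((-ContinuousLinearMap.id ℂ PotentialC) v) := fun v z => by
    rw [Complex.ofReal_zero, add_zero]
    exact mem_eigenvalues_neg v z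
  have h : UniformAsymptotics 0 1 tau₀ (fun w n => rho (-w) n - 0) (fun w n => normU (-w) n)
      (fun v n => -J₁.mulVec (fourier (gaugeAdjoint (fun x => v x)) n)) :=
    uniformAsymptotics_rho.transfer (-ContinuousLinearMap.id ℂ PotentialC) (fun w => -w) 0 hW
      complexify_neg heig (fun _ => (sub_zero _).symm) (fun _ _ => rfl) (fun _ _ => rfl)
      neg_fourier_gaugeAdjoint
  have htau : ∀ w n, tau w n = rho (-w) n - 0 := fun w n =>
    congrFun (h.eigenvalueSeq_eq tau₀_add w) n
  refine uniformAsymptotics_rho.transfer (-ContinuousLinearMap.id ℂ PotentialC) (fun w => -w) 0 hW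
      complexify_neg heig (fun _ => (sub_zero _).symm) htau (fun w n => ?_)
      neg_fourier_gaugeAdjoint
  rw [normT, normU, phi_one_zero, norm_neg, htau, sub_zero, complexify_neg]

end Transfer

end ZS

theorem theorem4p9 :
    ZS.UniformAsymptotics 1 1 ZS.nu₀ ZS.nu ZS.normS
      (fun v n => ZS.J₁.mulVec (ZS.fourier (fun x => v x) n)) ∧
    ZS.UniformAsymptotics 0 1 ZS.tau₀ ZS.tau ZS.normT
      (fun v n => -ZS.J₁.mulVec (ZS.fourier (ZS.gaugeAdjoint (fun x => v x)) n)) ∧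
    ZS.UniformAsymptotics 1 0 ZS.tau₀ ZS.rho ZS.normU
      (fun v n => ZS.J₁.mulVec (ZS.fourier (ZS.gaugeAdjoint (fun x => v x)) n)) :=
  ⟨ZS.uniformAsymptotics_nu, ZS.uniformAsymptotics_tau, ZS.uniformAsymptotics_rho⟩
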